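/- **Setting.** Let $d\ge 1$, $p\ge 2$ and $n\le m$ be integers and let $\mathbf n_1,\dots,\mathbf n_d$ be a basis of $\mathbb R^d$ generating the lattice $\Gamma$ with elementary cell $\Omega$. Let $\widetilde\Gamma=\{\mathbf s:\langle \mathbf s,\mathbf n_j\rangle\in2\pi\mathbb Z,\ j=1,\dots,d\}$ be the dual lattice and $\widetilde\Omega=\{\mathbf k\in\mathbb R^d: |\mathbf k|<|\mathbf k-\mathbf s|,\ 0\ne \mathbf s\in\widetilde\Gamma\}$ the central Brillouin zone. Let $\mathbf D=-i\nabla$ and $b(\mathbf D)=\sum_{|\alpha|=p}b_\alpha \mathbf D^\alpha$ with constant complex $(m\times n)$-matrices $b_\alpha$ such that, for some $0<\alpha_0\le\alpha_1<\infty$, $$\alpha_0\mathbf 1_n\le b(\theta)^*b(\theta)\le\alpha_1\mathbf 1_n\quad(\theta\in\mathbb S^{d-1}),\qquad |b_\alpha|\le\alpha_1^{1/2}\quad(|\alpha|=p).$$ Let $g$ be a measurable $\Gamma$-periodic function on $\mathbb R^d$ whose values are Hermitian positive definite $(m\times m)$-matrices, with $g,g^{-1}\in L_\infty$. For a $\Gamma$-periodic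 $\varphi$ put $\varphi^\varepsilon(\mathbf x)=\varphi(\mathbf x/\varepsilon)$. Let $A_\varepsilon=b(\mathbf D)^*g^\varepsilon b(\mathbf D)$ be the selfadjoint operator in $L_2(\mathbb R^d;\mathbb C^n)$ corresponding to the closed form $\int_{\mathbb R^d}\langle g^\varepsilon b(\mathbf D)\mathbf u,b(\mathbf D)\mathbf u\rangle\,d\mathbf x$, $\mathbf u\in H^p(\mathbb R^d;\mathbb C^n)$. Let the $(n\times m)$-matrix-valued function $\Lambda$ be the weak $\Gamma$-periodic solution, with columns in the periodic Sobolev space of order $p$, of $$b(\mathbf D)^*g\,(b(\mathbf D)\Lambda+\mathbf 1_m)=0,\qquad \int_\Omega\Lambda\,d\mathbf x=0,$$ (it exists), and put $\widetilde g=g\,(b(\mathbf D)\Lambda+\mathbf 1_m)$, $g^0=|\Omega|^{-1}\int_\Omega\widetilde g\,d\mathbf x$, $A^0=b(\mathbf D)^*g^0b(\mathbf D)$ (defined, like $A_\varepsilon$, through its form on $H^p$). Let $\Pi_\varepsilon$ be the pseudodifferential operator whose symbol is the characteristic function of $\widetilde\Omega/\varepsilon$, and $$K(\zeta;\varepsilon)=\Lambda^\varepsilon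 b(\mathbf D)(A^0-\zeta I)^{-1}\Pi_\varepsilon .$$ For $\zeta=|\zeta|e^{i\varphi}\in\mathbb C\setminus[0,\infty)$, $0<\varphi<2\pi$, put $c(\varphi)=|\sin\varphi|^{-1}$ if $\varphi\in(0,\pi/2)\cup(3\pi/2,2\pi)$ and $c(\varphi)=1$ if $\varphi\in[\pi/2,3\pi/2]$. The norm in $H^p(\mathbb R^d)$ is $\|\mathbf u\|_{H^p}^2=\int(1+|\xi|^2)^p|\widehat{\mathbf u}(\xi)|^2d\xi$, where $\widehat{\mathbf u}$ is the unitary Fourier transform. **Theorem 8.2.** For every $\zeta=|\zeta|e^{i\varphi}\in\mathbb C\setminus[0,\infty)$ and every $\varepsilon>0$ the resolvents $(A_\varepsilon-\zeta I)^{-1}$ and $(A^0-\zeta I)^{-1}$ exist, $K(\zeta;\varepsilon)$ maps $L_2(\mathbb R^d;\mathbb C^n)$ to $H^p(\mathbb R^d;\mathbb C^n)$, and $$\big\|(A_\varepsilon-\zeta I)^{-1}-(A^0-\zeta I)^{-1}-\varepsilon^pK(\zeta;\varepsilon)\big\|_{L_2(\mathbb R^d)\to H^p(\mathbb R^d)}\le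 \varepsilon\,c(\varphi)^2|\zeta|^{1/(2p)}\left(\mathcal C'|\zeta|^{-1}+\mathcal C''|\zeta|^{-1/2}\right),$$ $$\big\|g^\varepsilon b(\mathbf D)(A_\varepsilon-\zeta I)^{-1}-\widetilde g^\varepsilon b(\mathbf D)(A^0-\zeta I)^{-1}\Pi_\varepsilon\big\|_{L_2(\mathbb R^d)\to L_2(\mathbb R^d)}\le \varepsilon\,c(\varphi)^2\,\mathcal C_4|\zeta|^{1/(2p)-1/2}.$$ The constants $\mathcal C',\mathcal C'',\mathcal C_4$ depend only on $m$, $d$, $p$, $\alpha_0$, $\alpha_1$, on upper bounds for $\|g\|_{L_\infty}$ and $\|g^{-1}\|_{L_\infty}$, and on the parameters of the lattice $\Gamma$ (they do not depend on $n$, $b$, $g$, $\varepsilon$, $\zeta$ otherwise). -/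

import Mathlib

open MeasureTheory FourierTransform
open scoped Matrix Matrix.Norms.L2Operator ComplexOrder ContDiff ENNReal InnerProductSpace

noncomputable section

namespace HighOrderHomog

/-- The space `ℝ^d` with its Euclidean norm. -/
abbrev Space (d : ℕ) := EuclideanSpace ℝ (Fin d)

/-- The space `ℂ^n` with its Euclidean norm. -/
abbrev Vec (n : ℕ) := EuclideanSpace ℂ (Fin n)

/-- The Hilbert space `L₂(ℝ^d; ℂ^n)`. -/
abbrev L2 (d n : ℕ) := Lp (Vec n) 2 (volume : Measure (Space d))

/-- A matrix applied to a vector of `ℂ^n`. -/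
def app {k n : ℕ} (M : Matrix (Fin k) (Fin n) ℂ) (v : Vec n) : Vec k :=
  WithLp.toLp 2 (M *ᵥ v.ofLp)

/-! ### Fourier multipliers and the Sobolev space `H^p(ℝ^d; ℂ^n)`

Mathlib's Fourier transform uses the character `exp (-2πi⟨x, η⟩)`, so that
`û(ξ) = (2π)^(-d/2) ∫ exp (-i⟨x, ξ⟩) u(x) dx` equals `(2π)^(-d/2) (𝓕 u)(ξ / 2π)`:
the frequency `ξ` is `2π η`. -/

/-- The pseudodifferential operator with symbol `M(ξ)`, that is `(Op(M) u)^(ξ) = M(ξ) û(ξ)`,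
for those `u ∈ L₂` for which `M(ξ) û(ξ)` is square integrable (and `0` for the other `u`). -/
def multiplier {d k n : ℕ} (M : Space d → Matrix (Fin k) (Fin n) ℂ) (u : L2 d n) : L2 d k :=
  open Classical in
  if h : MemLp (fun η : Space d => app (M ((2 * Real.pi) • η)) ((𝓕 u : L2 d n) η)) 2 volume then
    𝓕⁻ (h.toLp _)
  else 0

/-- The norm of `H^p(ℝ^d; ℂ^n)`: the square root of `∫ (1 + |ξ|²)^p |û(ξ)|² dξ`
(it is `∞` if `u` is not in `H^p`). -/
def sobolevNorm {d n : ℕ} (p : ℕ) (u : L2 d n) : ℝ≥0∞ :=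
  (∫⁻ η : Space d, ENNReal.ofReal ((1 + ‖(2 * Real.pi) • η‖ ^ 2) ^ p)
    * ‖(𝓕 u : L2 d n) η‖ₑ ^ 2) ^ (1 / 2 : ℝ)

/-- `u ∈ H^p(ℝ^d; ℂ^n)`. -/
def MemSobolev {d n : ℕ} (p : ℕ) (u : L2 d n) : Prop := sobolevNorm p u < ⊤

/-! ### The operators `b(D)` and `b(D)^* g b(D)` on `ℝ^d` -/

/-- The multiindices `α ∈ ℤ₊^d` with `|α| = p`. -/
def multiIndices (d p : ℕ) : Finset (Fin d → ℕ) := Finset.piAntidiag Finset.univ p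

/-- The symbol `b(ξ) = ∑_{|α| = p} b_α ξ^α`. Only the `b α` with `|α| = p` matter. -/
def symbol {d m n : ℕ} (p : ℕ) (b : (Fin d → ℕ) → Matrix (Fin m) (Fin n) ℂ) (ξ : Space d) :
    Matrix (Fin m) (Fin n) ℂ :=
  ∑ α ∈ multiIndices d p, (∏ j, (ξ j : ℂ) ^ α j) • b α

/-- The operator `b(D)`, `D = -i∇`, on `H^p(ℝ^d; ℂ^n)`. -/
def bD {d m n : ℕ} (p : ℕ) (b : (Fin d → ℕ) → Matrix (Fin m) (Fin n) ℂ) (u : L2 d n) : L2 d m :=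
  multiplier (symbol p b) u

/-- The bounds on the coefficients of `b(D)`:
`α₀ 1 ≤ b(θ)^* b(θ) ≤ α₁ 1` for `|θ| = 1`, and `|b_α| ≤ α₁^{1/2}` for `|α| = p`. -/
structure SymbolBounds {d m n : ℕ} (p : ℕ) (b : (Fin d → ℕ) → Matrix (Fin m) (Fin n) ℂ)
    (α₀ α₁ : ℝ) : Prop where
  lower : ∀ θ : Space d, ‖θ‖ = 1 → ∀ c : Vec n, α₀ * ‖c‖ ^ 2 ≤ ‖app (symbol p b θ) c‖ ^ 2
  upper : ∀ θ : Space d, ‖θ‖ = 1 → ∀ c : Vec n, ‖app (symbol p b θ) c‖ ^ 2 ≤ α₁ * ‖c‖ ^ 2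
  coeff : ∀ α ∈ multiIndices d p, ‖b α‖ ≤ √α₁

/-- The sesquilinear form `a[u, v] = ∫ ⟨g(x) b(D)u, b(D)v⟩ dx` (linear in `u`, antilinear
in `v`). -/
def form {d m n : ℕ} (p : ℕ) (b : (Fin d → ℕ) → Matrix (Fin m) (Fin n) ℂ)
    (g : Space d → Matrix (Fin m) (Fin m) ℂ) (u v : L2 d n) : ℂ :=
  ∫ x, ⟪bD p b v x, app (g x) (bD p b u x)⟫_ℂ

/-- `OperatorGraph p b g u f` says that `u ∈ Dom A` and `A u = f`, where `A = b(D)^* g b(D)` is the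
operator in `L₂(ℝ^d; ℂ^n)` that corresponds to the form `a` with domain `H^p(ℝ^d; ℂ^n)`. -/
def OperatorGraph {d m n : ℕ} (p : ℕ) (b : (Fin d → ℕ) → Matrix (Fin m) (Fin n) ℂ)
    (g : Space d → Matrix (Fin m) (Fin m) ℂ) (u f : L2 d n) : Prop :=
  MemSobolev p u ∧ ∀ v : L2 d n, MemSobolev p v → form p b g u v = ⟪v, f⟫_ℂ

/-- `R = (A - ζ I)⁻¹`, the everywhere defined bounded inverse: `R f = u` if and only if
`u ∈ Dom A` and `A u - ζ u = f`. -/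
def IsResolvent {d m n : ℕ} (p : ℕ) (b : (Fin d → ℕ) → Matrix (Fin m) (Fin n) ℂ)
    (g : Space d → Matrix (Fin m) (Fin m) ℂ) (ζ : ℂ) (R : L2 d n →L[ℂ] L2 d n) : Prop :=
  ∀ f u : L2 d n, R f = u ↔ OperatorGraph p b g u (f + ζ • u)

/-! ### The lattice `Γ`, generated by a basis `β` of `ℝ^d` -/

/-- `Γ`-periodicity of a function on `ℝ^d`. -/
def IsPeriodic {d : ℕ} (β : Module.Basis (Fin d) ℝ (Space d)) {X : Type*} (v : Space d → X) :
    Prop :=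
  ∀ γ ∈ Submodule.span ℤ (Set.range β), ∀ x, v (x + γ) = v x

/-- The elementary cell `Ω`. -/
def cell {d : ℕ} (β : Module.Basis (Fin d) ℝ (Space d)) : Set (Space d) :=
  ZSpan.fundamentalDomain β

/-- The dual lattice: all `s` with `⟨s, γ⟩ ∈ 2πℤ` for each `γ` in the basis. -/
def dualLattice {d : ℕ} (β : Module.Basis (Fin d) ℝ (Space d)) : Set (Space d) :=
  {s | ∀ i, ∃ q : ℤ, ⟪s, β i⟫_ℝ = 2 * Real.pi * q}

/-- The central Brillouin zone. -/
def brillouin {d : ℕ} (β : Module.Basis (Fin d) ℝ (Space d)) : Set (Space d) :=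
  {k | ∀ s ∈ dualLattice β, s ≠ 0 → ‖k‖ < ‖k - s‖}

/-- The smoothing operator `Π_ε`: the pseudodifferential operator whose symbol is the
characteristic function of `ε⁻¹` times the Brillouin zone. -/
def smoothing {d n : ℕ} (β : Module.Basis (Fin d) ℝ (Space d)) (ε : ℝ) (u : L2 d n) : L2 d n :=
  multiplier ({ξ : Space d | ε • ξ ∈ brillouin β}.indicator
    (fun _ => (1 : Matrix (Fin n) (Fin n) ℂ))) u

/-- The coefficient matrix: `g` is measurable, `Γ`-periodic, Hermitian and positive definite, with
`‖g‖_{L_∞} ≤ G` and `‖g⁻¹‖_{L_∞} ≤ G'`; in particular `g ≥ c 1` with a constant `c > 0`. -/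
structure IsCoefficient {d m : ℕ} (β : Module.Basis (Fin d) ℝ (Space d))
    (g : Space d → Matrix (Fin m) (Fin m) ℂ) (G G' : ℝ) : Prop where
  measurable : ∀ i j, AEMeasurable (fun x => g x i j) volume
  periodic : IsPeriodic β g
  posDef : ∀ᵐ x, (g x).PosDef
  bound : ∀ᵐ x, ‖g x‖ ≤ G
  bound_inv : ∀ᵐ x, ‖(g x)⁻¹‖ ≤ G'

/-! ### Periodic Sobolev functions and the cell problem -/

/-- The classical partial derivative `∂_j φ`. -/
def partialDeriv {d : ℕ} (j : Fin d) (φ : Space d → ℂ) : Space d → ℂ :=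
  fun x => fderiv ℝ φ x (EuclideanSpace.single j 1)

/-- The classical derivative `∂^α φ`. -/
def iterPartial {d : ℕ} (α : Fin d → ℕ) (φ : Space d → ℂ) : Space d → ℂ :=
  (List.finRange d).foldr (fun j ψ => (partialDeriv j)^[α j] ψ) φ

/-- The periodic function `w ∈ L₂(Ω)` is the weak derivative `∂^α v` of the periodic function `v`,
tested against smooth periodic functions. -/
def IsWeakDeriv {d n : ℕ} (β : Module.Basis (Fin d) ℝ (Space d)) (α : Fin d → ℕ)
    (v w : Space d → Vec n) : Prop :=
  IsPeriodic β w ∧ MemLp w 2 (volume.restrict (cell β)) ∧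
    ∀ φ : Space d → ℂ, ContDiff ℝ (⊤ : ℕ∞) φ → IsPeriodic β φ →
      ∫ x in cell β, iterPartial α φ x • v x
        = (-1 : ℂ) ^ (∑ j, α j) • ∫ x in cell β, φ x • w x

/-- The periodic Sobolev space of order `p`: periodic functions in `L₂(Ω)` whose weak derivatives
up to order `p` exist and are in `L₂(Ω)`. -/
def MemPeriodicSobolev {d n : ℕ} (β : Module.Basis (Fin d) ℝ (Space d)) (p : ℕ)
    (v : Space d → Vec n) : Prop :=
  IsPeriodic β v ∧ MemLp v 2 (volume.restrict (cell β)) ∧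
    ∀ α : Fin d → ℕ, ∑ j, α j ≤ p → ∃ w, IsWeakDeriv β α v w

/-- The weak derivative `∂^α v` (which is unique almost everywhere), if it exists. -/
def weakDeriv {d n : ℕ} (β : Module.Basis (Fin d) ℝ (Space d)) (α : Fin d → ℕ)
    (v : Space d → Vec n) : Space d → Vec n :=
  open Classical in
  if h : ∃ w, IsWeakDeriv β α v w then h.choose else 0

/-- `b(D) v = ∑_{|α| = p} b_α (-i)^p ∂^α v` for a periodic Sobolev function `v`. -/
def periodicBD {d m n : ℕ} (β : Module.Basis (Fin d) ℝ (Space d)) (p : ℕ)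
    (b : (Fin d → ℕ) → Matrix (Fin m) (Fin n) ℂ) (v : Space d → Vec n) (x : Space d) : Vec m :=
  ∑ α ∈ multiIndices d p, app (b α) ((-Complex.I) ^ p • weakDeriv β α v x)

/-- The `j`-th column of a matrix-valued function. -/
def column {d m n : ℕ} (Λ : Space d → Matrix (Fin n) (Fin m) ℂ) (j : Fin m) (x : Space d) :
    Vec n :=
  WithLp.toLp 2 fun i => Λ x i j

/-- `Λ` is the periodic solution of the cell problem
`b(D)^* g (b(D)Λ + 1_m) = 0`, `∫_Ω Λ dx = 0`. Its columns `v_j` are in the periodic Sobolev space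
and satisfy `∫_Ω ⟨g (b(D)v_j + e_j), b(D)w⟩ dx = 0` for each `w` in that space. -/
def IsCellSolution {d m n : ℕ} (β : Module.Basis (Fin d) ℝ (Space d)) (p : ℕ)
    (b : (Fin d → ℕ) → Matrix (Fin m) (Fin n) ℂ) (g : Space d → Matrix (Fin m) (Fin m) ℂ)
    (Λ : Space d → Matrix (Fin n) (Fin m) ℂ) : Prop :=
  ∀ j : Fin m, MemPeriodicSobolev β p (column Λ j) ∧
    (∀ w : Space d → Vec n, MemPeriodicSobolev β p w →
      ∫ x in cell β, ⟪periodicBD β p b w x,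
        app (g x) (periodicBD β p b (column Λ j) x + EuclideanSpace.single j 1)⟫_ℂ = 0) ∧
    ∫ x in cell β, column Λ j x = 0

/-- The matrix `g̃ = g (b(D)Λ + 1_m)`. -/
def gTilde {d m n : ℕ} (β : Module.Basis (Fin d) ℝ (Space d)) (p : ℕ)
    (b : (Fin d → ℕ) → Matrix (Fin m) (Fin n) ℂ) (g : Space d → Matrix (Fin m) (Fin m) ℂ)
    (Λ : Space d → Matrix (Fin n) (Fin m) ℂ) (x : Space d) : Matrix (Fin m) (Fin m) ℂ :=
  g x * ((Matrix.of fun i j => periodicBD β p b (column Λ j) x i) + 1)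

/-- The effective matrix `g⁰ = |Ω|⁻¹ ∫_Ω g̃ dx`. -/
def gEff {d m n : ℕ} (β : Module.Basis (Fin d) ℝ (Space d)) (p : ℕ)
    (b : (Fin d → ℕ) → Matrix (Fin m) (Fin n) ℂ) (g : Space d → Matrix (Fin m) (Fin m) ℂ)
    (Λ : Space d → Matrix (Fin n) (Fin m) ℂ) : Matrix (Fin m) (Fin m) ℂ :=
  Matrix.of fun i j => ((volume.real (cell β) : ℝ) : ℂ)⁻¹ * ∫ x in cell β, gTilde β p b g Λ x i j

/-! ### The operators of the theorem -/

/-- `φ^ε(x) = φ(x / ε)`. -/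
def rescale {d : ℕ} {X : Type*} (ε : ℝ) (φ : Space d → X) (x : Space d) : X := φ (ε⁻¹ • x)

/-- The corrector applied to `f`: the function `Λ^ε b(D) (A⁰ - ζ)⁻¹ Π_ε f`, with `R₀` in the place
of `(A⁰ - ζ)⁻¹`. -/
def corrector {d m n : ℕ} (β : Module.Basis (Fin d) ℝ (Space d)) (p : ℕ)
    (b : (Fin d → ℕ) → Matrix (Fin m) (Fin n) ℂ) (Λ : Space d → Matrix (Fin n) (Fin m) ℂ)
    (ε : ℝ) (R₀ : L2 d n →L[ℂ] L2 d n) (f : L2 d n) (x : Space d) : Vec n :=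
  app (rescale ε Λ x) (bD p b (R₀ (smoothing β ε f)) x)

/-- The error of the flux approximation at `f`: the function
`g^ε b(D) (A_ε - ζ)⁻¹ f - g̃^ε b(D) (A⁰ - ζ)⁻¹ Π_ε f`, with `Rε` and `R₀` in the place of the
two resolvents. -/
def fluxError {d m n : ℕ} (β : Module.Basis (Fin d) ℝ (Space d)) (p : ℕ)
    (b : (Fin d → ℕ) → Matrix (Fin m) (Fin n) ℂ) (g : Space d → Matrix (Fin m) (Fin m) ℂ)
    (Λ : Space d → Matrix (Fin n) (Fin m) ℂ)
    (ε : ℝ) (Rε R₀ : L2 d n →L[ℂ] L2 d n) (f : L2 d n) (x : Space d) : Vec m :=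
  app (rescale ε g x) (bD p b (Rε f) x)
    - app (rescale ε (gTilde β p b g Λ) x) (bD p b (R₀ (smoothing β ε f)) x)

/-- The factor `c(φ)`. -/
def cAngle (φ : ℝ) : ℝ :=
  open Classical in
  if φ ∈ Set.Ioo 0 (Real.pi / 2) ∪ Set.Ioo (3 * Real.pi / 2) (2 * Real.pi) then |Real.sin φ|⁻¹
  else 1

end HighOrderHomog

end

open HighOrderHomog

noncomputable section

namespace HighOrderHomog

/-! The proof is an energy estimate for the error w = u_ε - u₀ - ε^p V, where u_ε and u₀ are the two
resolvents applied to f, y = b(D)(A⁰ - ζ)⁻¹Π_ε f and V = Λ^ε y. Coercivity of the form of A_ε - ζ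
(`form_coercive`) bounds ‖|D|^p w‖² + |ζ|‖w‖², at the price of one factor c(φ), by the residual of
w. With P = (b(D)Λ)^ε y and T = g̃^ε y = g^ε(P + y), `form_sub_eq` splits this residual into five
pairings with w or b(D)w: the term ζε^p V, the smoothing error b(D)u₀ - y behind g^ε and again
behind g⁰, the flux difference T - g⁰y, and the Leibniz remainder ε^p b(D)V - P. Each has to be
O(ε).

All estimates are made in Fourier space. Multiplication by F^ε, F periodic, spreads the transform of
y over its translates by the dual lattice divided by ε, weighted by the Fourier coefficients of F.
The frequencies of y lie in the Brillouin zone divided by ε, whose translates are disjoint, so each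
frequency sees at most one term. Hence the ℓ² norm of the coefficients times ‖y‖ bounds ‖F^ε y‖
(`eLpNorm_le_of_shift`, `exists_fourier_mul_rescale`), and L₂ information on the cell about Λ, b(D)Λ
and g̃ suffices; no boundedness of Λ enters.

On the translate by s, with k in the zone, ε^p b(D) acts as b(k + s). Replacing b(k + s) by b(s)
costs |k|, that is ε times a frequency, times the p-th power of |s| or of |k + s|
(`SymbolBounds.norm_sub_le_dual`, `SymbolBounds.norm_sub_le_add`). The Leibniz remainder is exactly
this replacement. In the flux difference the term s = 0 cancels because g⁰ is the mean of g̃, and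
for s ≠ 0 the cell equation b(s)^* g̃_s = 0 allows b(s) to be subtracted for free
(`IsCellSolution.adjoint_mcoef_gTilde`).

The smoothing error lives at |ξ| ≥ r/ε, where a factor ε|ξ|/r can be inserted. So everything except
ζε^p V is measured by |ξ|^{p+1} û₀. The effective resolvent is estimated at each ξ
(`resolvent_pointwise`), which yields Z^{-(p-1)} with Z = |ζ|^{1/(2p)} and the second factor c(φ).
For ζε^p V, the bound ε|ξ| ≤ M in the zone leaves one power of |ξ|.

Both resolvents, and the solution of the cell problem, come from the same Lax–Milgram lemma
(`exists_inverse_of_coercive`). -/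

/-! ### The dual lattice and exponentials -/

/-- The vector `s` of the dual lattice with `⟨s, x⟩ = 2π ∑ q_j x_j` for `x = ∑ x_j β_j`. -/
def dualVec {d : ℕ} (β : Module.Basis (Fin d) ℝ (Space d)) (q : Fin d → ℤ) : Space d :=
  (InnerProductSpace.toDual ℝ (Space d)).symm
    (LinearMap.toContinuousLinearMap (∑ j, (2 * Real.pi * (q j : ℝ)) • β.coord j))

lemma inner_dualVec {d : ℕ} (β : Module.Basis (Fin d) ℝ (Space d)) (q : Fin d → ℤ) (x : Space d) :
    ⟪dualVec β q, x⟫_ℝ = 2 * Real.pi * ∑ j, (q j : ℝ) * β.repr x j := by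
  rw [dualVec, InnerProductSpace.toDual_symm_apply]
  simp [Finset.mul_sum, mul_assoc]

lemma inner_dualVec_basis {d : ℕ} (β : Module.Basis (Fin d) ℝ (Space d)) (q : Fin d → ℤ)
    (i : Fin d) : ⟪dualVec β q, β i⟫_ℝ = 2 * Real.pi * q i := by
  rw [inner_dualVec]
  simp [Finsupp.single_apply]

lemma ext_inner_basis {d : ℕ} (β : Module.Basis (Fin d) ℝ (Space d)) {s t : Space d}
    (h : ∀ i, ⟪s, β i⟫_ℝ = ⟪t, β i⟫_ℝ) : s = t :=
  InnerProductSpace.ext_inner_right_basis β h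

lemma dualVec_add {d : ℕ} (β : Module.Basis (Fin d) ℝ (Space d)) (q r : Fin d → ℤ) :
    dualVec β (q + r) = dualVec β q + dualVec β r := by
  refine ext_inner_basis β fun i => ?_
  simp only [inner_add_left, inner_dualVec_basis, Pi.add_apply, Int.cast_add]
  ring

lemma dualVec_neg {d : ℕ} (β : Module.Basis (Fin d) ℝ (Space d)) (q : Fin d → ℤ) :
    dualVec β (-q) = -dualVec β q := by
  refine ext_inner_basis β fun i => ?_
  simp only [inner_neg_left, inner_dualVec_basis, Pi.neg_apply, Int.cast_neg]
  ring

lemma dualVec_sub {d : ℕ} (β : Module.Basis (Fin d) ℝ (Space d)) (q r : Fin d → ℤ) :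
    dualVec β (q - r) = dualVec β q - dualVec β r := by
  rw [sub_eq_add_neg, dualVec_add, dualVec_neg, sub_eq_add_neg]

@[simp] lemma dualVec_zero {d : ℕ} (β : Module.Basis (Fin d) ℝ (Space d)) : dualVec β 0 = 0 := by
  refine ext_inner_basis β fun i => ?_
  simp [inner_dualVec_basis]

lemma dualVec_mem {d : ℕ} (β : Module.Basis (Fin d) ℝ (Space d)) (q : Fin d → ℤ) :
    dualVec β q ∈ dualLattice β := fun i => ⟨q i, inner_dualVec_basis β q i⟩

lemma exists_dualVec_eq {d : ℕ} (β : Module.Basis (Fin d) ℝ (Space d)) {s : Space d}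
    (hs : s ∈ dualLattice β) : ∃ q, dualVec β q = s := by
  choose q hq using hs
  exact ⟨q, ext_inner_basis β fun i => by rw [inner_dualVec_basis, hq]⟩

/-- The dual lattice is discrete. -/
lemma exists_le_norm_dualVec {d : ℕ} (β : Module.Basis (Fin d) ℝ (Space d)) :
    ∃ r : ℝ, 0 < r ∧ ∀ q : Fin d → ℤ, q ≠ 0 → 2 * r ≤ ‖dualVec β q‖ := by
  have hS : 0 < 1 + ∑ j, ‖β j‖ := by positivity
  refine ⟨Real.pi / (1 + ∑ j, ‖β j‖), by positivity, fun q hq => ?_⟩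
  obtain ⟨i, hi⟩ := Function.ne_iff.mp hq
  have h1 : 2 * Real.pi ≤ |⟪dualVec β q, β i⟫_ℝ| := by
    rw [inner_dualVec_basis, abs_mul, abs_of_pos Real.two_pi_pos]
    have : (1 : ℝ) ≤ |(q i : ℝ)| := by
      rw [← Int.cast_abs]; exact_mod_cast Int.one_le_abs hi
    nlinarith [Real.pi_pos]
  have h2 : ‖β i‖ ≤ 1 + ∑ j, ‖β j‖ := by
    have := Finset.single_le_sum (f := fun j => ‖β j‖) (fun j _ => norm_nonneg _)
      (Finset.mem_univ i)
    linarith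
  rw [← mul_div_assoc, div_le_iff₀ hS]
  calc 2 * Real.pi ≤ |⟪dualVec β q, β i⟫_ℝ| := h1
    _ ≤ ‖dualVec β q‖ * ‖β i‖ := abs_real_inner_le_norm _ _
    _ ≤ _ := by gcongr

lemma dualVec_ne_zero {d : ℕ} (β : Module.Basis (Fin d) ℝ (Space d)) {q : Fin d → ℤ}
    (hq : q ≠ 0) : dualVec β q ≠ 0 := by
  obtain ⟨r, hr, h⟩ := exists_le_norm_dualVec β
  intro h0
  have := h q hq
  rw [h0, norm_zero] at this
  linarith

/-- The exponential `exp (i⟨s, x⟩)`, where `s` runs over the dual lattice. -/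
def wave {d : ℕ} (β : Module.Basis (Fin d) ℝ (Space d)) (q : Fin d → ℤ) (x : Space d) : ℂ :=
  Complex.exp (Complex.I * (⟪dualVec β q, x⟫_ℝ : ℝ))

lemma norm_wave {d : ℕ} (β : Module.Basis (Fin d) ℝ (Space d)) (q : Fin d → ℤ) (x : Space d) :
    ‖wave β q x‖ = 1 := by
  rw [wave, mul_comm, Complex.norm_exp_ofReal_mul_I]

lemma wave_neg {d : ℕ} (β : Module.Basis (Fin d) ℝ (Space d)) (q : Fin d → ℤ) (x : Space d) :
    wave β (-q) x = (starRingEnd ℂ) (wave β q x) := by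
  rw [wave, wave, ← Complex.exp_conj, dualVec_neg, inner_neg_left]
  simp

@[simp] lemma wave_zero {d : ℕ} (β : Module.Basis (Fin d) ℝ (Space d)) (x : Space d) :
    wave β 0 x = 1 := by simp [wave]

lemma contDiff_wave {d : ℕ} (β : Module.Basis (Fin d) ℝ (Space d)) (q : Fin d → ℤ) {k : WithTop ℕ∞} :
    ContDiff ℝ k (wave β q) := by
  unfold wave
  apply ContDiff.cexp
  apply contDiff_const.mul
  exact Complex.ofRealCLM.contDiff.comp (contDiff_const.inner ℝ contDiff_id)

lemma continuous_wave {d : ℕ} (β : Module.Basis (Fin d) ℝ (Space d)) (q : Fin d → ℤ) :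
    Continuous (wave β q) := (contDiff_wave β q (k := 0)).continuous

lemma isPeriodic_of_basis {d : ℕ} (β : Module.Basis (Fin d) ℝ (Space d)) {X : Type*}
    {v : Space d → X} (h : ∀ i x, v (x + β i) = v x) : IsPeriodic β v := by
  intro γ hγ
  induction hγ using Submodule.span_induction with
  | mem y hy => obtain ⟨i, rfl⟩ := hy; exact h i
  | zero => simp
  | add y z _ _ hy hz => intro x; rw [← add_assoc, hz, hy]
  | smul a y _ hy =>
    intro x
    have hn : ∀ k : ℕ, ∀ x, v (x + (k : ℤ) • y) = v x := by
      intro k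
      induction k with
      | zero => simp
      | succ k ih =>
        intro x
        have : x + ((k + 1 : ℕ) : ℤ) • y = (x + (k : ℤ) • y) + y := by
          push_cast; rw [add_smul, one_smul, add_assoc]
        rw [this, hy, ih]
    rcases Int.eq_nat_or_neg a with ⟨k, rfl | rfl⟩
    · exact hn k x
    · have := hn k (x + (-(k : ℤ)) • y)
      rw [neg_smul, neg_add_cancel_right] at this
      rw [neg_smul, this]

lemma isPeriodic_wave {d : ℕ} (β : Module.Basis (Fin d) ℝ (Space d)) (q : Fin d → ℤ) :
    IsPeriodic β (wave β q) := by
  refine isPeriodic_of_basis β fun i x => ?_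
  rw [wave, wave, inner_add_right, inner_dualVec_basis]
  push_cast
  rw [mul_add, Complex.exp_add]
  have : Complex.exp (Complex.I * (2 * Real.pi * (q i : ℂ))) = 1 := by
    rw [Complex.exp_eq_one_iff]; exact ⟨q i, by ring⟩
  rw [this, mul_one]

/-! ### The normalized measure on the cell -/

/-- The normalized Lebesgue measure on the cell. -/
def cellMeasure {d : ℕ} (β : Module.Basis (Fin d) ℝ (Space d)) : Measure (Space d) :=
  (volume (cell β))⁻¹ • volume.restrict (cell β)

lemma measurableSet_cell {d : ℕ} (β : Module.Basis (Fin d) ℝ (Space d)) :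
    MeasurableSet (cell β) := ZSpan.fundamentalDomain_measurableSet β

lemma volume_cell_ne_zero {d : ℕ} (β : Module.Basis (Fin d) ℝ (Space d)) :
    volume (cell β) ≠ 0 := ZSpan.measure_fundamentalDomain_ne_zero β

lemma volume_cell_ne_top {d : ℕ} (β : Module.Basis (Fin d) ℝ (Space d)) :
    volume (cell β) ≠ ⊤ := (ZSpan.fundamentalDomain_isBounded β).measure_lt_top.ne

instance {d : ℕ} (β : Module.Basis (Fin d) ℝ (Space d)) :
    IsProbabilityMeasure (cellMeasure β) := ⟨by
  rw [cellMeasure, Measure.smul_apply, Measure.restrict_apply_univ, smul_eq_mul,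
    ENNReal.inv_mul_cancel (volume_cell_ne_zero β) (volume_cell_ne_top β)]⟩

lemma volume_real_cell_pos {d : ℕ} (β : Module.Basis (Fin d) ℝ (Space d)) :
    0 < volume.real (cell β) :=
  ENNReal.toReal_pos (volume_cell_ne_zero β) (volume_cell_ne_top β)

lemma integral_cellMeasure {d : ℕ} (β : Module.Basis (Fin d) ℝ (Space d)) {E : Type*}
    [NormedAddCommGroup E] [NormedSpace ℝ E] (f : Space d → E) :
    ∫ x, f x ∂(cellMeasure β) = (volume.real (cell β))⁻¹ • ∫ x in cell β, f x := by
  rw [cellMeasure, integral_smul_measure, ENNReal.toReal_inv, measureReal_def]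

lemma memLp_cellMeasure {d : ℕ} (β : Module.Basis (Fin d) ℝ (Space d)) {E : Type*}
    [NormedAddCommGroup E] {f : Space d → E} {p : ℝ≥0∞} :
    MemLp f p (cellMeasure β) ↔ MemLp f p (volume.restrict (cell β)) := by
  constructor
  · intro h
    have := h.smul_measure (c := volume (cell β)) (volume_cell_ne_top β)
    rwa [cellMeasure, smul_smul, ENNReal.mul_inv_cancel (volume_cell_ne_zero β)
      (volume_cell_ne_top β), one_smul] at this
  · exact fun h => h.smul_measure (ENNReal.inv_ne_top.mpr (volume_cell_ne_zero β))

lemma ae_cellMeasure {d : ℕ} (β : Module.Basis (Fin d) ℝ (Space d)) {P : Space d → Prop} :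
    (∀ᵐ x ∂(cellMeasure β), P x) ↔ ∀ᵐ x ∂(volume.restrict (cell β)), P x := by
  rw [cellMeasure, Measure.ae_ennreal_smul_measure_eq]
  exact ENNReal.inv_ne_zero.mpr (volume_cell_ne_top β)

/-- A periodic property that holds almost everywhere on the cell holds almost everywhere. -/
lemma ae_of_ae_cell {d : ℕ} (β : Module.Basis (Fin d) ℝ (Space d)) {P : Space d → Prop}
    (hP : IsPeriodic β P) (h : ∀ᵐ x ∂(cellMeasure β), P x) : ∀ᵐ x, P x := by
  rw [ae_cellMeasure, ae_restrict_iff' (measurableSet_cell β)] at h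
  -- The lattice is countable, so one null set serves all translates of the cell.
  have h2 : ∀ᵐ x, ∀ γ : Submodule.span ℤ (Set.range β), x + (γ : Space d) ∈ cell β →
      P (x + (γ : Space d)) := by
    rw [ae_all_iff]
    intro γ
    exact (measurePreserving_add_right volume (γ : Space d)).quasiMeasurePreserving.ae h
  filter_upwards [h2] with x hx
  have h3 := hx (-(ZSpan.floor β x)) (by
    have := ZSpan.fract_mem_fundamentalDomain β x
    rw [ZSpan.fract_apply, sub_eq_add_neg] at this
    simpa [cell] using this)
  rwa [hP _ (Submodule.coe_mem _)] at h3

lemma ae_cell_of_ae {d : ℕ} (β : Module.Basis (Fin d) ℝ (Space d)) {P : Space d → Prop}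
    (h : ∀ᵐ x, P x) : ∀ᵐ x ∂(cellMeasure β), P x := by
  rw [ae_cellMeasure]; exact ae_restrict_of_ae h

/-! ### Fourier series on the cell -/

/-- The probability measure on the torus. -/
def torusMeasure (d : ℕ) : Measure (UnitAddTorus (Fin d)) :=
  Measure.pi fun _ => AddCircle.haarAddCircle

lemma measurePreserving_equivIoc_haar :
    MeasurePreserving (fun y : UnitAddCircle => (AddCircle.equivIoc (1 : ℝ) 0 y : ℝ))
      AddCircle.haarAddCircle (volume.restrict (Set.Ioc (0 : ℝ) 1)) := by
  have h1 : (volume : Measure (AddCircle (1 : ℝ))) = AddCircle.haarAddCircle := by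
    rw [AddCircle.volume_eq_smul_haarAddCircle, ENNReal.ofReal_one, one_smul]
  rw [← h1]
  have h2 := (measurePreserving_subtype_coe (μa := (volume : Measure ℝ))
    (s := Set.Ioc (0 : ℝ) (0 + 1)) measurableSet_Ioc).comp
    (AddCircle.measurePreserving_equivIoc (1 : ℝ) (a := 0))
  simpa [Function.comp_def] using h2

/-- The point of (the closure of) the cell that represents a point of the torus. -/
def cellPoint {d : ℕ} (β : Module.Basis (Fin d) ℝ (Space d)) (y : UnitAddTorus (Fin d)) :
    Space d :=
  β.equivFun.symm fun i => (AddCircle.equivIoc (1 : ℝ) 0 (y i) : ℝ)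

/-- A linear isomorphism carries Lebesgue measure to a translation-invariant measure, hence to a
multiple of Lebesgue measure. The multiple is read off from the total mass 1, so no determinant has
to be computed. -/
lemma measurePreserving_equivFun_symm {d : ℕ} (β : Module.Basis (Fin d) ℝ (Space d)) :
    MeasurePreserving β.equivFun.symm
      (Measure.pi fun _ => volume.restrict (Set.Ioc (0 : ℝ) 1)) (cellMeasure β) := by
  let A : (Fin d → ℝ) ≃L[ℝ] Space d := β.equivFunL.symm
  have hA : ∀ x, A x = β.equivFun.symm x := fun x => rfl
  have hmeas : Measurable β.equivFun.symm := A.continuous.measurable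
  refine ⟨hmeas, ?_⟩
  have hpre : A ⁻¹' cell β = Set.pi Set.univ fun _ => Set.Ico (0 : ℝ) 1 := by
    ext x
    simp only [Set.mem_preimage, cell, ZSpan.mem_fundamentalDomain, Set.mem_pi, Set.mem_univ,
      forall_const, hA]
    refine forall_congr' fun i => ?_
    have : β.repr (β.equivFun.symm x) i = x i := by
      rw [← β.equivFun_apply, LinearEquiv.apply_symm_apply]
    rw [this]
  obtain ⟨c, hc⟩ : ∃ c : ℝ≥0∞, Measure.map A (volume : Measure (Fin d → ℝ)) = c • volume :=
    ⟨_, Measure.isAddLeftInvariant_eq_smul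
      (Measure.map A (volume : Measure (Fin d → ℝ))) (volume : Measure (Space d))⟩
  -- The circle is represented by `Ioc`, the cell by `Ico`; both cubes agree with the closed cube up
  -- to a null set.
  have h1 : (Measure.pi fun _ : Fin d => volume.restrict (Set.Ioc (0 : ℝ) 1))
      = volume.restrict (A ⁻¹' cell β) := by
    rw [← Measure.restrict_pi_pi, hpre]
    refine Measure.restrict_congr_set ?_
    exact (Measure.univ_pi_Ioc_ae_eq_Icc (f := fun _ : Fin d => (0 : ℝ)) (g := fun _ => 1)).trans
      (Measure.univ_pi_Ico_ae_eq_Icc (f := fun _ : Fin d => (0 : ℝ)) (g := fun _ => 1)).symm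
  have h2 : Measure.map β.equivFun.symm (volume.restrict (A ⁻¹' cell β))
      = c • volume.restrict (cell β) := by
    have := Measure.restrict_map (μ := (volume : Measure (Fin d → ℝ))) hmeas (measurableSet_cell β)
    rw [← Measure.restrict_smul, ← hc]
    exact this.symm
  have h3 : c * volume (cell β) = 1 := by
    have e1 := congrArg (fun μ : Measure (Space d) => μ Set.univ) h2
    simp only [Measure.smul_apply, Measure.restrict_apply_univ, smul_eq_mul] at e1
    rw [← e1, Measure.map_apply hmeas MeasurableSet.univ, Set.preimage_univ, ← h1,
      Measure.pi_univ]
    simp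
  rw [h1, h2, cellMeasure]
  congr 1
  exact ENNReal.eq_inv_of_mul_eq_one_left h3

lemma measurePreserving_cellPoint {d : ℕ} (β : Module.Basis (Fin d) ℝ (Space d)) :
    MeasurePreserving (cellPoint β) (torusMeasure d) (cellMeasure β) := by
  have h := measurePreserving_pi (fun _ : Fin d => AddCircle.haarAddCircle (T := (1 : ℝ)))
    (fun _ : Fin d => volume.restrict (Set.Ioc (0 : ℝ) 1))
    (fun _ => measurePreserving_equivIoc_haar)
  exact (measurePreserving_equivFun_symm β).comp h

/-- The point of the torus of a point of space. -/
def torusPoint {d : ℕ} (β : Module.Basis (Fin d) ℝ (Space d)) (x : Space d) :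
    UnitAddTorus (Fin d) := fun i => ((β.repr x i : ℝ) : UnitAddCircle)

lemma torusPoint_cellPoint {d : ℕ} (β : Module.Basis (Fin d) ℝ (Space d))
    (y : UnitAddTorus (Fin d)) : torusPoint β (cellPoint β y) = y := by
  funext i
  have : β.repr (cellPoint β y) i = (AddCircle.equivIoc (1 : ℝ) 0 (y i) : ℝ) := by
    rw [cellPoint, ← β.equivFun_apply, LinearEquiv.apply_symm_apply]
  rw [torusPoint, this]
  exact (AddCircle.equivIoc (1 : ℝ) 0).symm_apply_apply (y i)

lemma measurable_torusPoint {d : ℕ} (β : Module.Basis (Fin d) ℝ (Space d)) :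
    Measurable (torusPoint β) := by
  refine measurable_pi_lambda _ fun i => AddCircle.measurable_mk'.comp ?_
  exact (β.equivFunL.continuous.measurable.eval (a := i))

lemma isPeriodic_torusPoint {d : ℕ} (β : Module.Basis (Fin d) ℝ (Space d)) :
    IsPeriodic β (torusPoint β) := by
  refine isPeriodic_of_basis β fun i x => ?_
  funext j
  simp only [torusPoint, map_add, Finsupp.add_apply, Module.Basis.repr_self]
  rw [AddCircle.coe_add]
  rcases eq_or_ne i j with rfl | h
  · rw [Finsupp.single_eq_same, AddCircle.coe_period, add_zero]
  · rw [Finsupp.single_apply, if_neg h]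
    simp

lemma mFourier_torusPoint {d : ℕ} (β : Module.Basis (Fin d) ℝ (Space d)) (q : Fin d → ℤ)
    (x : Space d) : UnitAddTorus.mFourier q (torusPoint β x) = wave β q x := by
  simp only [UnitAddTorus.mFourier, ContinuousMap.coe_mk, torusPoint, fourier_coe_apply]
  rw [← Complex.exp_sum, wave, inner_dualVec]
  congr 1
  push_cast
  rw [Finset.mul_sum, Finset.mul_sum]
  refine Finset.sum_congr rfl fun j _ => ?_
  simp; ring

lemma mFourier_eq_wave {d : ℕ} (β : Module.Basis (Fin d) ℝ (Space d)) (q : Fin d → ℤ)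
    (y : UnitAddTorus (Fin d)) : UnitAddTorus.mFourier q y = wave β q (cellPoint β y) := by
  rw [← mFourier_torusPoint, torusPoint_cellPoint]

/-- The Fourier coefficient of a scalar function on the cell. -/
def fcoef {d : ℕ} (β : Module.Basis (Fin d) ℝ (Space d)) (f : Space d → ℂ) (q : Fin d → ℤ) : ℂ :=
  ∫ x, (starRingEnd ℂ) (wave β q x) * f x ∂(cellMeasure β)

/-- The Fourier basis of `L₂` of the torus. -/
def torusBasis (d : ℕ) : HilbertBasis (Fin d → ℤ) ℂ (Lp ℂ 2 (torusMeasure d)) :=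
  UnitAddTorus.mFourierBasis

lemma coeFn_torusBasis {d : ℕ} (q : Fin d → ℤ) :
    (torusBasis d q : UnitAddTorus (Fin d) → ℂ) =ᵐ[torusMeasure d] UnitAddTorus.mFourier q := by
  have h : torusBasis d q = UnitAddTorus.mFourierLp 2 q :=
    congrFun UnitAddTorus.coe_mFourierBasis q
  rw [h]
  exact UnitAddTorus.coeFn_mFourierLp 2 q

lemma aestronglyMeasurable_conj_wave_mul {d : ℕ} (β : Module.Basis (Fin d) ℝ (Space d))
    {f : Space d → ℂ} {μ : Measure (Space d)} (hf : AEStronglyMeasurable f μ)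
    (q : Fin d → ℤ) :
    AEStronglyMeasurable (fun x => (starRingEnd ℂ) (wave β q x) * f x) μ :=
  (Complex.continuous_conj.comp (continuous_wave β q)).aestronglyMeasurable.mul hf

/-- A function on the cell as an element of `L₂` of the torus. -/
def toTorus {d : ℕ} (β : Module.Basis (Fin d) ℝ (Space d)) {f : Space d → ℂ}
    (hf : MemLp f 2 (cellMeasure β)) : Lp ℂ 2 (torusMeasure d) :=
  (hf.comp_measurePreserving (measurePreserving_cellPoint β)).toLp _

lemma coeFn_toTorus {d : ℕ} (β : Module.Basis (Fin d) ℝ (Space d)) {f : Space d → ℂ}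
    (hf : MemLp f 2 (cellMeasure β)) :
    (toTorus β hf : UnitAddTorus (Fin d) → ℂ) =ᵐ[torusMeasure d] f ∘ cellPoint β :=
  MemLp.coeFn_toLp _

lemma integral_comp_cellPoint {d : ℕ} (β : Module.Basis (Fin d) ℝ (Space d)) {E : Type*}
    [NormedAddCommGroup E] [NormedSpace ℝ E] {f : Space d → E}
    (hf : AEStronglyMeasurable f (cellMeasure β)) :
    ∫ y, f (cellPoint β y) ∂(torusMeasure d) = ∫ x, f x ∂(cellMeasure β) := by
  have hm := measurePreserving_cellPoint β
  rw [← hm.map_eq] at hf ⊢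
  exact (integral_map hm.measurable.aemeasurable hf).symm

lemma inner_toTorus {d : ℕ} (β : Module.Basis (Fin d) ℝ (Space d)) {f g : Space d → ℂ}
    (hf : MemLp f 2 (cellMeasure β)) (hg : MemLp g 2 (cellMeasure β)) :
    ⟪toTorus β hf, toTorus β hg⟫_ℂ = ∫ x, (starRingEnd ℂ) (f x) * g x ∂(cellMeasure β) := by
  have hm : AEStronglyMeasurable (fun x => (starRingEnd ℂ) (f x) * g x) (cellMeasure β) :=
    (Complex.continuous_conj.comp_aestronglyMeasurable hf.1).mul hg.1
  rw [← integral_comp_cellPoint β hm, L2.inner_def]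
  refine integral_congr_ae ?_
  filter_upwards [coeFn_toTorus β hf, coeFn_toTorus β hg] with y h1 h2
  rw [h1, h2, RCLike.inner_apply, mul_comm]
  rfl

lemma inner_torusBasis_toTorus {d : ℕ} (β : Module.Basis (Fin d) ℝ (Space d)) {f : Space d → ℂ}
    (hf : MemLp f 2 (cellMeasure β)) (q : Fin d → ℤ) :
    ⟪torusBasis d q, toTorus β hf⟫_ℂ = fcoef β f q := by
  have hm := aestronglyMeasurable_conj_wave_mul β hf.1 q
  rw [fcoef, ← integral_comp_cellPoint β hm, L2.inner_def]
  refine integral_congr_ae ?_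
  filter_upwards [coeFn_toTorus β hf, coeFn_torusBasis q] with y h1 h2
  rw [h1, h2, RCLike.inner_apply, mul_comm, mFourier_eq_wave β]
  rfl

/-- Parseval's identity on the cell. -/
lemma hasSum_fcoef_mul {d : ℕ} (β : Module.Basis (Fin d) ℝ (Space d)) {f g : Space d → ℂ}
    (hf : MemLp f 2 (cellMeasure β)) (hg : MemLp g 2 (cellMeasure β)) :
    HasSum (fun q => (starRingEnd ℂ) (fcoef β f q) * fcoef β g q)
      (∫ x, (starRingEnd ℂ) (f x) * g x ∂(cellMeasure β)) := by
  rw [← inner_toTorus β hf hg]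
  refine ((torusBasis d).hasSum_inner_mul_inner (toTorus β hf) (toTorus β hg)).congr_fun
    fun q => ?_
  rw [inner_torusBasis_toTorus, ← inner_conj_symm, inner_torusBasis_toTorus]

/-- The Fourier series converges in `L₂` of the cell. -/
lemma tendsto_fourier_series {d : ℕ} (β : Module.Basis (Fin d) ℝ (Space d)) {f : Space d → ℂ}
    (hf : MemLp f 2 (cellMeasure β)) :
    Filter.Tendsto (fun N : Finset (Fin d → ℤ) =>
      eLpNorm (fun x => ∑ q ∈ N, fcoef β f q * wave β q x - f x) 2 (cellMeasure β))
      Filter.atTop (nhds 0) := by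
  have h := (torusBasis d).hasSum_repr (toTorus β hf)
  rw [HasSum, Lp.tendsto_Lp_iff_tendsto_eLpNorm'] at h
  refine h.congr fun N => ?_
  have hm : AEStronglyMeasurable (fun x => ∑ q ∈ N, fcoef β f q * wave β q x - f x)
      (cellMeasure β) := by
    refine AEStronglyMeasurable.sub ?_ hf.1
    exact (continuous_finsetSum _ fun q _ =>
      continuous_const.mul (continuous_wave β q)).aestronglyMeasurable
  rw [← eLpNorm_comp_measurePreserving hm (measurePreserving_cellPoint β)]
  refine eLpNorm_congr_ae ?_
  have h1 : ∀ q, ((torusBasis d).repr (toTorus β hf) q • torusBasis d q :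
      Lp ℂ 2 (torusMeasure d)) =ᵐ[torusMeasure d]
      fun y => fcoef β f q * wave β q (cellPoint β y) := by
    intro q
    filter_upwards [Lp.coeFn_smul ((torusBasis d).repr (toTorus β hf) q) (torusBasis d q),
      coeFn_torusBasis q] with y e1 e2
    rw [e1, Pi.smul_apply, e2, mFourier_eq_wave β, smul_eq_mul, HilbertBasis.repr_apply_apply,
      inner_torusBasis_toTorus]
  have h2 : ((∑ q ∈ N, (torusBasis d).repr (toTorus β hf) q • torusBasis d q :
      Lp ℂ 2 (torusMeasure d)) : UnitAddTorus (Fin d) → ℂ) =ᵐ[torusMeasure d]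
      fun y => ∑ q ∈ N, fcoef β f q * wave β q (cellPoint β y) := by
    filter_upwards [Lp.coeFn_finsetSum N
      (fun q => (torusBasis d).repr (toTorus β hf) q • torusBasis d q),
      (ae_all_iff.mpr h1 : ∀ᵐ y ∂(torusMeasure d), ∀ q, _)] with y e1 e2
    rw [e1, Finset.sum_apply]
    exact Finset.sum_congr rfl fun q _ => e2 q
  filter_upwards [h2, coeFn_toTorus β hf] with y e1 e2
  simp only [Pi.sub_apply, e1, e2, Function.comp_apply]

/-- The Riesz–Fischer theorem on the cell. -/
lemma exists_periodic_of_summable {d : ℕ} (β : Module.Basis (Fin d) ℝ (Space d))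
    {a : (Fin d → ℤ) → ℂ} (ha : Summable fun q => ‖a q‖ ^ 2) :
    ∃ f : Space d → ℂ, IsPeriodic β f ∧ MemLp f 2 (cellMeasure β) ∧ ∀ q, fcoef β f q = a q := by
  have ha' : Memℓp a 2 := by
    refine memℓp_gen ?_
    simpa using ha
  let F : Lp ℂ 2 (torusMeasure d) := (torusBasis d).repr.symm ⟨a, ha'⟩
  have hmp := measurePreserving_cellPoint β
  -- Composing with `torusPoint` gives a function periodic at every point, and it still represents F
  -- because `cellPoint` is a section of `torusPoint`.
  have hsm : StronglyMeasurable (fun x => F (torusPoint β x)) :=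
    (Lp.stronglyMeasurable F).comp_measurable (measurable_torusPoint β)
  have hcomp : (fun x => F (torusPoint β x)) ∘ cellPoint β = F := by
    funext y; simp [torusPoint_cellPoint]
  have hmem : MemLp (fun x => F (torusPoint β x)) 2 (cellMeasure β) := by
    refine ⟨hsm.aestronglyMeasurable, ?_⟩
    rw [← eLpNorm_comp_measurePreserving hsm.aestronglyMeasurable hmp, hcomp]
    exact Lp.eLpNorm_lt_top F
  refine ⟨fun x => F (torusPoint β x), fun γ hγ x => ?_, hmem, fun q => ?_⟩
  · simp only [isPeriodic_torusPoint β γ hγ x]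
  · have h1 : toTorus β hmem = F := by
      refine Lp.ext ((coeFn_toTorus β hmem).trans ?_)
      rw [hcomp]
    rw [← inner_torusBasis_toTorus β hmem, h1, ← HilbertBasis.repr_apply_apply]
    simp [F]

lemma fcoef_congr {d : ℕ} (β : Module.Basis (Fin d) ℝ (Space d)) {f g : Space d → ℂ}
    (h : f =ᵐ[cellMeasure β] g) (q : Fin d → ℤ) : fcoef β f q = fcoef β g q := by
  refine integral_congr_ae ?_
  filter_upwards [h] with x hx
  rw [hx]

lemma integrable_conj_wave_mul {d : ℕ} (β : Module.Basis (Fin d) ℝ (Space d)) {f : Space d → ℂ}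
    (hf : MemLp f 2 (cellMeasure β)) (q : Fin d → ℤ) :
    Integrable (fun x => (starRingEnd ℂ) (wave β q x) * f x) (cellMeasure β) := by
  refine (hf.integrable one_le_two).bdd_mul (c := 1)
    (Complex.continuous_conj.comp (continuous_wave β q)).aestronglyMeasurable ?_
  exact Filter.Eventually.of_forall fun x => by rw [RCLike.norm_conj, norm_wave]

lemma fcoef_add {d : ℕ} (β : Module.Basis (Fin d) ℝ (Space d)) {f g : Space d → ℂ}
    (hf : MemLp f 2 (cellMeasure β)) (hg : MemLp g 2 (cellMeasure β)) (q : Fin d → ℤ) :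
    fcoef β (fun x => f x + g x) q = fcoef β f q + fcoef β g q := by
  simp only [fcoef, mul_add]
  exact integral_add (integrable_conj_wave_mul β hf q) (integrable_conj_wave_mul β hg q)

lemma fcoef_const_mul {d : ℕ} (β : Module.Basis (Fin d) ℝ (Space d)) (f : Space d → ℂ) (c : ℂ)
    (q : Fin d → ℤ) : fcoef β (fun x => c * f x) q = c * fcoef β f q := by
  simp only [fcoef, mul_left_comm _ c]
  exact integral_const_mul _ _

lemma fcoef_sum {d : ℕ} (β : Module.Basis (Fin d) ℝ (Space d)) {ι : Type*} (S : Finset ι)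
    {f : ι → Space d → ℂ} (hf : ∀ i ∈ S, MemLp (f i) 2 (cellMeasure β)) (q : Fin d → ℤ) :
    fcoef β (fun x => ∑ i ∈ S, f i x) q = ∑ i ∈ S, fcoef β (f i) q := by
  simp only [fcoef, Finset.mul_sum]
  exact integral_finsetSum _ fun i hi => integrable_conj_wave_mul β (hf i hi) q

lemma memLp_wave {d : ℕ} (β : Module.Basis (Fin d) ℝ (Space d)) (q : Fin d → ℤ) :
    MemLp (wave β q) 2 (cellMeasure β) :=
  MemLp.of_bound (continuous_wave β q).aestronglyMeasurable 1
    (Filter.Eventually.of_forall fun x => (norm_wave β q x).le)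

lemma fcoef_wave {d : ℕ} (β : Module.Basis (Fin d) ℝ (Space d)) (r q : Fin d → ℤ) :
    fcoef β (wave β r) q = if q = r then 1 else 0 := by
  have h1 : toTorus β (memLp_wave β r) = torusBasis d r := by
    refine Lp.ext ((coeFn_toTorus β _).trans (Filter.EventuallyEq.trans ?_
      (coeFn_torusBasis r).symm))
    exact Filter.Eventually.of_forall fun y => (mFourier_eq_wave β r y).symm
  rw [← inner_torusBasis_toTorus β (memLp_wave β r), h1]
  exact orthonormal_iff_ite.mp (torusBasis d).orthonormal q r

lemma fcoef_zero {d : ℕ} (β : Module.Basis (Fin d) ℝ (Space d)) (f : Space d → ℂ) :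
    fcoef β f 0 = ∫ x, f x ∂(cellMeasure β) := by
  simp [fcoef]

/-- A function is determined almost everywhere on the cell by its Fourier coefficients. -/
lemma ae_eq_of_fcoef_eq {d : ℕ} (β : Module.Basis (Fin d) ℝ (Space d)) {f g : Space d → ℂ}
    (hf : MemLp f 2 (cellMeasure β)) (hg : MemLp g 2 (cellMeasure β))
    (h : ∀ q, fcoef β f q = fcoef β g q) : f =ᵐ[cellMeasure β] g := by
  have h1 := tendsto_fourier_series β (hf.sub hg)
  have h2 : ∀ q, fcoef β (f - g) q = 0 := by
    intro q
    have e : f - g = fun x => f x + (-1) * g x := by funext x; simp; ring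
    rw [e, fcoef_add β hf (hg.const_mul (-1)), fcoef_const_mul, h]; ring
  simp only [h2, zero_mul, Finset.sum_const_zero, zero_sub] at h1
  have h3 := tendsto_nhds_unique h1 tendsto_const_nhds
  have h4 : eLpNorm (-(f - g)) 2 (cellMeasure β) = 0 := h3.symm
  rw [eLpNorm_neg, eLpNorm_eq_zero_iff (hf.sub hg).1 two_ne_zero] at h4
  filter_upwards [h4] with x hx
  exact sub_eq_zero.mp hx

/-! ### Smooth periodic functions -/

/-- Every point is a lattice translate of a point of the cell, whose closure is compact. -/
lemma exists_bound_of_isPeriodic {d : ℕ} (β : Module.Basis (Fin d) ℝ (Space d)) {E : Type*}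
    [NormedAddCommGroup E] {φ : Space d → E} (hc : Continuous φ) (hp : IsPeriodic β φ) :
    ∃ C, ∀ x, ‖φ x‖ ≤ C := by
  have hK : IsCompact (closure (cell β)) :=
    (ZSpan.fundamentalDomain_isBounded β).isCompact_closure
  obtain ⟨C, hC⟩ := hK.exists_bound_of_continuousOn hc.continuousOn
  refine ⟨C, fun x => ?_⟩
  have h1 := hp _ (ZSpan.floor β x).2 (ZSpan.fract β x)
  rw [ZSpan.fract_apply, sub_add_cancel] at h1
  rw [h1, ← ZSpan.fract_apply]
  exact hC _ (subset_closure (ZSpan.fract_mem_fundamentalDomain β x))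

lemma memLp_of_continuous_periodic {d : ℕ} (β : Module.Basis (Fin d) ℝ (Space d))
    {φ : Space d → ℂ} (hc : Continuous φ) (hp : IsPeriodic β φ) (r : ℝ≥0∞) :
    MemLp φ r (cellMeasure β) := by
  obtain ⟨C, hC⟩ := exists_bound_of_isPeriodic β hc hp
  exact MemLp.of_bound hc.aestronglyMeasurable C (Filter.Eventually.of_forall hC)

open scoped Pointwise in
/-- The integral of a periodic function over the cell is invariant under translations. -/
lemma setIntegral_cell_add {d : ℕ} (β : Module.Basis (Fin d) ℝ (Space d))
    {φ : Space d → ℂ} (hp : IsPeriodic β φ) (v : Space d) :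
    ∫ x in cell β, φ (x + v) = ∫ x in cell β, φ x := by
  have hD := ZSpan.isAddFundamentalDomain' β (volume : Measure (Space d))
  have : Countable (Submodule.span ℤ (Set.range β)).toAddSubgroup :=
    inferInstanceAs (Countable (Submodule.span ℤ (Set.range β)))
  -- The translated cell is another fundamental domain of the lattice, and a periodic function has
  -- the same integral over any two of them.
  have hD' := hD.vadd_of_comm v
  have h1 := hD'.setIntegral_eq hD (f := φ) (fun γ x => by
    have := hp γ γ.2 x
    rwa [add_comm] at this)
  change _ = ∫ x in ZSpan.fundamentalDomain β, φ x
  rw [← h1]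
  have hmp := measurePreserving_add_left (volume : Measure (Space d)) v
  have hme : MeasurableEmbedding (fun x : Space d => v + x) := measurableEmbedding_addLeft v
  have h2 := hmp.setIntegral_image_emb hme φ (ZSpan.fundamentalDomain β)
  have h3 : (fun x : Space d => v + x) '' ZSpan.fundamentalDomain β
    = v +ᵥ ZSpan.fundamentalDomain β := rfl
  rw [h3] at h2
  rw [h2]
  simp only [add_comm v, cell]

lemma contDiff_partialDeriv {d : ℕ} (j : Fin d) {φ : Space d → ℂ}
    (hφ : ContDiff ℝ (⊤ : ℕ∞) φ) : ContDiff ℝ (⊤ : ℕ∞) (partialDeriv j φ) := by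
  have h : ContDiff ℝ (⊤ : ℕ∞) (fderiv ℝ φ) := hφ.fderiv_right (by simp)
  exact h.clm_apply contDiff_const

lemma isPeriodic_partialDeriv {d : ℕ} (β : Module.Basis (Fin d) ℝ (Space d)) (j : Fin d)
    {φ : Space d → ℂ} (hp : IsPeriodic β φ) : IsPeriodic β (partialDeriv j φ) := by
  intro γ hγ x
  have h : (fun y => φ (y + γ)) = φ := funext fun y => hp γ hγ y
  rw [partialDeriv, partialDeriv, ← fderiv_comp_add_right, h]

/-- The integral of a partial derivative of a smooth periodic function vanishes. -/
lemma setIntegral_partialDeriv {d : ℕ} (β : Module.Basis (Fin d) ℝ (Space d)) (j : Fin d)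
    {φ : Space d → ℂ} (hφ : ContDiff ℝ (⊤ : ℕ∞) φ) (hp : IsPeriodic β φ) :
    ∫ x in cell β, partialDeriv j φ x = 0 := by
  set e : Space d := EuclideanSpace.single j 1
  have hc := (contDiff_partialDeriv j hφ).continuous
  obtain ⟨C, hC⟩ := exists_bound_of_isPeriodic β hc (isPeriodic_partialDeriv β j hp)
  obtain ⟨C', hC'⟩ := exists_bound_of_isPeriodic β hφ.continuous hp
  have : IsFiniteMeasure (volume.restrict (cell β)) :=
    ⟨by rw [Measure.restrict_apply_univ]; exact (volume_cell_ne_top β).lt_top⟩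
  have hd : ∀ x t, HasDerivAt (fun t : ℝ => φ (x + t • e)) (partialDeriv j φ (x + t • e)) t := by
    intro x t
    have h1 : HasFDerivAt φ (fderiv ℝ φ (x + t • e)) (x + t • e) :=
      ((hφ.differentiable (by simp)) _).hasFDerivAt
    have h2 : HasDerivAt (fun t : ℝ => x + t • e) e t := by
      simpa using ((hasDerivAt_id t).smul_const e).const_add x
    exact h1.comp_hasDerivAt t h2
  -- The integral of φ(x + te) over the cell does not depend on t; its derivative at t = 0, taken
  -- under the integral sign, is the integral in question.
  have key := hasDerivAt_integral_of_dominated_loc_of_deriv_le (μ := volume.restrict (cell β))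
    (F := fun t x => φ (x + t • e)) (F' := fun t x => partialDeriv j φ (x + t • e))
    (x₀ := (0 : ℝ)) (s := Set.univ) (bound := fun _ => C) Filter.univ_mem
    (Filter.Eventually.of_forall fun t =>
      (hφ.continuous.comp (continuous_add_const (t • e))).aestronglyMeasurable)
    (Integrable.of_bound
      (hφ.continuous.comp (continuous_add_const ((0 : ℝ) • e))).aestronglyMeasurable C'
      (Filter.Eventually.of_forall fun x => hC' _))
    (hc.comp (continuous_add_const ((0 : ℝ) • e))).aestronglyMeasurable
    (Filter.Eventually.of_forall fun x t _ => hC _)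
    (integrable_const _)
    (Filter.Eventually.of_forall fun x t _ => hd x t)
  have h3 := key.2
  simp only [setIntegral_cell_add β hp, zero_smul, add_zero] at h3
  exact h3.unique (hasDerivAt_const 0 _)

lemma partialDeriv_wave {d : ℕ} (β : Module.Basis (Fin d) ℝ (Space d)) (q : Fin d → ℤ)
    (j : Fin d) (x : Space d) :
    partialDeriv j (wave β q) x = (Complex.I * (dualVec β q j : ℂ)) * wave β q x := by
  have h1 : HasFDerivAt (fun y : Space d => ⟪dualVec β q, y⟫_ℝ) (innerSL ℝ (dualVec β q)) x :=
    (innerSL ℝ (dualVec β q)).hasFDerivAt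
  have h2 := ((Complex.ofRealCLM.hasFDerivAt.comp x h1).const_mul Complex.I).cexp
  have h3 : HasFDerivAt (wave β q) _ x := h2
  rw [partialDeriv, h3.fderiv]
  simp [wave, EuclideanSpace.inner_single_right]
  ring

/-- The monomial `ξ^α`. -/
def monom {d : ℕ} (α : Fin d → ℕ) (ξ : Space d) : ℂ := ∏ j, (ξ j : ℂ) ^ α j

lemma monom_neg {d : ℕ} (α : Fin d → ℕ) (ξ : Space d) :
    monom α (-ξ) = (-1) ^ (∑ j, α j) * monom α ξ := by
  rw [monom, monom, ← Finset.prod_pow_eq_pow_sum, ← Finset.prod_mul_distrib]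
  refine Finset.prod_congr rfl fun j _ => ?_
  rw [PiLp.neg_apply, Complex.ofReal_neg, neg_pow]

/-- Integration by parts: the derivative of the periodic product of φ and `wave β (-q)` has integral
zero. -/
lemma fcoef_partialDeriv {d : ℕ} (β : Module.Basis (Fin d) ℝ (Space d)) (j : Fin d)
    {φ : Space d → ℂ} (hφ : ContDiff ℝ (⊤ : ℕ∞) φ) (hp : IsPeriodic β φ) (q : Fin d → ℤ) :
    fcoef β (partialDeriv j φ) q = (Complex.I * (dualVec β q j : ℂ)) * fcoef β φ q := by
  have hw : ContDiff ℝ (⊤ : ℕ∞) (wave β (-q)) := contDiff_wave β (-q)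
  have hper : IsPeriodic β (fun x => wave β (-q) x * φ x) := fun γ hγ x => by
    simp only [isPeriodic_wave β (-q) γ hγ x, hp γ hγ x]
  have h0 := setIntegral_partialDeriv β j (hw.mul hφ) hper
  have h1 : ∀ x, partialDeriv j (fun x => wave β (-q) x * φ x) x =
      wave β (-q) x * partialDeriv j φ x
        + (-(Complex.I * (dualVec β q j : ℂ))) * (wave β (-q) x * φ x) := by
    intro x
    have e := fderiv_fun_mul ((hw.differentiable (by simp)) x) ((hφ.differentiable (by simp)) x)
    have e2 := partialDeriv_wave β (-q) j x
    rw [partialDeriv] at e2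
    rw [partialDeriv, e]
    simp only [add_apply, smul_apply, smul_eq_mul, e2,
      partialDeriv, dualVec_neg, PiLp.neg_apply, Complex.ofReal_neg]
    ring
  simp only [h1] at h0
  have m1 := memLp_of_continuous_periodic β (contDiff_partialDeriv j hφ).continuous
    (isPeriodic_partialDeriv β j hp) 2
  have m2 := memLp_of_continuous_periodic β hφ.continuous hp 2
  have i1 := integrable_conj_wave_mul β m1 q
  have i2 := integrable_conj_wave_mul β m2 q
  simp only [← wave_neg] at i1 i2
  have h2 : ∫ x, wave β (-q) x * partialDeriv j φ x
        + (-(Complex.I * (dualVec β q j : ℂ))) * (wave β (-q) x * φ x) ∂(cellMeasure β) = 0 := by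
    rw [integral_cellMeasure, h0, smul_zero]
  rw [integral_add i1 (i2.const_mul _), integral_const_mul] at h2
  simp only [fcoef, ← wave_neg]
  linear_combination h2

lemma fcoef_iterate_partialDeriv {d : ℕ} (β : Module.Basis (Fin d) ℝ (Space d)) (j : Fin d)
    (k : ℕ) {φ : Space d → ℂ} (hφ : ContDiff ℝ (⊤ : ℕ∞) φ) (hp : IsPeriodic β φ) :
    ContDiff ℝ (⊤ : ℕ∞) ((partialDeriv j)^[k] φ) ∧ IsPeriodic β ((partialDeriv j)^[k] φ) ∧
      ∀ q, fcoef β ((partialDeriv j)^[k] φ) q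
        = (Complex.I * (dualVec β q j : ℂ)) ^ k * fcoef β φ q := by
  induction k with
  | zero => simp [hφ, hp]
  | succ k ih =>
    obtain ⟨h1, h2, h3⟩ := ih
    simp only [Function.iterate_succ_apply']
    refine ⟨contDiff_partialDeriv j h1, isPeriodic_partialDeriv β j h2, fun q => ?_⟩
    rw [fcoef_partialDeriv β j h1 h2, h3, pow_succ]; ring

lemma fcoef_iterPartial_aux {d : ℕ} (β : Module.Basis (Fin d) ℝ (Space d)) (α : Fin d → ℕ)
    {φ : Space d → ℂ} (hφ : ContDiff ℝ (⊤ : ℕ∞) φ) (hp : IsPeriodic β φ) (l : List (Fin d)) :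
    ContDiff ℝ (⊤ : ℕ∞) (l.foldr (fun j ψ => (partialDeriv j)^[α j] ψ) φ) ∧
    IsPeriodic β (l.foldr (fun j ψ => (partialDeriv j)^[α j] ψ) φ) ∧
    ∀ q, fcoef β (l.foldr (fun j ψ => (partialDeriv j)^[α j] ψ) φ) q
      = (l.map fun j => (Complex.I * (dualVec β q j : ℂ)) ^ α j).prod * fcoef β φ q := by
  induction l with
  | nil => simp [hφ, hp]
  | cons j l ih =>
    obtain ⟨h1, h2, h3⟩ := ih
    obtain ⟨g1, g2, g3⟩ := fcoef_iterate_partialDeriv β j (α j) h1 h2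
    refine ⟨g1, g2, fun q => ?_⟩
    rw [List.foldr_cons, g3, h3, List.map_cons, List.prod_cons, mul_assoc]

lemma prod_finRange_eq {d : ℕ} (α : Fin d → ℕ) (ξ : Space d) (c : ℂ) :
    ((List.finRange d).map fun j => (c * (ξ j : ℂ)) ^ α j).prod
      = c ^ (∑ j, α j) * monom α ξ := by
  rw [← List.ofFn_eq_map, List.prod_ofFn, monom, ← Finset.prod_pow_eq_pow_sum,
    ← Finset.prod_mul_distrib]
  simp only [mul_pow]

lemma iterPartial_smooth {d : ℕ} (β : Module.Basis (Fin d) ℝ (Space d)) (α : Fin d → ℕ)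
    {φ : Space d → ℂ} (hφ : ContDiff ℝ (⊤ : ℕ∞) φ) (hp : IsPeriodic β φ) :
    ContDiff ℝ (⊤ : ℕ∞) (iterPartial α φ) ∧ IsPeriodic β (iterPartial α φ) :=
  ⟨(fcoef_iterPartial_aux β α hφ hp _).1, (fcoef_iterPartial_aux β α hφ hp _).2.1⟩

lemma fcoef_iterPartial {d : ℕ} (β : Module.Basis (Fin d) ℝ (Space d)) (α : Fin d → ℕ)
    {φ : Space d → ℂ} (hφ : ContDiff ℝ (⊤ : ℕ∞) φ) (hp : IsPeriodic β φ) (q : Fin d → ℤ) :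
    fcoef β (iterPartial α φ) q
      = Complex.I ^ (∑ j, α j) * monom α (dualVec β q) * fcoef β φ q := by
  rw [iterPartial, (fcoef_iterPartial_aux β α hφ hp _).2.2, prod_finRange_eq]

lemma partialDeriv_const_mul {d : ℕ} (j : Fin d) (c : ℂ) {φ : Space d → ℂ}
    (hφ : Differentiable ℝ φ) :
    partialDeriv j (fun x => c * φ x) = fun x => c * partialDeriv j φ x := by
  funext x
  rw [partialDeriv, fderiv_const_mul (hφ x)]
  rfl

lemma iterate_partialDeriv_wave {d : ℕ} (β : Module.Basis (Fin d) ℝ (Space d)) (q : Fin d → ℤ)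
    (j : Fin d) (k : ℕ) (c : ℂ) :
    (partialDeriv j)^[k] (fun x => c * wave β q x)
      = fun x => (Complex.I * (dualVec β q j : ℂ)) ^ k * c * wave β q x := by
  induction k with
  | zero => simp
  | succ k ih =>
    rw [Function.iterate_succ_apply', ih, partialDeriv_const_mul]
    · funext x
      rw [partialDeriv_wave, pow_succ]; ring
    · exact (contDiff_wave β q (k := 1)).differentiable (by simp)

lemma iterPartial_wave {d : ℕ} (β : Module.Basis (Fin d) ℝ (Space d)) (α : Fin d → ℕ)
    (q : Fin d → ℤ) :
    iterPartial α (wave β q)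
      = fun x => Complex.I ^ (∑ j, α j) * monom α (dualVec β q) * wave β q x := by
  rw [iterPartial, ← prod_finRange_eq]
  generalize List.finRange d = l
  induction l with
  | nil => funext x; simp
  | cons j l ih =>
    rw [List.foldr_cons, ih, iterate_partialDeriv_wave, List.map_cons, List.prod_cons]

/-! ### Weak derivatives and Fourier coefficients -/

/-- The Fourier coefficient of a vector-valued function on the cell. -/
def vcoef {d n : ℕ} (β : Module.Basis (Fin d) ℝ (Space d)) (v : Space d → Vec n)
    (q : Fin d → ℤ) : Vec n := WithLp.toLp 2 fun i => fcoef β (fun x => v x i) q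

lemma vcoef_apply {d n : ℕ} (β : Module.Basis (Fin d) ℝ (Space d)) (v : Space d → Vec n)
    (q : Fin d → ℤ) (i : Fin n) : vcoef β v q i = fcoef β (fun x => v x i) q := rfl

lemma memLp_coord {X : Type*} [MeasurableSpace X] {μ : Measure X} {n : ℕ} {v : X → Vec n}
    {r : ℝ≥0∞} (hv : MemLp v r μ) (i : Fin n) : MemLp (fun x => v x i) r μ :=
  (EuclideanSpace.proj (𝕜 := ℂ) i).comp_memLp' hv

lemma memLp_of_coord {X : Type*} [MeasurableSpace X] {μ : Measure X} {n : ℕ} {v : X → Vec n}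
    {r : ℝ≥0∞} (hv : ∀ i, MemLp (fun x => v x i) r μ) : MemLp v r μ := by
  have h : v = fun x => ∑ i, (v x i) • EuclideanSpace.single i (1 : ℂ) := by
    funext x
    ext k
    simp [Pi.single_apply]
  rw [h]
  refine memLp_finsetSum _ fun i _ => ?_
  exact (ContinuousLinearMap.toSpanSingleton ℂ (EuclideanSpace.single i (1 : ℂ))).comp_memLp'
    (hv i)

lemma integral_coord {X : Type*} [MeasurableSpace X] {μ : Measure X} {n : ℕ} {v : X → Vec n}
    (hv : Integrable v μ) (i : Fin n) : (∫ x, v x ∂μ) i = ∫ x, v x i ∂μ :=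
  ((EuclideanSpace.proj (𝕜 := ℂ) i).integral_comp_comm hv).symm

/-- Test with `wave β (-q)`, an eigenfunction of every ∂^α. The sign in the definition of the weak
derivative cancels the sign of the monomial at the negative dual vector. -/
lemma fcoef_of_isWeakDeriv {d n : ℕ} (β : Module.Basis (Fin d) ℝ (Space d)) {α : Fin d → ℕ}
    {v w : Space d → Vec n} (hv : MemLp v 2 (cellMeasure β)) (h : IsWeakDeriv β α v w)
    (q : Fin d → ℤ) :
    vcoef β w q = (Complex.I ^ (∑ j, α j) * monom α (dualVec β q)) • vcoef β v q := by
  have hw := (memLp_cellMeasure β).mpr h.2.1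
  have h1 := h.2.2 (wave β (-q)) (contDiff_wave β (-q)) (isPeriodic_wave β (-q))
  have h2 := congrArg (fun z => ((volume.real (cell β))⁻¹ : ℝ) • z) h1
  rw [smul_comm, ← integral_cellMeasure, ← integral_cellMeasure, iterPartial_wave] at h2
  have hb : ∀ (c : ℂ) {u : Space d → Vec n}, MemLp u 2 (cellMeasure β) →
      Integrable (fun x => (c * wave β (-q) x) • u x) (cellMeasure β) := fun c u hu => by
    refine (hu.integrable one_le_two).bdd_smul ‖c‖
      (continuous_const.mul (continuous_wave β (-q))).aestronglyMeasurable ?_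
    exact Filter.Eventually.of_forall fun x => by rw [Pi.mul_apply, norm_mul, norm_wave, mul_one]
  ext i
  have h3 := congrArg (fun z : Vec n => z i) h2
  have hb1 := hb 1 hw
  simp only [one_mul] at hb1
  simp only [PiLp.smul_apply] at h3
  rw [integral_coord (hb _ hv), integral_coord hb1] at h3
  have e1 : ∀ m : ℂ, ∫ x, ((m * wave β (-q) x) • v x) i ∂(cellMeasure β)
      = m * fcoef β (fun x => v x i) q := fun m => by
    rw [fcoef, ← integral_const_mul]
    refine integral_congr_ae (Filter.Eventually.of_forall fun x => ?_)
    simp only [PiLp.smul_apply, smul_eq_mul, wave_neg]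
    ring
  have e2 : ∫ x, (wave β (-q) x • w x) i ∂(cellMeasure β) = fcoef β (fun x => w x i) q := by
    refine integral_congr_ae (Filter.Eventually.of_forall fun x => ?_)
    simp only [PiLp.smul_apply, smul_eq_mul, wave_neg]
  rw [e1, e2] at h3
  rw [dualVec_neg, monom_neg] at h3
  simp only [PiLp.smul_apply, vcoef_apply, smul_eq_mul] at h3 ⊢
  have e4 : ((-1 : ℂ) ^ (∑ j, α j)) ≠ 0 := by simp
  refine mul_left_cancel₀ e4 ?_
  rw [← h3]; ring

lemma fcoef_conj {d : ℕ} (β : Module.Basis (Fin d) ℝ (Space d)) (f : Space d → ℂ)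
    (q : Fin d → ℤ) :
    fcoef β (fun x => (starRingEnd ℂ) (f x)) q = (starRingEnd ℂ) (fcoef β f (-q)) := by
  rw [fcoef, fcoef, ← integral_conj]
  simp only [map_mul, wave_neg, Complex.conj_conj]

/-- Parseval expands both sides of the weak identity, and the sums agree term by term. Together with
`fcoef_of_isWeakDeriv` this makes weak differentiability a condition on coefficients alone. -/
lemma isWeakDeriv_of_fcoef {d n : ℕ} (β : Module.Basis (Fin d) ℝ (Space d)) {α : Fin d → ℕ}
    {v w : Space d → Vec n} (hv : MemLp v 2 (cellMeasure β)) (hw : MemLp w 2 (cellMeasure β))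
    (hper : IsPeriodic β w)
    (h : ∀ q, vcoef β w q = (Complex.I ^ (∑ j, α j) * monom α (dualVec β q)) • vcoef β v q) :
    IsWeakDeriv β α v w := by
  refine ⟨hper, (memLp_cellMeasure β).mp hw, fun φ hφ hφp => ?_⟩
  obtain ⟨hs, hsp⟩ := iterPartial_smooth β α hφ hφp
  have hvol : ((volume.real (cell β))⁻¹ : ℝ) ≠ 0 := (inv_pos.mpr (volume_real_cell_pos β)).ne'
  refine smul_right_injective _ hvol ?_
  simp only
  rw [smul_comm, ← integral_cellMeasure, ← integral_cellMeasure]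
  have hb : ∀ {ψ : Space d → ℂ} {u : Space d → Vec n}, Continuous ψ → IsPeriodic β ψ →
      MemLp u 2 (cellMeasure β) →
      Integrable (fun x => ψ x • u x) (cellMeasure β) := fun {ψ u} h1 h2 hu => by
    obtain ⟨C, hC⟩ := exists_bound_of_isPeriodic β h1 h2
    exact (hu.integrable one_le_two).bdd_smul C h1.aestronglyMeasurable
      (Filter.Eventually.of_forall hC)
  have hP : ∀ {ψ : Space d → ℂ} {u : Space d → Vec n}, Continuous ψ → IsPeriodic β ψ →
      MemLp u 2 (cellMeasure β) → ∀ i,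
      HasSum (fun q => fcoef β ψ (-q) * vcoef β u q i)
        (∫ x, (ψ x • u x) i ∂(cellMeasure β)) := fun {ψ u} h1 h2 hu i => by
    have := hasSum_fcoef_mul β (f := fun x => (starRingEnd ℂ) (ψ x))
      (memLp_of_continuous_periodic β (φ := fun x => (starRingEnd ℂ) (ψ x))
        (Complex.continuous_conj.comp h1)
        (fun γ hγ x => by simp only [h2 γ hγ x]) 2) (memLp_coord hu i)
    simpa only [fcoef_conj, Complex.conj_conj] using! this
  ext i
  rw [PiLp.smul_apply, integral_coord (hb hs.continuous hsp hv),
    integral_coord (hb hφ.continuous hφp hw)]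
  have s1 := hP hs.continuous hsp hv i
  have s2 := (hP hφ.continuous hφp hw i).mul_left ((-1 : ℂ) ^ (∑ j, α j))
  refine s1.unique (s2.congr_fun fun q => ?_)
  rw [fcoef_iterPartial β α hφ hφp, dualVec_neg, monom_neg, h q, PiLp.smul_apply, smul_eq_mul]
  ring

/-! ### Matrices applied to vectors -/

lemma app_apply {k n : ℕ} (M : Matrix (Fin k) (Fin n) ℂ) (v : Vec n) (i : Fin k) :
    app M v i = ∑ j, M i j * v j := rfl

lemma norm_app_le {k n : ℕ} (M : Matrix (Fin k) (Fin n) ℂ) (v : Vec n) :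
    ‖app M v‖ ≤ ‖M‖ * ‖v‖ := Matrix.l2_opNorm_mulVec M v

lemma app_add {k n : ℕ} (M : Matrix (Fin k) (Fin n) ℂ) (u v : Vec n) :
    app M (u + v) = app M u + app M v := by
  ext i; simp [app_apply, mul_add, Finset.sum_add_distrib]

lemma app_sub {k n : ℕ} (M : Matrix (Fin k) (Fin n) ℂ) (u v : Vec n) :
    app M (u - v) = app M u - app M v := by
  ext i; simp [app_apply, mul_sub, Finset.sum_sub_distrib]

lemma app_smul {k n : ℕ} (M : Matrix (Fin k) (Fin n) ℂ) (c : ℂ) (u : Vec n) :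
    app M (c • u) = c • app M u := by
  ext i; simp [app_apply, Finset.mul_sum, mul_left_comm]

@[simp] lemma app_zero {k n : ℕ} (M : Matrix (Fin k) (Fin n) ℂ) : app M 0 = 0 := by
  ext i; simp [app_apply]

lemma add_app {k n : ℕ} (M N : Matrix (Fin k) (Fin n) ℂ) (u : Vec n) :
    app (M + N) u = app M u + app N u := by
  ext i; simp [app_apply, add_mul, Finset.sum_add_distrib]

lemma sub_app {k n : ℕ} (M N : Matrix (Fin k) (Fin n) ℂ) (u : Vec n) :
    app (M - N) u = app M u - app N u := by
  ext i; simp [app_apply, sub_mul, Finset.sum_sub_distrib]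

lemma smul_app {k n : ℕ} (c : ℂ) (M : Matrix (Fin k) (Fin n) ℂ) (u : Vec n) :
    app (c • M) u = c • app M u := by
  ext i; simp [app_apply, Finset.mul_sum, mul_assoc]

@[simp] lemma zero_app {k n : ℕ} (u : Vec n) : app (0 : Matrix (Fin k) (Fin n) ℂ) u = 0 := by
  ext i; simp [app_apply]

@[simp] lemma one_app {n : ℕ} (u : Vec n) : app (1 : Matrix (Fin n) (Fin n) ℂ) u = u := by
  ext i; simp [app_apply, Matrix.one_apply]

lemma sum_app {k n : ℕ} {ι : Type*} (S : Finset ι) (M : ι → Matrix (Fin k) (Fin n) ℂ) (u : Vec n) :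
    app (∑ i ∈ S, M i) u = ∑ i ∈ S, app (M i) u := by
  classical
  induction S using Finset.induction_on with
  | empty => simp
  | insert a S ha ih => rw [Finset.sum_insert ha, Finset.sum_insert ha, add_app, ih]

lemma mul_app {k l n : ℕ} (M : Matrix (Fin k) (Fin l) ℂ) (N : Matrix (Fin l) (Fin n) ℂ)
    (u : Vec n) : app (M * N) u = app M (app N u) := by
  simp [app, Matrix.mulVec_mulVec]

lemma inner_app_left {k n : ℕ} (M : Matrix (Fin k) (Fin n) ℂ) (u : Vec n) (v : Vec k) :
    ⟪app M u, v⟫_ℂ = ⟪u, app Mᴴ v⟫_ℂ := by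
  simp only [PiLp.inner_apply, RCLike.inner_apply, app_apply, map_sum, map_mul,
    Matrix.conjTranspose_apply, Finset.mul_sum, Finset.sum_mul]
  rw [Finset.sum_comm]
  refine Finset.sum_congr rfl fun i _ => Finset.sum_congr rfl fun j _ => ?_
  rw [Complex.star_def]; ring

lemma inner_app_right {k n : ℕ} (M : Matrix (Fin k) (Fin n) ℂ) (u : Vec k) (v : Vec n) :
    ⟪u, app M v⟫_ℂ = ⟪app Mᴴ u, v⟫_ℂ := by
  rw [inner_app_left, Matrix.conjTranspose_conjTranspose]

/-- A matrix as a continuous linear map. -/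
def appL {k n : ℕ} (M : Matrix (Fin k) (Fin n) ℂ) : Vec n →L[ℂ] Vec k :=
  LinearMap.mkContinuous
    { toFun := app M, map_add' := app_add M, map_smul' := app_smul M } ‖M‖ (norm_app_le M)

@[simp] lemma appL_apply {k n : ℕ} (M : Matrix (Fin k) (Fin n) ℂ) (v : Vec n) :
    appL M v = app M v := rfl

/-- The square of the Frobenius norm. -/
def frobSq {k n : ℕ} (M : Matrix (Fin k) (Fin n) ℂ) : ℝ := ∑ i, ∑ j, ‖M i j‖ ^ 2

lemma frobSq_nonneg {k n : ℕ} (M : Matrix (Fin k) (Fin n) ℂ) : 0 ≤ frobSq M := by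
  unfold frobSq; positivity

lemma norm_app_sq_le {k n : ℕ} (M : Matrix (Fin k) (Fin n) ℂ) (v : Vec n) :
    ‖app M v‖ ^ 2 ≤ frobSq M * ‖v‖ ^ 2 := by
  rw [EuclideanSpace.norm_sq_eq, EuclideanSpace.norm_sq_eq, frobSq, Finset.sum_mul]
  refine Finset.sum_le_sum fun i _ => ?_
  calc ‖app M v i‖ ^ 2 ≤ (∑ j, ‖M i j‖ * ‖v j‖) ^ 2 := by
        gcongr
        rw [app_apply]
        refine (norm_sum_le _ _).trans (le_of_eq ?_)
        simp only [norm_mul]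
    _ ≤ _ := Finset.sum_mul_sq_le_sq_mul_sq _ _ _

lemma norm_app_le_sqrt {k n : ℕ} (M : Matrix (Fin k) (Fin n) ℂ) (v : Vec n) :
    ‖app M v‖ ≤ √(frobSq M) * ‖v‖ := by
  rw [← Real.sqrt_sq (norm_nonneg v), ← Real.sqrt_mul (frobSq_nonneg M)]
  exact Real.le_sqrt_of_sq_le (norm_app_sq_le M v)

lemma norm_le_of_norm_app_le {k n : ℕ} {M : Matrix (Fin k) (Fin n) ℂ} {C : ℝ} (hC : 0 ≤ C)
    (h : ∀ v, ‖app M v‖ ≤ C * ‖v‖) : ‖M‖ ≤ C := by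
  rw [Matrix.l2_opNorm_def]
  exact ContinuousLinearMap.opNorm_le_bound _ hC h

lemma aestronglyMeasurable_of_coord {X : Type*} [MeasurableSpace X] {μ : Measure X} {n : ℕ}
    {v : X → Vec n} (hv : ∀ i, AEStronglyMeasurable (fun x => v x i) μ) :
    AEStronglyMeasurable v μ := by
  have h : v = fun x => ∑ i, (v x i) • EuclideanSpace.single i (1 : ℂ) := by
    funext x
    ext k
    simp [Pi.single_apply]
  rw [h]
  exact Finset.aestronglyMeasurable_fun_sum _ fun i _ => (hv i).smul_const _

lemma AEStronglyMeasurable.coord {X : Type*} [MeasurableSpace X] {μ : Measure X} {n : ℕ}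
    {v : X → Vec n} (hv : AEStronglyMeasurable v μ) (i : Fin n) :
    AEStronglyMeasurable (fun x => v x i) μ :=
  (EuclideanSpace.proj (𝕜 := ℂ) i).continuous.comp_aestronglyMeasurable hv

lemma aestronglyMeasurable_app {X : Type*} [MeasurableSpace X] {μ : Measure X} {k n : ℕ}
    {M : X → Matrix (Fin k) (Fin n) ℂ} (hM : ∀ i j, AEMeasurable (fun x => M x i j) μ)
    {v : X → Vec n} (hv : AEStronglyMeasurable v μ) :
    AEStronglyMeasurable (fun x => app (M x) (v x)) μ := by
  refine aestronglyMeasurable_of_coord fun i => ?_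
  simp only [app_apply]
  exact Finset.aestronglyMeasurable_fun_sum _ fun j _ =>
    (hM i j).aestronglyMeasurable.mul (AEStronglyMeasurable.coord hv j)

/-! ### Estimates of the symbol -/

lemma symbol_eq {d m n : ℕ} (p : ℕ) (b : (Fin d → ℕ) → Matrix (Fin m) (Fin n) ℂ) (ξ : Space d) :
    symbol p b ξ = ∑ α ∈ multiIndices d p, monom α ξ • b α := rfl

lemma sum_of_mem_multiIndices {d p : ℕ} {α : Fin d → ℕ} (h : α ∈ multiIndices d p) :
    ∑ j, α j = p := (Finset.mem_piAntidiag.mp h).1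

lemma monom_smul {d : ℕ} (α : Fin d → ℕ) (t : ℝ) (ξ : Space d) :
    monom α (t • ξ) = (t : ℂ) ^ (∑ j, α j) * monom α ξ := by
  rw [monom, monom, ← Finset.prod_pow_eq_pow_sum, ← Finset.prod_mul_distrib]
  refine Finset.prod_congr rfl fun j _ => ?_
  rw [PiLp.smul_apply, smul_eq_mul, Complex.ofReal_mul, mul_pow]

lemma continuous_monom {d : ℕ} (α : Fin d → ℕ) : Continuous (monom α) := by
  unfold monom
  fun_prop

lemma norm_monom_le {d : ℕ} (α : Fin d → ℕ) (ξ : Space d) :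
    ‖monom α ξ‖ ≤ ‖ξ‖ ^ (∑ j, α j) := by
  rw [monom, norm_prod, ← Finset.prod_pow_eq_pow_sum]
  refine Finset.prod_le_prod (fun _ _ => norm_nonneg _) fun j _ => ?_
  rw [norm_pow, Complex.norm_real]
  gcongr
  exact PiLp.norm_apply_le ξ j

lemma symbol_smul {d m n : ℕ} (p : ℕ) (b : (Fin d → ℕ) → Matrix (Fin m) (Fin n) ℂ) (t : ℝ)
    (ξ : Space d) : symbol p b (t • ξ) = (t : ℂ) ^ p • symbol p b ξ := by
  rw [symbol_eq, symbol_eq, Finset.smul_sum]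
  refine Finset.sum_congr rfl fun α hα => ?_
  rw [monom_smul, sum_of_mem_multiIndices hα, smul_smul]

lemma continuous_symbol_apply {d m n : ℕ} (p : ℕ) (b : (Fin d → ℕ) → Matrix (Fin m) (Fin n) ℂ)
    (i : Fin m) (j : Fin n) : Continuous fun ξ => symbol p b ξ i j := by
  simp only [symbol_eq, Matrix.sum_apply, Matrix.smul_apply]
  exact continuous_finsetSum _ fun α _ => (continuous_monom α).smul continuous_const

lemma SymbolBounds.norm_bounds {d m n p : ℕ} (hd : 1 ≤ d)
    {b : (Fin d → ℕ) → Matrix (Fin m) (Fin n) ℂ} {α₀ α₁ : ℝ} (hα₀ : 0 ≤ α₀) (hα₁ : 0 ≤ α₁)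
    (hb : SymbolBounds p b α₀ α₁) (ξ : Space d) (c : Vec n) :
    √α₀ * (‖ξ‖ ^ p * ‖c‖) ≤ ‖app (symbol p b ξ) c‖ ∧
      ‖app (symbol p b ξ) c‖ ≤ √α₁ * (‖ξ‖ ^ p * ‖c‖) := by
  obtain ⟨θ, hθ, hξ⟩ : ∃ θ : Space d, ‖θ‖ = 1 ∧ ξ = ‖ξ‖ • θ := by
    by_cases h : ξ = 0
    -- At ξ = 0 any unit vector serves as direction; one exists because d ≥ 1.
    · exact ⟨EuclideanSpace.single ⟨0, hd⟩ 1, by simp, by simp [h]⟩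
    · refine ⟨‖ξ‖⁻¹ • ξ, norm_smul_inv_norm h, ?_⟩
      rw [smul_smul, mul_inv_cancel₀ (norm_ne_zero_iff.mpr h), one_smul]
  have e : ‖app (symbol p b ξ) c‖ = ‖ξ‖ ^ p * ‖app (symbol p b θ) c‖ := by
    conv_lhs => rw [hξ]
    rw [symbol_smul, smul_app, norm_smul, norm_pow, Complex.norm_real, norm_norm]
  have h1 : √α₀ * ‖c‖ ≤ ‖app (symbol p b θ) c‖ := by
    refine (sq_le_sq₀ (by positivity) (norm_nonneg _)).mp ?_
    rw [mul_pow, Real.sq_sqrt hα₀]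
    exact hb.lower θ hθ c
  have h2 : ‖app (symbol p b θ) c‖ ≤ √α₁ * ‖c‖ := by
    refine (sq_le_sq₀ (norm_nonneg _) (by positivity)).mp ?_
    rw [mul_pow, Real.sq_sqrt hα₁]
    exact hb.upper θ hθ c
  rw [e]
  constructor
  · calc _ = ‖ξ‖ ^ p * (√α₀ * ‖c‖) := by ring
      _ ≤ _ := by gcongr
  · calc _ ≤ ‖ξ‖ ^ p * (√α₁ * ‖c‖) := by gcongr
      _ = _ := by ring

/-- The factor R on the left replaces the exponent k - 1 on the right, so that k = 0 needs no
separate treatment. -/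
lemma norm_pow_sub_pow_mul_le {a b : ℂ} {R δ : ℝ} (ha : ‖a‖ ≤ R) (hb : ‖b‖ ≤ R)
    (hab : ‖a - b‖ ≤ δ) (k : ℕ) : ‖a ^ k - b ^ k‖ * R ≤ k * δ * R ^ k := by
  have hR : 0 ≤ R := (norm_nonneg a).trans ha
  have hδ : 0 ≤ δ := (norm_nonneg _).trans hab
  induction k with
  | zero => simp
  | succ k ih =>
    have e : a ^ (k + 1) - b ^ (k + 1) = a * (a ^ k - b ^ k) + (a - b) * b ^ k := by ring
    calc ‖a ^ (k + 1) - b ^ (k + 1)‖ * R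
        ≤ (‖a‖ * ‖a ^ k - b ^ k‖ + ‖a - b‖ * ‖b‖ ^ k) * R := by
          rw [e]; gcongr
          refine (norm_add_le _ _).trans ?_
          rw [norm_mul, norm_mul, norm_pow]
      _ ≤ (R * ‖a ^ k - b ^ k‖ + δ * R ^ k) * R := by gcongr
      _ = R * (‖a ^ k - b ^ k‖ * R) + δ * R ^ (k + 1) := by ring
      _ ≤ R * (k * δ * R ^ k) + δ * R ^ (k + 1) := by gcongr
      _ = _ := by push_cast; ring

lemma norm_prod_pow_sub_le {d : ℕ} (α : Fin d → ℕ) {x y : Fin d → ℂ} {R δ : ℝ} (hR : 0 ≤ R)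
    (hδ : 0 ≤ δ) (hx : ∀ j, ‖x j‖ ≤ R) (hy : ∀ j, ‖y j‖ ≤ R) (hxy : ∀ j, ‖x j - y j‖ ≤ δ)
    (S : Finset (Fin d)) :
    ‖∏ j ∈ S, x j ^ α j - ∏ j ∈ S, y j ^ α j‖ * R
      ≤ (∑ j ∈ S, α j : ℕ) * δ * R ^ (∑ j ∈ S, α j) := by
  induction S using Finset.induction_on with
  | empty => simp
  | insert i S hi ih =>
    rw [Finset.prod_insert hi, Finset.prod_insert hi, Finset.sum_insert hi]
    set X := ∏ j ∈ S, x j ^ α j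
    set Y := ∏ j ∈ S, y j ^ α j
    set s := ∑ j ∈ S, α j
    have hY : ‖Y‖ ≤ R ^ s := by
      rw [norm_prod, ← Finset.prod_pow_eq_pow_sum]
      refine Finset.prod_le_prod (fun _ _ => norm_nonneg _) fun j _ => ?_
      rw [norm_pow]; gcongr; exact hy j
    have e : x i ^ α i * X - y i ^ α i * Y
        = x i ^ α i * (X - Y) + (x i ^ α i - y i ^ α i) * Y := by ring
    have h1 := norm_pow_sub_pow_mul_le (hx i) (hy i) (hxy i) (α i)
    calc ‖x i ^ α i * X - y i ^ α i * Y‖ * R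
        ≤ (‖x i‖ ^ α i * ‖X - Y‖ + ‖x i ^ α i - y i ^ α i‖ * ‖Y‖) * R := by
          rw [e]; gcongr
          refine (norm_add_le _ _).trans ?_
          rw [norm_mul, norm_mul, norm_pow]
      _ = ‖x i‖ ^ α i * (‖X - Y‖ * R) + (‖x i ^ α i - y i ^ α i‖ * R) * ‖Y‖ := by ring
      _ ≤ R ^ α i * (s * δ * R ^ s) + (α i * δ * R ^ α i) * R ^ s := by
          gcongr
          exact hx i
      _ = _ := by push_cast; rw [pow_add]; ring

lemma norm_monom_sub_le {d : ℕ} (α : Fin d → ℕ) {k s : Space d} {R : ℝ} (h1 : ‖k + s‖ ≤ R)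
    (h2 : ‖s‖ ≤ R) :
    ‖monom α (k + s) - monom α s‖ * R ≤ (∑ j, α j : ℕ) * ‖k‖ * R ^ (∑ j, α j) := by
  refine norm_prod_pow_sub_le α ((norm_nonneg _).trans h1) (norm_nonneg k) (fun j => ?_)
    (fun j => ?_) (fun j => ?_) Finset.univ
  · rw [Complex.norm_real]; exact (PiLp.norm_apply_le _ j).trans h1
  · rw [Complex.norm_real]; exact (PiLp.norm_apply_le _ j).trans h2
  · rw [PiLp.add_apply, Complex.ofReal_add, add_sub_cancel_right, Complex.norm_real]
    exact PiLp.norm_apply_le k j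

/-- The constant in the estimate of the differences of the symbol. -/
def diffConst (d p : ℕ) (α₁ : ℝ) : ℝ := (multiIndices d p).card * (p * √α₁)

lemma diffConst_nonneg (d p : ℕ) (α₁ : ℝ) : 0 ≤ diffConst d p α₁ := by
  unfold diffConst; positivity

/-- A homogeneous polynomial of degree p is Lipschitz on the ball of radius R with a constant of
order R^{p-1}. The factor ‖k‖ is the source of the power of ε in the Leibniz remainder and in the
flux difference. -/
lemma SymbolBounds.norm_sub_le {d m n p : ℕ} {b : (Fin d → ℕ) → Matrix (Fin m) (Fin n) ℂ}
    {α₀ α₁ : ℝ} (hb : SymbolBounds p b α₀ α₁) {k s : Space d} {R : ℝ} (h1 : ‖k + s‖ ≤ R)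
    (h2 : ‖s‖ ≤ R) :
    ‖symbol p b (k + s) - symbol p b s‖ * R ≤ diffConst d p α₁ * ‖k‖ * R ^ p := by
  have hR : 0 ≤ R := (norm_nonneg _).trans h1
  rw [symbol_eq, symbol_eq, ← Finset.sum_sub_distrib]
  calc ‖∑ α ∈ multiIndices d p, (monom α (k + s) • b α - monom α s • b α)‖ * R
      ≤ (∑ α ∈ multiIndices d p, ‖monom α (k + s) • b α - monom α s • b α‖) * R := by
        gcongr; exact norm_sum_le _ _
    _ = ∑ α ∈ multiIndices d p, (‖monom α (k + s) - monom α s‖ * R) * ‖b α‖ := by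
        rw [Finset.sum_mul]
        refine Finset.sum_congr rfl fun α _ => ?_
        rw [← sub_smul, norm_smul]; ring
    _ ≤ ∑ α ∈ multiIndices d p, (p * ‖k‖ * R ^ p) * √α₁ := by
        refine Finset.sum_le_sum fun α hα => ?_
        have h3 := norm_monom_sub_le α h1 h2
        rw [sum_of_mem_multiIndices hα] at h3
        gcongr
        exact hb.coeff α hα
    _ = _ := by rw [Finset.sum_const, nsmul_eq_mul, diffConst]; ring

/-! ### Elliptic coefficients -/

/-- A bounded Hermitian coefficient with `‖c‖² ≤ K ⟨c, g c⟩`. -/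
structure IsElliptic {d m : ℕ} (g : Space d → Matrix (Fin m) (Fin m) ℂ) (G K : ℝ) : Prop where
  measurable : ∀ i j, AEMeasurable (fun x => g x i j) volume
  herm : ∀ᵐ x, (g x).IsHermitian
  bound : ∀ᵐ x, ‖g x‖ ≤ G
  lower : ∀ᵐ x, ∀ c : Vec m, ‖c‖ ^ 2 ≤ K * (⟪c, app (g x) c⟫_ℂ).re

/-- Positivity of the form at the vector c - K⁻¹M⁻¹c, together with Re⟨M⁻¹c, c⟩ ≤ K‖c‖², gives
K⁻¹‖c‖² ≤ Re⟨c, Mc⟩. A bound for the inverse thus becomes a lower bound for the form without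
diagonalization. -/
lemma norm_sq_le_of_posDef {m : ℕ} {M : Matrix (Fin m) (Fin m) ℂ} (hM : M.PosDef) {K : ℝ}
    (hK : 0 < K) (h : ‖M⁻¹‖ ≤ K) (c : Vec m) : ‖c‖ ^ 2 ≤ K * (⟪c, app M c⟫_ℂ).re := by
  have hu : IsUnit M.det := (Matrix.isUnit_iff_isUnit_det M).mp hM.isUnit
  have hpos : ∀ x : Vec m, 0 ≤ (⟪x, app M x⟫_ℂ).re := fun x => by
    have h1 := hM.posSemidef.re_dotProduct_nonneg x.ofLp
    rw [EuclideanSpace.inner_eq_star_dotProduct, dotProduct_comm]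
    exact h1
  set y := app M⁻¹ c
  have hy : app M y = c := by
    rw [← mul_app, Matrix.mul_nonsing_inv M hu, one_app]
  set t : ℂ := ((K⁻¹ : ℝ) : ℂ)
  have h0 := hpos (c - t • y)
  have e1 : ⟪y, app M c⟫_ℂ = ⟪c, c⟫_ℂ := by
    rw [inner_app_right, hM.isHermitian.eq, hy]
  have e2 : ⟪c - t • y, app M (c - t • y)⟫_ℂ
      = ⟪c, app M c⟫_ℂ - t * ⟪c, c⟫_ℂ - t * ⟪c, c⟫_ℂ + t * t * ⟪y, c⟫_ℂ := by
    rw [app_sub, app_smul, hy, inner_sub_left, inner_sub_right, inner_sub_right, inner_smul_left,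
      inner_smul_right, inner_smul_left, inner_smul_right, e1, Complex.conj_ofReal]
    ring
  have e3 : (⟪c, c⟫_ℂ).re = ‖c‖ ^ 2 := by
    rw [inner_self_eq_norm_sq_to_K]; norm_cast
  have e4 : (⟪y, c⟫_ℂ).re ≤ K * ‖c‖ ^ 2 := by
    calc (⟪y, c⟫_ℂ).re ≤ ‖⟪y, c⟫_ℂ‖ := Complex.re_le_norm _
      _ ≤ ‖y‖ * ‖c‖ := norm_inner_le_norm _ _
      _ ≤ (K * ‖c‖) * ‖c‖ := by
        gcongr
        exact (norm_app_le _ _).trans (by gcongr)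
      _ = _ := by ring
  rw [e2] at h0
  simp only [Complex.sub_re, Complex.add_re, t, ← Complex.ofReal_mul, Complex.re_ofReal_mul,
    e3] at h0
  have h5 : K⁻¹ * K⁻¹ * (⟪y, c⟫_ℂ).re ≤ K⁻¹ * ‖c‖ ^ 2 := by
    calc K⁻¹ * K⁻¹ * (⟪y, c⟫_ℂ).re ≤ K⁻¹ * K⁻¹ * (K * ‖c‖ ^ 2) := by gcongr
      _ = _ := by field_simp
  have h6 : K⁻¹ * ‖c‖ ^ 2 ≤ (⟪c, app M c⟫_ℂ).re := by linarith
  rwa [inv_mul_le_iff₀ hK] at h6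

lemma IsCoefficient.isElliptic {d m : ℕ} {β : Module.Basis (Fin d) ℝ (Space d)}
    {g : Space d → Matrix (Fin m) (Fin m) ℂ} {G G' G₁ K : ℝ} (hg : IsCoefficient β g G G')
    (hG : G ≤ G₁) (hK : G' ≤ K) (hK0 : 0 < K) : IsElliptic g G₁ K where
  measurable := hg.measurable
  herm := hg.posDef.mono fun x hx => hx.isHermitian
  bound := hg.bound.mono fun x hx => hx.trans hG
  lower := by
    filter_upwards [hg.posDef, hg.bound_inv] with x h1 h2
    exact norm_sq_le_of_posDef h1 hK0 (h2.trans hK)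

lemma quasiMeasurePreserving_smul {d : ℕ} {t : ℝ} (ht : t ≠ 0) :
    Measure.QuasiMeasurePreserving (fun x : Space d => t • x) volume volume := by
  refine ⟨measurable_const_smul t, ?_⟩
  rw [Measure.map_addHaar_smul volume ht]
  exact Measure.smul_absolutelyContinuous

lemma IsElliptic.rescale {d m : ℕ} {g : Space d → Matrix (Fin m) (Fin m) ℂ} {G K ε : ℝ}
    (hg : IsElliptic g G K) (hε : 0 < ε) : IsElliptic (rescale ε g) G K := by
  have h := quasiMeasurePreserving_smul (d := d) (inv_pos.mpr hε).ne'
  exact ⟨fun i j => (hg.measurable i j).comp_quasiMeasurePreserving h, h.ae hg.herm, h.ae hg.bound,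
    h.ae hg.lower⟩

lemma IsElliptic.im_inner {d m : ℕ} {g : Space d → Matrix (Fin m) (Fin m) ℂ} {G K : ℝ}
    (hg : IsElliptic g G K) : ∀ᵐ x, ∀ c : Vec m, (⟪c, app (g x) c⟫_ℂ).im = 0 := by
  filter_upwards [hg.herm] with x hx c
  have h1 : ⟪c, app (g x) c⟫_ℂ = (starRingEnd ℂ) ⟪c, app (g x) c⟫_ℂ := by
    rw [inner_conj_symm, inner_app_left, hx.eq]
  exact Complex.conj_eq_iff_im.mp h1.symm

/-! ### Multiplication by bounded matrix functions -/

/-- `M` is measurable and bounded by `C`. -/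
structure IsBddMatrix {X : Type*} [MeasurableSpace X] (μ : Measure X) {k n : ℕ}
    (M : X → Matrix (Fin k) (Fin n) ℂ) (C : ℝ) : Prop where
  measurable : ∀ i j, AEMeasurable (fun x => M x i j) μ
  bound : ∀ᵐ x ∂μ, ∀ v, ‖app (M x) v‖ ≤ C * ‖v‖

lemma IsBddMatrix.memLp {X : Type*} [MeasurableSpace X] {μ : Measure X} {k n : ℕ}
    {M : X → Matrix (Fin k) (Fin n) ℂ} {C : ℝ} (h : IsBddMatrix μ M C) {u : X → Vec n}
    (hu : MemLp u 2 μ) : MemLp (fun x => app (M x) (u x)) 2 μ :=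
  hu.of_le_mul (aestronglyMeasurable_app h.measurable hu.1) (h.bound.mono fun _ hx => hx _)

/-- Multiplication by a bounded matrix function as an operator in `L₂`. -/
def IsBddMatrix.mulL {X : Type*} [MeasurableSpace X] {μ : Measure X} {k n : ℕ}
    {M : X → Matrix (Fin k) (Fin n) ℂ} {C : ℝ} (h : IsBddMatrix μ M C) :
    Lp (Vec n) 2 μ →L[ℂ] Lp (Vec k) 2 μ :=
  LinearMap.mkContinuous
    { toFun := fun u => (h.memLp (Lp.memLp u)).toLp _
      map_add' := fun u v => by
        rw [← MemLp.toLp_add]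
        refine MemLp.toLp_congr _ _ ?_
        filter_upwards [Lp.coeFn_add u v] with x hx
        rw [hx, Pi.add_apply, app_add, Pi.add_apply]
      map_smul' := fun c u => by
        rw [RingHom.id_apply, ← MemLp.toLp_const_smul]
        refine MemLp.toLp_congr _ _ ?_
        filter_upwards [Lp.coeFn_smul c u] with x hx
        rw [hx, Pi.smul_apply, app_smul, Pi.smul_apply] } C
    (fun u => by
      refine Lp.norm_le_mul_norm_of_ae_le_mul ?_
      filter_upwards [h.bound, (h.memLp (Lp.memLp u)).coeFn_toLp] with x h1 h2
      exact (congrArg norm h2).trans_le (h1 _))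

lemma IsBddMatrix.coeFn_mulL {X : Type*} [MeasurableSpace X] {μ : Measure X} {k n : ℕ}
    {M : X → Matrix (Fin k) (Fin n) ℂ} {C : ℝ} (h : IsBddMatrix μ M C) (u : Lp (Vec n) 2 μ) :
    h.mulL u =ᵐ[μ] fun x => app (M x) (u x) := (h.memLp (Lp.memLp u)).coeFn_toLp

lemma IsElliptic.isBddMatrix {d m : ℕ} {g : Space d → Matrix (Fin m) (Fin m) ℂ} {G K : ℝ}
    (hg : IsElliptic g G K) : IsBddMatrix volume g G :=
  ⟨hg.measurable, hg.bound.mono fun x hx v => (norm_app_le _ _).trans (by gcongr)⟩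

/-! ### The Fourier transform on `L₂` -/

lemma fourier_toLp_add {d n : ℕ} (u v : L2 d n) : 𝓕 (u + v) = 𝓕 u + 𝓕 v :=
  (Lp.fourierTransformₗᵢ (Space d) (Vec n)).map_add u v

lemma fourier_toLp_sub {d n : ℕ} (u v : L2 d n) : 𝓕 (u - v) = 𝓕 u - 𝓕 v :=
  (Lp.fourierTransformₗᵢ (Space d) (Vec n)).map_sub u v

lemma fourier_toLp_smul {d n : ℕ} (c : ℂ) (u : L2 d n) : 𝓕 (c • u) = c • 𝓕 u :=
  (Lp.fourierTransformₗᵢ (Space d) (Vec n)).map_smul c u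

lemma coeFn_fourier_add {d n : ℕ} (u v : L2 d n) :
    (𝓕 (u + v) : L2 d n) =ᵐ[volume] fun η => (𝓕 u : L2 d n) η + (𝓕 v : L2 d n) η := by
  rw [fourier_toLp_add]; exact Lp.coeFn_add _ _

lemma coeFn_fourier_sub {d n : ℕ} (u v : L2 d n) :
    (𝓕 (u - v) : L2 d n) =ᵐ[volume] fun η => (𝓕 u : L2 d n) η - (𝓕 v : L2 d n) η := by
  rw [fourier_toLp_sub]; exact Lp.coeFn_sub _ _

lemma coeFn_fourier_smul {d n : ℕ} (c : ℂ) (u : L2 d n) :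
    (𝓕 (c • u) : L2 d n) =ᵐ[volume] fun η => c • (𝓕 u : L2 d n) η := by
  rw [fourier_toLp_smul]; exact Lp.coeFn_smul _ _

lemma eq_of_fourier_ae_eq {d n : ℕ} {u v : L2 d n}
    (h : (𝓕 u : L2 d n) =ᵐ[volume] (𝓕 v : L2 d n)) : u = v :=
  (Lp.fourierTransformₗᵢ (Space d) (Vec n)).injective (Lp.ext h)

lemma fourier_fourierInv {d n : ℕ} (u : L2 d n) : 𝓕 (𝓕⁻ u : L2 d n) = u :=
  (Lp.fourierTransformₗᵢ (Space d) (Vec n)).apply_symm_apply u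

lemma fourierInv_fourier {d n : ℕ} (u : L2 d n) : 𝓕⁻ (𝓕 u : L2 d n) = u :=
  (Lp.fourierTransformₗᵢ (Space d) (Vec n)).symm_apply_apply u

/-- The Fourier transform commutes with constant matrices. -/
lemma fourier_compLpL {d k n : ℕ} (L : Vec n →L[ℂ] Vec k) (u : L2 d n) :
    𝓕 (L.compLpL 2 volume u : L2 d k) = L.compLpL 2 volume (𝓕 u : L2 d n) := by
  -- Both sides are continuous in u, so Schwartz functions suffice; there the transform is an
  -- integral and L passes through it.
  have hd := SchwartzMap.denseRange_toLpCLM (E := Space d) (F := Vec n) (p := 2)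
    (μ := volume) ENNReal.ofNat_ne_top
  refine hd.induction_on (p := fun u : L2 d n =>
    𝓕 (L.compLpL 2 volume u : L2 d k) = L.compLpL 2 volume (𝓕 u : L2 d n)) u ?_ ?_
  · exact isClosed_eq ((Lp.fourierTransformₗᵢ (Space d) (Vec k)).continuous.comp
      (L.compLpL 2 volume).continuous) ((L.compLpL 2 volume).continuous.comp
      (Lp.fourierTransformₗᵢ (Space d) (Vec n)).continuous)
  intro f
  have h1 : ∀ f : SchwartzMap (Space d) (Vec n),
      L.compLpL 2 volume (f.toLp 2) = (SchwartzMap.postcompCLM L f).toLp 2 := by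
    intro f
    refine Lp.ext ?_
    filter_upwards [L.coeFn_compLpL (μ := volume) (f.toLp 2), f.coeFn_toLp 2 volume,
      (SchwartzMap.postcompCLM L f).coeFn_toLp 2 volume] with x e1 e2 e3
    rw [e1, e2, e3, SchwartzMap.postcompCLM_apply]
  change 𝓕 (L.compLpL 2 volume (f.toLp 2) : L2 d k)
    = L.compLpL 2 volume (𝓕 (f.toLp 2 : L2 d n) : L2 d n)
  rw [h1, SchwartzMap.toLp_fourier_eq, SchwartzMap.toLp_fourier_eq, h1]
  congr 1
  ext1 w
  rw [SchwartzMap.postcompCLM_apply, SchwartzMap.fourier_coe, SchwartzMap.fourier_coe,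
    Real.fourier_eq, Real.fourier_eq, ← L.integral_comp_comm]
  · refine integral_congr_ae (Filter.Eventually.of_forall fun v => ?_)
    simp only [SchwartzMap.postcompCLM_apply, Circle.smul_def, map_smul]
  · exact (Real.fourierIntegral_convergent_iff w).mpr f.integrable

/-- The phase `exp (2πi⟨τ, x⟩)` as a scalar matrix. -/
def phase {d : ℕ} (n : ℕ) (τ : Space d) (x : Space d) : Matrix (Fin n) (Fin n) ℂ :=
  Complex.exp ((2 * Real.pi * ⟪τ, x⟫_ℝ : ℝ) * Complex.I) • (1 : Matrix (Fin n) (Fin n) ℂ)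

lemma app_phase {d n : ℕ} (τ x : Space d) (v : Vec n) :
    app (phase n τ x) v = Complex.exp ((2 * Real.pi * ⟪τ, x⟫_ℝ : ℝ) * Complex.I) • v := by
  rw [phase, smul_app, one_app]

lemma isBddMatrix_phase {d : ℕ} (n : ℕ) (τ : Space d) : IsBddMatrix volume (phase n τ) 1 := by
  refine ⟨fun i j => ?_, Filter.Eventually.of_forall fun x v => ?_⟩
  · simp only [phase, Matrix.smul_apply, smul_eq_mul]
    refine Continuous.aemeasurable ?_
    fun_prop
  · rw [app_phase, norm_smul, Complex.norm_exp_ofReal_mul_I]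

/-- Multiplication by a phase shifts the Fourier transform. -/
lemma fourierInv_translate {d n : ℕ} (τ : Space d) (h : L2 d n) :
    𝓕⁻ (Lp.compMeasurePreservingₗᵢ ℂ (fun η : Space d => η - τ)
      (measurePreserving_sub_right volume τ) h : L2 d n)
      = (isBddMatrix_phase n τ).mulL (𝓕⁻ h : L2 d n) := by
  set T := Lp.compMeasurePreservingₗᵢ (E := Vec n) (p := 2) ℂ (fun η : Space d => η - τ)
      (measurePreserving_sub_right volume τ)
  have hd := SchwartzMap.denseRange_toLpCLM (E := Space d) (F := Vec n) (p := 2)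
    (μ := volume) ENNReal.ofNat_ne_top
  refine hd.induction_on (p := fun h : L2 d n =>
    𝓕⁻ (T h : L2 d n) = (isBddMatrix_phase n τ).mulL (𝓕⁻ h : L2 d n)) h ?_ ?_
  · exact isClosed_eq ((Lp.fourierTransformₗᵢ (Space d) (Vec n)).symm.continuous.comp
      T.continuous) ((isBddMatrix_phase n τ).mulL.continuous.comp
      (Lp.fourierTransformₗᵢ (Space d) (Vec n)).symm.continuous)
  intro f
  change 𝓕⁻ (T (f.toLp 2) : L2 d n)
    = (isBddMatrix_phase n τ).mulL (𝓕⁻ (f.toLp 2 : L2 d n) : L2 d n)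
  have h1 : T (f.toLp 2) = (SchwartzMap.compSubConstCLM ℂ τ f).toLp 2 := by
    refine Lp.ext ?_
    have e2 := (measurePreserving_sub_right (volume : Measure (Space d)) τ).quasiMeasurePreserving.ae
      (f.coeFn_toLp 2 volume)
    filter_upwards [Lp.coeFn_compMeasurePreserving (f.toLp 2)
      (measurePreserving_sub_right (volume : Measure (Space d)) τ), e2,
      (SchwartzMap.compSubConstCLM ℂ τ f).coeFn_toLp 2 volume] with x e1 e2 e3
    rw [e3, SchwartzMap.compSubConstCLM_apply, ← e2]
    exact e1
  -- For Schwartz functions this is the substitution v ↦ v + τ in the inverse Fourier integral.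
  rw [h1, SchwartzMap.toLp_fourierInv_eq, SchwartzMap.toLp_fourierInv_eq]
  refine Lp.ext ?_
  filter_upwards [(isBddMatrix_phase n τ).coeFn_mulL ((𝓕⁻ f).toLp 2),
    (𝓕⁻ f).coeFn_toLp 2 volume,
    (𝓕⁻ (SchwartzMap.compSubConstCLM ℂ τ f)).coeFn_toLp 2 volume] with x e1 e2 e3
  rw [e1, e2, e3, app_phase, SchwartzMap.fourierInv_coe, SchwartzMap.fourierInv_coe,
    Real.fourierInv_eq', Real.fourierInv_eq', ← integral_smul,
    ← integral_add_right_eq_self _ τ]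
  refine integral_congr_ae (Filter.Eventually.of_forall fun v => ?_)
  simp only [SchwartzMap.compSubConstCLM_apply, smul_smul, ← Complex.exp_add, add_sub_cancel_right]
  congr 2
  rw [inner_add_left]
  push_cast; ring

lemma coeFn_fourier_phase {d n : ℕ} (τ : Space d) (u : L2 d n) :
    (𝓕 ((isBddMatrix_phase n τ).mulL u : L2 d n) : L2 d n)
      =ᵐ[volume] fun η => (𝓕 u : L2 d n) (η - τ) := by
  have h := fourierInv_translate τ (𝓕 u : L2 d n)
  rw [fourierInv_fourier] at h
  rw [← h, fourier_fourierInv]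
  exact Lp.coeFn_compMeasurePreserving _ _

/-! ### Fourier multipliers and Sobolev norms -/

/-- The frequency `ξ = 2πη`. -/
abbrev freq {d : ℕ} (η : Space d) : Space d := (2 * Real.pi) • η

lemma coeFn_fourier_multiplier {d k n : ℕ} {M : Space d → Matrix (Fin k) (Fin n) ℂ} {u : L2 d n}
    (h : MemLp (fun η : Space d => app (M (freq η)) ((𝓕 u : L2 d n) η)) 2 volume) :
    (𝓕 (multiplier M u) : L2 d k)
      =ᵐ[volume] fun η => app (M (freq η)) ((𝓕 u : L2 d n) η) := by
  rw [multiplier, dif_pos h, fourier_fourierInv]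
  exact h.coeFn_toLp

/-- The weight `(1 + |ξ|²)^{p/2}`. -/
def bessel {d : ℕ} (p : ℕ) (η : Space d) : ℝ := √((1 + ‖freq η‖ ^ 2) ^ p)

lemma one_le_bessel {d : ℕ} (p : ℕ) (η : Space d) : 1 ≤ bessel p η := by
  rw [bessel, Real.one_le_sqrt]
  exact one_le_pow₀ (by nlinarith [sq_nonneg ‖freq η‖])

lemma pow_le_bessel {d : ℕ} (p : ℕ) (η : Space d) : ‖freq η‖ ^ p ≤ bessel p η := by
  refine Real.le_sqrt_of_sq_le ?_
  rw [← pow_mul, mul_comm, pow_mul]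
  gcongr
  linarith

/-- For t = |ξ| ≤ 1 one has 1 + t² ≤ 2, otherwise 1 + t² ≤ 2t². The norm of H^p is thereby
controlled by ‖u‖ and ‖|D|^p u‖, the two quantities that the energy estimate provides. -/
lemma bessel_le {d : ℕ} (p : ℕ) (η : Space d) : bessel p η ≤ √(2 ^ p) * (1 + ‖freq η‖ ^ p) := by
  rw [bessel, ← Real.sqrt_sq (by positivity : 0 ≤ 1 + ‖freq η‖ ^ p),
    ← Real.sqrt_mul (by positivity)]
  refine Real.sqrt_le_sqrt ?_
  set t := ‖freq η‖
  have ht : 0 ≤ t := norm_nonneg _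
  rcases le_total t 1 with h | h
  · calc (1 + t ^ 2) ^ p ≤ 2 ^ p := by gcongr; nlinarith
      _ = 2 ^ p * 1 ^ 2 := by ring
      _ ≤ 2 ^ p * (1 + t ^ p) ^ 2 := by
        gcongr; have := pow_nonneg ht p; linarith
  · calc (1 + t ^ 2) ^ p ≤ (2 * t ^ 2) ^ p := by gcongr; nlinarith
      _ = 2 ^ p * (t ^ p) ^ 2 := by rw [mul_pow]; ring
      _ ≤ 2 ^ p * (1 + t ^ p) ^ 2 := by gcongr; linarith

lemma continuous_bessel {d : ℕ} (p : ℕ) : Continuous (bessel (d := d) p) := by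
  unfold bessel
  fun_prop

lemma sobolevNorm_eq {d n : ℕ} (p : ℕ) (u : L2 d n) :
    sobolevNorm p u = eLpNorm (fun η => bessel p η • (𝓕 u : L2 d n) η) 2 volume := by
  rw [eLpNorm_eq_lintegral_rpow_enorm_toReal two_ne_zero ENNReal.ofNat_ne_top, sobolevNorm]
  have e : (2 : ℝ≥0∞).toReal = 2 := rfl
  rw [e]
  congr 1
  refine lintegral_congr fun η => ?_
  rw [enorm_smul, ENNReal.mul_rpow_of_nonneg _ _ zero_le_two, Real.enorm_of_nonneg
    (zero_le_one.trans (one_le_bessel p η))]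
  norm_cast
  rw [← ENNReal.ofReal_pow (zero_le_one.trans (one_le_bessel p η)), bessel,
    Real.sq_sqrt (by positivity)]

lemma aestronglyMeasurable_smul_fourier {d n : ℕ} {w : Space d → ℝ} (hw : Continuous w)
    (u : L2 d n) :
    AEStronglyMeasurable (fun η => w η • (𝓕 u : L2 d n) η) volume :=
  hw.aestronglyMeasurable.smul (Lp.aestronglyMeasurable _)

lemma continuous_freq_pow {d : ℕ} (p : ℕ) : Continuous fun η : Space d => ‖freq η‖ ^ p := by
  fun_prop

lemma memSobolev_iff {d n : ℕ} {p : ℕ} {u : L2 d n} :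
    MemSobolev p u ↔ MemLp (fun η => bessel p η • (𝓕 u : L2 d n) η) 2 volume := by
  rw [MemSobolev, sobolevNorm_eq]
  exact ⟨fun h => ⟨aestronglyMeasurable_smul_fourier (continuous_bessel p) u, h⟩, fun h => h.2⟩

/-- The seminorm `‖|D|^p u‖`. -/
def dNorm {d n : ℕ} (p : ℕ) (u : L2 d n) : ℝ :=
  (eLpNorm (fun η => ‖freq η‖ ^ p • (𝓕 u : L2 d n) η) 2 volume).toReal

lemma dNorm_nonneg {d n : ℕ} (p : ℕ) (u : L2 d n) : 0 ≤ dNorm p u := ENNReal.toReal_nonneg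

lemma MemSobolev.memLp {d n : ℕ} {p : ℕ} {u : L2 d n} (h : MemSobolev p u) :
    MemLp (fun η => ‖freq η‖ ^ p • (𝓕 u : L2 d n) η) 2 volume := by
  refine (memSobolev_iff.mp h).mono (aestronglyMeasurable_smul_fourier (continuous_freq_pow p) u)
    (Filter.Eventually.of_forall fun η => ?_)
  rw [norm_smul (‖freq η‖ ^ p), norm_smul (bessel p η), Real.norm_of_nonneg (by positivity),
    Real.norm_of_nonneg (zero_le_one.trans (one_le_bessel p η))]
  gcongr
  exact pow_le_bessel p η

lemma memSobolev_of_memLp {d n : ℕ} {p : ℕ} {u : L2 d n}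
    (h : MemLp (fun η => ‖freq η‖ ^ p • (𝓕 u : L2 d n) η) 2 volume) :
    MemSobolev p u ∧
      sobolevNorm p u ≤ ENNReal.ofReal (√(2 ^ p) * (‖u‖ + dNorm p u)) := by
  have hu : MemLp (𝓕 u : L2 d n) 2 volume := Lp.memLp _
  have hle : sobolevNorm p u ≤ ENNReal.ofReal (√(2 ^ p) * (‖u‖ + dNorm p u)) := by
    rw [sobolevNorm_eq]
    calc _ ≤ ENNReal.ofReal (√(2 ^ p)) * eLpNorm (fun η => ‖(𝓕 u : L2 d n) η‖
            + ‖‖freq η‖ ^ p • (𝓕 u : L2 d n) η‖) 2 volume := by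
          refine eLpNorm_le_mul_eLpNorm_of_ae_le_mul (Filter.Eventually.of_forall fun η => ?_) 2
          rw [norm_smul, norm_smul, Real.norm_of_nonneg (zero_le_one.trans (one_le_bessel p η)),
            Real.norm_of_nonneg (by positivity : 0 ≤ ‖freq η‖ ^ p),
            Real.norm_of_nonneg (by positivity)]
          calc _ ≤ (√(2 ^ p) * (1 + ‖freq η‖ ^ p)) * ‖(𝓕 u : L2 d n) η‖ := by
                gcongr; exact bessel_le p η
            _ = _ := by ring
      _ ≤ ENNReal.ofReal (√(2 ^ p)) * (eLpNorm (𝓕 u : L2 d n) 2 volume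
            + eLpNorm (fun η => ‖freq η‖ ^ p • (𝓕 u : L2 d n) η) 2 volume) := by
          gcongr
          refine (eLpNorm_add_le hu.1.norm h.1.norm one_le_two).trans ?_
          rw [eLpNorm_norm, eLpNorm_norm]
      _ = _ := by
          rw [ENNReal.ofReal_mul (by positivity), ENNReal.ofReal_add (norm_nonneg _)
            (dNorm_nonneg _ _), dNorm, ENNReal.ofReal_toReal h.2.ne, ← Lp.norm_fourier_eq u,
            Lp.norm_def, ENNReal.ofReal_toReal hu.2.ne]
  exact ⟨hle.trans_lt ENNReal.ofReal_lt_top, hle⟩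

lemma MemSobolev.sub {d n : ℕ} {p : ℕ} {u v : L2 d n} (hu : MemSobolev p u)
    (hv : MemSobolev p v) : MemSobolev p (u - v) := by
  rw [memSobolev_iff] at *
  refine (hu.sub hv).ae_eq ?_
  filter_upwards [coeFn_fourier_sub u v] with η h
  rw [h, smul_sub, Pi.sub_apply]

lemma MemSobolev.smul {d n : ℕ} {p : ℕ} {u : L2 d n} (hu : MemSobolev p u) (c : ℂ) :
    MemSobolev p (c • u) := by
  rw [memSobolev_iff] at *
  refine (hu.const_smul c).ae_eq ?_
  filter_upwards [coeFn_fourier_smul c u] with η h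
  rw [h, smul_comm, Pi.smul_apply]

/-! ### The operator b(D) on H^p and its form. -/

section bD

variable {d m n p : ℕ} {b : (Fin d → ℕ) → Matrix (Fin m) (Fin n) ℂ} {α₀ α₁ : ℝ}

lemma aemeasurable_symbol_freq (i : Fin m) (j : Fin n) :
    AEMeasurable (fun η : Space d => symbol p b (freq η) i j) volume :=
  ((continuous_symbol_apply p b i j).comp (continuous_const_smul _)).aemeasurable

lemma aestronglyMeasurable_symbol {u : Space d → Vec n} (hu : AEStronglyMeasurable u volume) :
    AEStronglyMeasurable (fun η => app (symbol p b (freq η)) (u η)) volume :=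
  aestronglyMeasurable_app aemeasurable_symbol_freq hu

lemma memLp_symbol (hd : 1 ≤ d) (hα₀ : 0 ≤ α₀) (hα₁ : 0 ≤ α₁) (hb : SymbolBounds p b α₀ α₁)
    {u : L2 d n} (h : MemSobolev p u) :
    MemLp (fun η : Space d => app (symbol p b (freq η)) ((𝓕 u : L2 d n) η)) 2 volume := by
  refine h.memLp.of_le_mul (c := √α₁) (aestronglyMeasurable_symbol (Lp.aestronglyMeasurable _))
    (Filter.Eventually.of_forall fun η => ?_)
  rw [norm_smul, Real.norm_of_nonneg (by positivity)]
  exact (hb.norm_bounds hd hα₀ hα₁ _ _).2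

lemma coeFn_fourier_bD (hd : 1 ≤ d) (hα₀ : 0 ≤ α₀) (hα₁ : 0 ≤ α₁) (hb : SymbolBounds p b α₀ α₁)
    {u : L2 d n} (h : MemSobolev p u) :
    (𝓕 (bD p b u) : L2 d m)
      =ᵐ[volume] fun η => app (symbol p b (freq η)) ((𝓕 u : L2 d n) η) :=
  coeFn_fourier_multiplier (memLp_symbol hd hα₀ hα₁ hb h)

lemma norm_bD_le (hd : 1 ≤ d) (hα₀ : 0 ≤ α₀) (hα₁ : 0 ≤ α₁) (hb : SymbolBounds p b α₀ α₁)
    {u : L2 d n} (h : MemSobolev p u) :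
    √α₀ * dNorm p u ≤ ‖bD p b u‖ ∧ ‖bD p b u‖ ≤ √α₁ * dNorm p u := by
  have e := coeFn_fourier_bD hd hα₀ hα₁ hb h
  have e2 : ‖bD p b u‖ = (eLpNorm (fun η : Space d =>
      app (symbol p b (freq η)) ((𝓕 u : L2 d n) η)) 2 volume).toReal := by
    rw [← Lp.norm_fourier_eq, Lp.norm_def, eLpNorm_congr_ae e]
  have hf := memLp_symbol hd hα₀ hα₁ hb h
  rw [e2, dNorm, ← ENNReal.toReal_ofReal (Real.sqrt_nonneg α₀),
    ← ENNReal.toReal_ofReal (Real.sqrt_nonneg α₁), ← ENNReal.toReal_mul, ← ENNReal.toReal_mul]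
  constructor
  · refine ENNReal.toReal_mono hf.2.ne ?_
    rw [← Real.enorm_of_nonneg (Real.sqrt_nonneg α₀), ← eLpNorm_const_smul]
    refine eLpNorm_mono fun η => ?_
    rw [Pi.smul_apply, norm_smul, norm_smul, Real.norm_of_nonneg (Real.sqrt_nonneg _),
      Real.norm_of_nonneg (by positivity : 0 ≤ ‖freq η‖ ^ p)]
    exact (hb.norm_bounds hd hα₀ hα₁ _ _).1
  · refine ENNReal.toReal_mono (ENNReal.mul_ne_top ENNReal.ofReal_ne_top h.memLp.2.ne) ?_
    refine eLpNorm_le_mul_eLpNorm_of_ae_le_mul (Filter.Eventually.of_forall fun η => ?_) 2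
    rw [norm_smul, Real.norm_of_nonneg (by positivity)]
    exact (hb.norm_bounds hd hα₀ hα₁ _ _).2

lemma bD_sub (hd : 1 ≤ d) (hα₀ : 0 ≤ α₀) (hα₁ : 0 ≤ α₁) (hb : SymbolBounds p b α₀ α₁)
    {u v : L2 d n} (hu : MemSobolev p u) (hv : MemSobolev p v) :
    bD p b (u - v) = bD p b u - bD p b v := by
  refine eq_of_fourier_ae_eq ?_
  filter_upwards [coeFn_fourier_bD hd hα₀ hα₁ hb hu, coeFn_fourier_bD hd hα₀ hα₁ hb hv,
    coeFn_fourier_bD hd hα₀ hα₁ hb (hu.sub hv), coeFn_fourier_sub u v,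
    coeFn_fourier_sub (bD p b u) (bD p b v)] with η e1 e2 e3 e4 e5
  rw [e5, e3, e4, e1, e2, app_sub]

lemma bD_smul (hd : 1 ≤ d) (hα₀ : 0 ≤ α₀) (hα₁ : 0 ≤ α₁) (hb : SymbolBounds p b α₀ α₁)
    {u : L2 d n} (hu : MemSobolev p u) (c : ℂ) :
    bD p b (c • u) = c • bD p b u := by
  refine eq_of_fourier_ae_eq ?_
  filter_upwards [coeFn_fourier_bD hd hα₀ hα₁ hb hu,
    coeFn_fourier_bD hd hα₀ hα₁ hb (hu.smul c), coeFn_fourier_smul c u,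
    coeFn_fourier_smul c (bD p b u)] with η e1 e3 e4 e5
  rw [e5, e3, e4, e1, app_smul]

lemma form_eq_inner {g : Space d → Matrix (Fin m) (Fin m) ℂ} {G K : ℝ} (hg : IsElliptic g G K)
    (u v : L2 d n) : form p b g u v = ⟪bD p b v, hg.isBddMatrix.mulL (bD p b u)⟫_ℂ := by
  rw [form, L2.inner_def]
  refine integral_congr_ae ?_
  filter_upwards [hg.isBddMatrix.coeFn_mulL (bD p b u)] with x hx
  rw [hx]

end bD

/-! ### Coercive operators -/

/-- A coercive operator in a complex Hilbert space is invertible. -/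
lemma exists_inverse_of_coercive {H : Type*} [NormedAddCommGroup H] [InnerProductSpace ℂ H]
    [CompleteSpace H] (T : H →L[ℂ] H) {κ : ℝ} (hκ : 0 < κ)
    (h : ∀ x, κ * ‖x‖ ^ 2 ≤ ‖⟪x, T x⟫_ℂ‖) :
    ∃ S : H →L[ℂ] H, (∀ x, S (T x) = x) ∧ ∀ x, T (S x) = x := by
  have hb : ∀ x, κ * ‖x‖ ≤ ‖T x‖ := by
    intro x
    by_cases hx : x = 0
    · simp [hx]
    · have h1 := (h x).trans (norm_inner_le_norm x (T x))
      have h2 : 0 < ‖x‖ := norm_pos_iff.mpr hx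
      refine le_of_mul_le_mul_left ?_ h2
      calc ‖x‖ * (κ * ‖x‖) = κ * ‖x‖ ^ 2 := by ring
        _ ≤ _ := h1
  have ha : AntilipschitzWith (κ⁻¹).toNNReal T := by
    refine T.antilipschitz_of_bound fun x => ?_
    rw [Real.coe_toNNReal _ (inv_nonneg.mpr hκ.le), ← div_eq_inv_mul, le_div_iff₀ hκ, mul_comm]
    exact hb x
  have hker : T.ker = ⊥ := LinearMap.ker_eq_bot.mpr ha.injective
  have hcl : IsClosed (T.range : Set H) := ha.isClosed_range T.uniformContinuous
  -- The range is closed, and a vector w orthogonal to it has ⟨w, Tw⟩ = 0, so coercivity forces w =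
  -- 0.
  have hran : T.range = ⊤ := by
    have := hcl.completeSpace_coe
    rw [← T.range.orthogonal_orthogonal, Submodule.eq_top_iff']
    intro v w hw
    have h0 : ⟪w, T w⟫_ℂ = 0 := by
      rw [← inner_conj_symm, hw (T w) ⟨w, rfl⟩, map_zero]
    have h1 := h w
    rw [h0, norm_zero] at h1
    have h2 : ‖w‖ ^ 2 ≤ 0 := by
      by_contra hc
      exact absurd h1 (not_le.mpr (mul_pos hκ (not_le.mp hc)))
    have h3 : w = 0 := by
      rw [← norm_eq_zero]; exact pow_eq_zero_iff two_ne_zero |>.mp (le_antisymm h2 (sq_nonneg _))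
    rw [h3, inner_zero_left]
  let e := ContinuousLinearEquiv.ofBijective T hker hran
  exact ⟨e.symm, fun x => e.symm_apply_apply x, fun x => e.apply_symm_apply x⟩

lemma sin_ne_zero_of_mem {φ : ℝ}
    (h : φ ∈ Set.Ioo 0 (Real.pi / 2) ∪ Set.Ioo (3 * Real.pi / 2) (2 * Real.pi)) :
    Real.sin φ ≠ 0 := by
  rcases h with h | h
  · exact (Real.sin_pos_of_pos_of_lt_pi h.1 (by linarith [h.2, Real.pi_pos])).ne'
  · have : Real.sin (φ - 2 * Real.pi) < 0 :=
      Real.sin_neg_of_neg_of_neg_pi_lt (by linarith [h.2]) (by linarith [h.1, Real.pi_pos])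
    rw [Real.sin_sub_two_pi] at this
    exact this.ne

lemma one_le_cAngle {φ : ℝ} : 1 ≤ cAngle φ := by
  unfold cAngle
  split_ifs with h
  · exact (one_le_inv₀ (abs_pos.mpr (sin_ne_zero_of_mem h))).mpr (Real.abs_sin_le_one φ)
  · exact le_rfl

/-- The distance between a half-line and a ray. -/
lemma add_le_cAngle_mul {ζ : ℂ} {φ : ℝ} (hφ : φ ∈ Set.Ioo 0 (2 * Real.pi))
    (hζ : ζ = ‖ζ‖ * Complex.exp (φ * Complex.I)) {a t : ℝ} (ha : 0 ≤ a) (ht : 0 ≤ t) :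
    a + ‖ζ‖ * t ≤ 2 * cAngle φ * ‖(a : ℂ) - ζ * t‖ := by
  set y := ‖ζ‖ * t
  have hy : 0 ≤ y := by positivity
  have e : (a : ℂ) - ζ * t = ((a - y * Real.cos φ : ℝ) : ℂ) + ((-(y * Real.sin φ) : ℝ) : ℂ) * Complex.I := by
    rw [hζ, Complex.exp_mul_I]
    simp only [y]
    push_cast; ring
  have hn : ‖(a : ℂ) - ζ * t‖ ^ 2 = a ^ 2 - 2 * a * y * Real.cos φ + y ^ 2 := by
    rw [e, Complex.sq_norm, Complex.normSq_add_mul_I]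
    have := Real.sin_sq_add_cos_sq φ
    linear_combination y ^ 2 * this
  have hc : 0 < cAngle φ := zero_lt_one.trans_le one_le_cAngle
  refine (sq_le_sq₀ (by positivity) (by positivity)).mp ?_
  rw [mul_pow, hn]
  unfold cAngle
  split_ifs with h
  · have hs := sin_ne_zero_of_mem h
    have hs2 : 0 < |Real.sin φ| ^ 2 := by positivity
    have e2 : (2 * |Real.sin φ|⁻¹) ^ 2 = 4 / |Real.sin φ| ^ 2 := by
      rw [mul_pow, inv_pow]; ring
    rw [e2, div_mul_eq_mul_div, le_div_iff₀ hs2, sq_abs]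
    have h1 := Real.sin_sq_add_cos_sq φ
    have h2 := Real.cos_le_one φ
    have h3 := Real.neg_one_le_cos φ
    have h4 : Real.sin φ ^ 2 = (1 - Real.cos φ) * (1 + Real.cos φ) := by linarith
    have h5 : Real.sin φ ^ 2 ≤ 2 * (1 - Real.cos φ) := by rw [h4]; nlinarith
    -- The identity behind this is 4(a² - 2ay cos φ + y²) = 2(1 + cos φ)(a - y)² + 2(1 - cos φ)(a +
    -- y)², combined with sin² φ ≤ 2(1 - cos φ).
    nlinarith [mul_nonneg (by linarith : 0 ≤ 1 + Real.cos φ) (sq_nonneg (a - y)),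
      mul_le_mul_of_nonneg_left h5 (sq_nonneg (a + y))]
  · have hcos : Real.cos φ ≤ 0 := by
      rw [Set.mem_union, Set.mem_Ioo, Set.mem_Ioo, not_or] at h
      refine Real.cos_nonpos_of_pi_div_two_le_of_le ?_ ?_
      · by_contra hc; exact h.1 ⟨hφ.1, not_le.mp hc⟩
      · by_contra hc
        exact h.2 ⟨by linarith [not_le.mp hc], hφ.2⟩
    -- For cos φ ≤ 0 the square of the distance is at least a² + y² ≥ (a + y)²/2.
    nlinarith [mul_nonneg (mul_nonneg ha hy) (neg_nonneg.mpr hcos), sq_nonneg (a - y),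
      sq_nonneg (a + y)]

lemma norm_sq_eq_inner_re {H : Type*} [NormedAddCommGroup H] [InnerProductSpace ℂ H] (x : H) :
    ⟪x, x⟫_ℂ = ((‖x‖ ^ 2 : ℝ) : ℂ) := by
  rw [inner_self_eq_norm_sq_to_K]; norm_cast

lemma IsElliptic.inner_mulL {d m : ℕ} {g : Space d → Matrix (Fin m) (Fin m) ℂ} {G K : ℝ}
    (hg : IsElliptic g G K) (v : L2 d m) :
    ‖v‖ ^ 2 ≤ K * (⟪v, hg.isBddMatrix.mulL v⟫_ℂ).re ∧ (⟪v, hg.isBddMatrix.mulL v⟫_ℂ).im = 0 := by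
  have hi := L2.integrable_inner (𝕜 := ℂ) v (hg.isBddMatrix.mulL v)
  have hi2 := L2.integrable_inner (𝕜 := ℂ) v v
  constructor
  · have e1 : ‖v‖ ^ 2 = (⟪v, v⟫_ℂ).re := by rw [norm_sq_eq_inner_re, Complex.ofReal_re]
    rw [e1, L2.inner_def, L2.inner_def]
    have r1 : (∫ x, ⟪v x, v x⟫_ℂ).re = ∫ x, (⟪v x, v x⟫_ℂ).re := (integral_re hi2).symm
    have r2 : (∫ x, ⟪v x, hg.isBddMatrix.mulL v x⟫_ℂ).re
        = ∫ x, (⟪v x, hg.isBddMatrix.mulL v x⟫_ℂ).re := (integral_re hi).symm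
    rw [r1, r2, ← integral_const_mul]
    refine integral_mono_ae hi2.re (hi.re.const_mul K) ?_
    filter_upwards [hg.lower, hg.isBddMatrix.coeFn_mulL v] with x h1 h2
    rw [h2, norm_sq_eq_inner_re, Complex.ofReal_re]
    exact h1 _
  · rw [L2.inner_def]
    have r2 : (∫ x, ⟪v x, hg.isBddMatrix.mulL v x⟫_ℂ).im
        = ∫ x, (⟪v x, hg.isBddMatrix.mulL v x⟫_ℂ).im := (integral_im hi).symm
    rw [r2]
    refine integral_eq_zero_of_ae ?_
    filter_upwards [hg.im_inner, hg.isBddMatrix.coeFn_mulL v] with x h1 h2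
    rw [h2]
    exact h1 _

/-! ### Existence of the resolvents. -/

section resolvent

variable {d m n p : ℕ} {b : (Fin d → ℕ) → Matrix (Fin m) (Fin n) ℂ} {α₀ α₁ : ℝ}
  {g : Space d → Matrix (Fin m) (Fin m) ℂ} {G K : ℝ} {ζ : ℂ} {φ : ℝ}

/-- Coercivity of the form of the operator `A - ζ`. -/
lemma form_coercive (hd : 1 ≤ d) (hα₀ : 0 ≤ α₀) (hα₁ : 0 ≤ α₁) (hb : SymbolBounds p b α₀ α₁)
    (hg : IsElliptic g G K) (hK : 0 < K) (hφ : φ ∈ Set.Ioo 0 (2 * Real.pi))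
    (hζ : ζ = ‖ζ‖ * Complex.exp (φ * Complex.I)) {u : L2 d n} (hu : MemSobolev p u) :
    α₀ / K * dNorm p u ^ 2 + ‖ζ‖ * ‖u‖ ^ 2
      ≤ 2 * cAngle φ * ‖form p b g u u - ζ * ⟪u, u⟫_ℂ‖ := by
  obtain ⟨h1, h2⟩ := hg.inner_mulL (bD p b u)
  have h3 := (norm_bD_le hd hα₀ hα₁ hb hu).1
  rw [form_eq_inner hg]
  set z := ⟪bD p b u, hg.isBddMatrix.mulL (bD p b u)⟫_ℂ
  -- The form is real because g is Hermitian, so the estimate for a half-line and a ray applies to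
  -- it.
  have hz : z = (z.re : ℂ) := by
    apply Complex.ext <;> simp [h2]
  have h4 : α₀ / K * dNorm p u ^ 2 ≤ z.re := by
    rw [div_mul_eq_mul_div, div_le_iff₀ hK]
    calc α₀ * dNorm p u ^ 2 = (√α₀ * dNorm p u) ^ 2 := by rw [mul_pow, Real.sq_sqrt hα₀]
      _ ≤ ‖bD p b u‖ ^ 2 := by
        have := dNorm_nonneg p u
        gcongr
      _ ≤ _ := h1.trans (le_of_eq (mul_comm _ _))
  have h5 : 0 ≤ z.re := le_trans (by positivity) h4
  rw [hz, norm_sq_eq_inner_re]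
  exact (add_le_add_left h4 _).trans (add_le_cAngle_mul hφ hζ h5 (sq_nonneg _))

/-- The Fourier multiplier with a bounded symbol, as a function of `η`. -/
def IsBddMatrix.fmulL {k l : ℕ} {M : Space d → Matrix (Fin k) (Fin l) ℂ} {C : ℝ}
    (h : IsBddMatrix volume M C) : L2 d l →L[ℂ] L2 d k :=
  ((Lp.fourierTransformₗᵢ (Space d) (Vec k)).symm.toContinuousLinearEquiv :
      L2 d k →L[ℂ] L2 d k) ∘L h.mulL ∘L
    ((Lp.fourierTransformₗᵢ (Space d) (Vec l)).toContinuousLinearEquiv : L2 d l →L[ℂ] L2 d l)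

lemma IsBddMatrix.coeFn_fmulL {k l : ℕ} {M : Space d → Matrix (Fin k) (Fin l) ℂ} {C : ℝ}
    (h : IsBddMatrix volume M C) (u : L2 d l) :
    (𝓕 (h.fmulL u) : L2 d k) =ᵐ[volume] fun η => app (M η) ((𝓕 u : L2 d l) η) := by
  have e : (𝓕 (h.fmulL u) : L2 d k) = h.mulL (𝓕 u : L2 d l) :=
    fourier_fourierInv (h.mulL (𝓕 u : L2 d l))
  rw [e]
  exact h.coeFn_mulL _

lemma isBddMatrix_bessel (d n p : ℕ) : IsBddMatrix volume
    (fun η : Space d => (((bessel p η)⁻¹ : ℝ) : ℂ) • (1 : Matrix (Fin n) (Fin n) ℂ)) 1 := by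
  refine ⟨fun i j => ?_, Filter.Eventually.of_forall fun η v => ?_⟩
  · simp only [Matrix.smul_apply]
    exact ((Complex.measurable_ofReal.comp (continuous_bessel p).measurable.inv).smul_const
      _).aemeasurable
  · rw [smul_app, one_app, norm_smul, Complex.norm_real, Real.norm_of_nonneg]
    · gcongr; exact inv_le_one_of_one_le₀ (one_le_bessel p η)
    · exact inv_nonneg.mpr (zero_le_one.trans (one_le_bessel p η))

/-- b(D) has order p and the Bessel potential has order -p, so their composition is bounded in L₂.
-/
lemma isBddMatrix_bessel_symbol (hd : 1 ≤ d) (hα₀ : 0 ≤ α₀) (hα₁ : 0 ≤ α₁)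
    (hb : SymbolBounds p b α₀ α₁) : IsBddMatrix volume
    (fun η : Space d => (((bessel p η)⁻¹ : ℝ) : ℂ) • symbol p b (freq η)) √α₁ := by
  refine ⟨fun i j => ?_, Filter.Eventually.of_forall fun η v => ?_⟩
  · simp only [Matrix.smul_apply]
    exact (Complex.measurable_ofReal.comp (continuous_bessel p).measurable.inv).aemeasurable.smul
      (aemeasurable_symbol_freq i j)
  · have h1 := one_le_bessel p η
    have h0 : 0 < bessel p η := zero_lt_one.trans_le h1
    rw [smul_app, norm_smul, Complex.norm_real, Real.norm_of_nonneg (inv_nonneg.mpr h0.le),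
      inv_mul_le_iff₀ h0]
    calc _ ≤ √α₁ * (‖freq η‖ ^ p * ‖v‖) := (hb.norm_bounds hd hα₀ hα₁ _ _).2
      _ ≤ √α₁ * (bessel p η * ‖v‖) := by gcongr; exact pow_le_bessel p η
      _ = _ := by ring

/-- The Bessel potential, an isometry of `L₂` onto `H^p`. -/
def besselL (d n p : ℕ) : L2 d n →L[ℂ] L2 d n := (isBddMatrix_bessel d n p).fmulL

lemma coeFn_fourier_besselL (U : L2 d n) : (𝓕 (besselL d n p U) : L2 d n)
    =ᵐ[volume] fun η => (bessel p η)⁻¹ • (𝓕 U : L2 d n) η := by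
  filter_upwards [(isBddMatrix_bessel d n p).coeFn_fmulL U] with η h
  rw [besselL, h, smul_app, one_app]
  exact RCLike.real_smul_eq_coe_smul (K := ℂ) _ _ |>.symm

lemma bessel_smul_besselL (U : L2 d n) :
    (fun η => bessel p η • (𝓕 (besselL d n p U) : L2 d n) η) =ᵐ[volume] (𝓕 U : L2 d n) := by
  filter_upwards [coeFn_fourier_besselL (p := p) U] with η h
  rw [h, smul_smul, mul_inv_cancel₀ (zero_lt_one.trans_le (one_le_bessel p η)).ne', one_smul]

lemma memSobolev_besselL (U : L2 d n) : MemSobolev p (besselL d n p U) :=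
  memSobolev_iff.mpr ((Lp.memLp (𝓕 U : L2 d n)).ae_eq (bessel_smul_besselL U).symm)

lemma norm_le_besselL (U : L2 d n) :
    ‖U‖ ≤ √(2 ^ p) * (‖besselL d n p U‖ + dNorm p (besselL d n p U)) := by
  have h := (memSobolev_of_memLp (memSobolev_besselL (p := p) U).memLp).2
  rw [sobolevNorm_eq, eLpNorm_congr_ae (bessel_smul_besselL U)] at h
  rw [← Lp.norm_fourier_eq U, Lp.norm_def]
  refine ENNReal.toReal_le_of_le_ofReal ?_ h
  have := dNorm_nonneg p (besselL d n p U)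
  positivity

lemma exists_besselL_eq {u : L2 d n} (hu : MemSobolev p u) : ∃ U, besselL d n p U = u := by
  refine ⟨𝓕⁻ ((memSobolev_iff.mp hu).toLp _ : L2 d n), eq_of_fourier_ae_eq ?_⟩
  have e := coeFn_fourier_besselL (p := p) (𝓕⁻ ((memSobolev_iff.mp hu).toLp _ : L2 d n))
  rw [fourier_fourierInv] at e
  filter_upwards [e, (memSobolev_iff.mp hu).coeFn_toLp] with η h1 h2
  rw [h1, h2, smul_smul, inv_mul_cancel₀ (zero_lt_one.trans_le (one_le_bessel p η)).ne', one_smul]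

set_option maxHeartbeats 1600000 in
/-- The resolvent exists. -/
theorem exists_isResolvent (hd : 1 ≤ d) (hα₀ : 0 < α₀) (hα₁ : 0 ≤ α₁)
    (hb : SymbolBounds p b α₀ α₁) (hg : IsElliptic g G K) (hK : 0 < K)
    (hφ : φ ∈ Set.Ioo 0 (2 * Real.pi)) (hζ0 : ζ ≠ 0)
    (hζ : ζ = ‖ζ‖ * Complex.exp (φ * Complex.I)) :
    ∃ R : L2 d n →L[ℂ] L2 d n, IsResolvent p b g ζ R := by
  -- J parametrizes H^p by L₂, which turns the form on H^p into a bounded form on L₂.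
  set J := besselL d n p
  set B := (isBddMatrix_bessel_symbol hd hα₀.le hα₁ hb).fmulL
  have hB : ∀ U, bD p b (J U) = B U := fun U => by
    refine eq_of_fourier_ae_eq ?_
    filter_upwards [coeFn_fourier_bD hd hα₀.le hα₁ hb (memSobolev_besselL (p := p) U),
      (isBddMatrix_bessel_symbol hd hα₀.le hα₁ hb).coeFn_fmulL U,
      (isBddMatrix_bessel d n p).coeFn_fmulL U] with η h1 h2 h3
    have h3' : (𝓕 (J U) : L2 d n) η = _ := h3
    rw [h1, h2, h3', smul_app, one_app, app_smul, smul_app]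
  -- The form of A - ζ pulled back by J. It is coercive on L₂, and its inverse S gives the resolvent
  -- as J S J^*.
  set T := (ContinuousLinearMap.adjoint B) ∘L hg.isBddMatrix.mulL ∘L B
    - ζ • ((ContinuousLinearMap.adjoint J) ∘L J)
  have hT : ∀ U V, ⟪V, T U⟫_ℂ = form p b g (J U) (J V) - ζ * ⟪J V, J U⟫_ℂ := fun U V => by
    rw [form_eq_inner hg, hB, hB]
    simp only [T, sub_apply, smul_apply, ContinuousLinearMap.comp_apply, inner_sub_right,
      inner_smul_right, ContinuousLinearMap.adjoint_inner_right]
  have hz : 0 < ‖ζ‖ := norm_pos_iff.mpr hζ0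
  have hc : 0 < cAngle φ := zero_lt_one.trans_le one_le_cAngle
  set κ := min (α₀ / K) ‖ζ‖
  have hκ : 0 < κ := lt_min (by positivity) hz
  have hco : ∀ U, κ / (2 * cAngle φ * (2 * 2 ^ p)) * ‖U‖ ^ 2 ≤ ‖⟪U, T U⟫_ℂ‖ := by
    intro U
    have h1 := form_coercive hd hα₀.le hα₁ hb hg hK hφ hζ (memSobolev_besselL (p := p) U)
    rw [hT, div_mul_eq_mul_div, div_le_iff₀ (by positivity)]
    have h2 := norm_le_besselL (p := p) U
    set x := ‖besselL d n p U‖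
    set y := dNorm p (besselL d n p U)
    have h3 : ‖U‖ ^ 2 ≤ 2 ^ p * (2 * (x ^ 2 + y ^ 2)) := by
      calc ‖U‖ ^ 2 ≤ (√(2 ^ p) * (x + y)) ^ 2 := by gcongr
        _ = 2 ^ p * (x + y) ^ 2 := by rw [mul_pow, Real.sq_sqrt (by positivity)]
        _ ≤ _ := by gcongr; nlinarith [sq_nonneg (x - y)]
    have h4 : κ * (x ^ 2 + y ^ 2) ≤ 2 * cAngle φ * ‖form p b g (J U) (J U) - ζ * ⟪J U, J U⟫_ℂ‖ := by
      refine le_trans ?_ h1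
      have := mul_le_mul_of_nonneg_right (min_le_left (α₀ / K) ‖ζ‖) (sq_nonneg y)
      have := mul_le_mul_of_nonneg_right (min_le_right (α₀ / K) ‖ζ‖) (sq_nonneg x)
      linarith
    calc κ * ‖U‖ ^ 2 ≤ κ * (2 ^ p * (2 * (x ^ 2 + y ^ 2))) := by gcongr
      _ = (2 * 2 ^ p) * (κ * (x ^ 2 + y ^ 2)) := by ring
      _ ≤ (2 * 2 ^ p) * (2 * cAngle φ * ‖form p b g (J U) (J U) - ζ * ⟪J U, J U⟫_ℂ‖) := by
        gcongr
      _ = _ := by ring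
  obtain ⟨S, hS1, hS2⟩ := exists_inverse_of_coercive T (by positivity) hco
  refine ⟨J ∘L S ∘L (ContinuousLinearMap.adjoint J), fun f u => ⟨?_, ?_⟩⟩
  · rintro rfl
    refine ⟨memSobolev_besselL _, fun v hv => ?_⟩
    obtain ⟨V, rfl⟩ := exists_besselL_eq hv
    have h1 := hT (S (ContinuousLinearMap.adjoint J f)) V
    rw [hS2, ContinuousLinearMap.adjoint_inner_right] at h1
    simp only [ContinuousLinearMap.comp_apply, inner_add_right, inner_smul_right]
    rw [h1]; ring
  · rintro ⟨hu, h⟩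
    obtain ⟨U, rfl⟩ := exists_besselL_eq hu
    have h1 : T U = ContinuousLinearMap.adjoint J f := by
      refine ext_inner_left ℂ fun V => ?_
      rw [hT, h _ (memSobolev_besselL V), ContinuousLinearMap.adjoint_inner_right,
        inner_add_right, inner_smul_right]
      ring
    simp only [ContinuousLinearMap.comp_apply]
    rw [← h1, hS1]

end resolvent

/-! ### Constant coefficients: the effective resolvent at each frequency. -/

section effective

variable {d m n p : ℕ} {b : (Fin d → ℕ) → Matrix (Fin m) (Fin n) ℂ} {α₀ α₁ : ℝ}
  {A : Matrix (Fin m) (Fin m) ℂ} {G K : ℝ} {ζ : ℂ} {φ : ℝ}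

lemma coeFn_fourier_mulL_const {C : ℝ} (h : IsBddMatrix volume (fun _ : Space d => A) C)
    (u : L2 d m) :
    (𝓕 (h.mulL u) : L2 d m) =ᵐ[volume] fun η => app A ((𝓕 u : L2 d m) η) := by
  have e : h.mulL u = (appL A).compLpL 2 volume u := by
    refine Lp.ext ?_
    filter_upwards [h.coeFn_mulL u, (appL A).coeFn_compLpL (μ := volume) u] with x h1 h2
    rw [h1, h2, appL_apply]
  rw [e, fourier_compLpL]
  exact (appL A).coeFn_compLpL _

/-- The ball of radius `N` in frequency space. -/
def freqBall (d N : ℕ) : Set (Space d) := {η | ‖freq η‖ ≤ N}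

lemma measurableSet_freqBall (d N : ℕ) : MeasurableSet (freqBall d N) :=
  (isClosed_le ((continuous_const_smul _).norm) continuous_const).measurableSet

/-- W is not assumed square integrable, so the difference W - w need not be an admissible test
function. Its restriction to a frequency ball is the transform of an element of H^p; testing with
that proves equality on each ball. -/
lemma ae_eq_of_fourier_inner_eq {W : Space d → Vec n} {w : L2 d n}
    (hW : ∀ N : ℕ, MemLp ((freqBall d N).indicator W) 2 volume)
    (h : ∀ v : L2 d n, MemSobolev p v → ∫ η, ⟪(𝓕 v : L2 d n) η, W η - w η⟫_ℂ = 0) :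
    W =ᵐ[volume] w := by
  have hball : ∀ N : ℕ, ∀ᵐ η : Space d, η ∈ freqBall d N → W η = w η := by
    intro N
    set B := freqBall d N
    have hD : MemLp (B.indicator (fun η => W η - w η)) 2 volume := by
      have h2 := (Lp.memLp w).indicator (measurableSet_freqBall d N)
      have e : B.indicator (fun η => W η - w η) = B.indicator W - B.indicator w :=
        Set.indicator_sub' B W w
      rw [e]
      exact (hW N).sub h2
    set v : L2 d n := 𝓕⁻ (hD.toLp _ : L2 d n)
    have hv : (𝓕 v : L2 d n) =ᵐ[volume] B.indicator (fun η => W η - w η) := by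
      rw [fourier_fourierInv]; exact hD.coeFn_toLp
    have hvS : MemSobolev p v := by
      refine (memSobolev_of_memLp (hD.of_le_mul (c := (N : ℝ) ^ p)
        (aestronglyMeasurable_smul_fourier (continuous_freq_pow p) v) ?_)).1
      filter_upwards [hv] with η h1
      rw [h1, norm_smul, Real.norm_of_nonneg (by positivity)]
      by_cases hη : η ∈ B
      · have : ‖freq η‖ ≤ N := hη
        gcongr
      · rw [Set.indicator_of_notMem hη, norm_zero, mul_zero, mul_zero]
    have h1 : ∫ η, ((‖B.indicator (fun η => W η - w η) η‖ ^ 2 : ℝ) : ℂ) = 0 := by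
      rw [← h v hvS]
      refine integral_congr_ae ?_
      filter_upwards [hv] with η e4
      rw [e4]
      by_cases hη : η ∈ B
      · rw [Set.indicator_of_mem hη, ← norm_sq_eq_inner_re]
      · rw [Set.indicator_of_notMem hη, inner_zero_left]; simp
    rw [integral_complex_ofReal, Complex.ofReal_eq_zero, integral_eq_zero_iff_of_nonneg
      (fun η => sq_nonneg _) (hD.integrable_norm_pow two_ne_zero)] at h1
    filter_upwards [h1] with η e hη
    have e2 : ‖B.indicator (fun η => W η - w η) η‖ ^ 2 = 0 := e
    rw [Set.indicator_of_mem hη, sq_eq_zero_iff, norm_eq_zero] at e2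
    exact sub_eq_zero.mp e2
  filter_upwards [ae_all_iff.mpr hball] with η hη
  obtain ⟨N, hN⟩ := exists_nat_ge ‖freq η‖
  exact hη N hN

lemma memLp_indicator_symbol_adjoint (hd : 1 ≤ d) (hα₀ : 0 ≤ α₀) (hα₁ : 0 ≤ α₁)
    (hb : SymbolBounds p b α₀ α₁) (N : ℕ) {w : Space d → Vec m} (hw : MemLp w 2 volume) :
    MemLp ((freqBall d N).indicator fun η => app (symbol p b (freq η))ᴴ (w η)) 2 volume := by
  have hm : AEStronglyMeasurable (fun η : Space d => app (symbol p b (freq η))ᴴ (w η)) volume := by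
    refine aestronglyMeasurable_app (fun i j => ?_) hw.1
    simp only [Matrix.conjTranspose_apply]
    exact continuous_star.measurable.comp_aemeasurable (aemeasurable_symbol_freq j i)
  refine hw.of_le_mul (c := √α₁ * (N : ℝ) ^ p) (hm.indicator (measurableSet_freqBall d N))
    (Filter.Eventually.of_forall fun η => ?_)
  by_cases hη : η ∈ freqBall d N
  · rw [Set.indicator_of_mem hη]
    refine (norm_app_le _ _).trans ?_
    rw [Matrix.l2_opNorm_conjTranspose]
    gcongr
    refine norm_le_of_norm_app_le (by positivity) fun v => ?_
    refine (hb.norm_bounds hd hα₀ hα₁ _ v).2.trans ?_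
    rw [← mul_assoc]
    have : ‖freq η‖ ≤ N := hη
    exact mul_le_mul_of_nonneg_right (mul_le_mul_of_nonneg_left
      (pow_le_pow_left₀ (norm_nonneg _) this p) (Real.sqrt_nonneg _)) (norm_nonneg _)
  · rw [Set.indicator_of_notMem hη, norm_zero]; positivity

/-- The Fourier image of an equation with constant coefficients. -/
lemma ae_eq_of_operatorGraph (hd : 1 ≤ d) (hα₀ : 0 ≤ α₀) (hα₁ : 0 ≤ α₁)
    (hb : SymbolBounds p b α₀ α₁) (hA : IsElliptic (fun _ : Space d => A) G K) {u f : L2 d n}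
    (h : OperatorGraph p b (fun _ => A) u f) :
    ∀ᵐ η : Space d, app (symbol p b (freq η))ᴴ (app A (app (symbol p b (freq η))
      ((𝓕 u : L2 d n) η))) = (𝓕 f : L2 d n) η := by
  set y : L2 d m := 𝓕 (hA.isBddMatrix.mulL (bD p b u))
  have hy : ∀ᵐ η : Space d, (y : Space d → Vec m) η
      = app A (app (symbol p b (freq η)) ((𝓕 u : L2 d n) η)) := by
    filter_upwards [coeFn_fourier_bD hd hα₀ hα₁ hb h.1,
        coeFn_fourier_mulL_const hA.isBddMatrix (bD p b u)] with η e2 e3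
    rw [← e2]; exact e3
  have key : (fun η : Space d => app (symbol p b (freq η))ᴴ ((y : Space d → Vec m) η))
      =ᵐ[volume] (𝓕 f : L2 d n) := by
    refine ae_eq_of_fourier_inner_eq (p := p)
      (fun N => memLp_indicator_symbol_adjoint hd hα₀ hα₁ hb N (Lp.memLp y)) fun v hvS => ?_
    have key := h.2 v hvS
    rw [form_eq_inner hA, ← Lp.inner_fourier_eq, ← Lp.inner_fourier_eq v, L2.inner_def,
      L2.inner_def] at key
    have hi1 := L2.integrable_inner (𝕜 := ℂ) (𝓕 (bD p b v) : L2 d m) y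
    have hi2 := L2.integrable_inner (𝕜 := ℂ) (𝓕 v : L2 d n) (𝓕 f : L2 d n)
    have h0 := sub_eq_zero.mpr key
    rw [← integral_sub hi1 hi2] at h0
    rw [← h0]
    refine integral_congr_ae ?_
    filter_upwards [coeFn_fourier_bD hd hα₀ hα₁ hb hvS] with η e1
    rw [e1, inner_app_left, ← inner_sub_right]
  filter_upwards [key, hy] with η h1 h2
  rw [← h1, h2]

/-- The resolvent of the effective operator, pointwise in Fourier space. -/
lemma resolvent_pointwise (hd : 1 ≤ d) (hα₀ : 0 ≤ α₀) (hα₁ : 0 ≤ α₁)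
    (hb : SymbolBounds p b α₀ α₁) (hA : IsElliptic (fun _ : Space d => A) G K) (hK : 0 < K)
    (hφ : φ ∈ Set.Ioo 0 (2 * Real.pi)) (hζ : ζ = ‖ζ‖ * Complex.exp (φ * Complex.I))
    {R : L2 d n →L[ℂ] L2 d n} (hR : IsResolvent p b (fun _ => A) ζ R) (f : L2 d n) :
    ∀ᵐ η : Space d, (α₀ / K * ‖freq η‖ ^ (2 * p) + ‖ζ‖) * ‖(𝓕 (R f) : L2 d n) η‖
      ≤ 2 * cAngle φ * ‖(𝓕 f : L2 d n) η‖ := by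
  have hG := (hR f (R f)).mp rfl
  have hlow : ∀ c : Vec m, ‖c‖ ^ 2 ≤ K * (⟪c, app A c⟫_ℂ).re := by
    obtain ⟨_, h⟩ := hA.lower.exists
    exact h
  have him : ∀ c : Vec m, (⟪c, app A c⟫_ℂ).im = 0 := by
    obtain ⟨_, h⟩ := hA.im_inner.exists
    exact h
  have hsm := coeFn_fourier_smul ζ (R f)
  filter_upwards [ae_eq_of_operatorGraph hd hα₀ hα₁ hb hA hG, coeFn_fourier_add f (ζ • R f),
    hsm] with η h1 h2 h3
  rw [h2, h3] at h1
  set u := (𝓕 (R f) : L2 d n) η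
  set w := (𝓕 f : L2 d n) η
  set c := app (symbol p b (freq η)) u
  -- The equation b^*Ab û - ζû = f̂ paired with û at a single frequency; the coercivity argument is
  -- then repeated for numbers.
  have e1 : ⟪u, w⟫_ℂ = ⟪c, app A c⟫_ℂ - ζ * ((‖u‖ ^ 2 : ℝ) : ℂ) := by
    rw [inner_app_left, h1, inner_add_right, inner_smul_right, norm_sq_eq_inner_re]; ring
  set z := ⟪c, app A c⟫_ℂ
  have hz : z = (z.re : ℂ) := by
    apply Complex.ext <;> simp [z, him c]
  have h4 : α₀ / K * ‖freq η‖ ^ (2 * p) * ‖u‖ ^ 2 ≤ z.re := by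
    have h5 := (hb.norm_bounds hd hα₀ hα₁ (freq η) u).1
    have h6 : α₀ * (‖freq η‖ ^ (2 * p) * ‖u‖ ^ 2) ≤ ‖c‖ ^ 2 := by
      calc _ = (√α₀ * (‖freq η‖ ^ p * ‖u‖)) ^ 2 := by
            rw [mul_pow, Real.sq_sqrt hα₀]; ring
        _ ≤ _ := by gcongr
    have h7 := h6.trans (hlow c)
    rw [mul_assoc, div_mul_eq_mul_div, div_le_iff₀ hK, mul_comm z.re]
    exact h7
  have h5 : 0 ≤ z.re := le_trans (by positivity) h4
  have h6 := add_le_cAngle_mul hφ hζ h5 (sq_nonneg ‖u‖)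
  rw [← hz, ← e1] at h6
  have h7 : (α₀ / K * ‖freq η‖ ^ (2 * p) + ‖ζ‖) * ‖u‖ ^ 2 ≤ 2 * cAngle φ * (‖u‖ * ‖w‖) := by
    have hc : 0 < cAngle φ := zero_lt_one.trans_le one_le_cAngle
    calc _ ≤ z.re + ‖ζ‖ * ‖u‖ ^ 2 := by rw [add_mul]; gcongr
      _ ≤ _ := h6
      _ ≤ _ := by gcongr; exact norm_inner_le_norm _ _
  by_cases hu : ‖u‖ = 0
  · rw [hu, mul_zero]
    have hc : 0 < cAngle φ := zero_lt_one.trans_le one_le_cAngle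
    positivity
  · have hu' : 0 < ‖u‖ := lt_of_le_of_ne (norm_nonneg _) (Ne.symm hu)
    refine le_of_mul_le_mul_right ?_ hu'
    calc _ = (α₀ / K * ‖freq η‖ ^ (2 * p) + ‖ζ‖) * ‖u‖ ^ 2 := by ring
      _ ≤ _ := h7
      _ = _ := by ring

end effective

/-! ### Fourier coefficients of vector-valued periodic functions -/

section VectorCoefficients

variable {d k n : ℕ} (β : Module.Basis (Fin d) ℝ (Space d))

lemma vcoef_congr {v w : Space d → Vec n} (h : v =ᵐ[cellMeasure β] w) (q : Fin d → ℤ) :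
    vcoef β v q = vcoef β w q := by
  ext i
  exact fcoef_congr β (h.mono fun x hx => by simp [hx]) q

lemma memLp_app_const (M : Matrix (Fin k) (Fin n) ℂ) {X : Type*} [MeasurableSpace X]
    {μ : Measure X} {v : X → Vec n} {r : ℝ≥0∞} (hv : MemLp v r μ) :
    MemLp (fun x => app M (v x)) r μ := (appL M).comp_memLp' hv

lemma vcoef_app (M : Matrix (Fin k) (Fin n) ℂ) {v : Space d → Vec n}
    (hv : MemLp v 2 (cellMeasure β)) (q : Fin d → ℤ) :
    vcoef β (fun x => app M (v x)) q = app M (vcoef β v q) := by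
  ext i
  simp only [vcoef_apply, app_apply]
  rw [fcoef_sum β _ fun j _ => (memLp_coord hv j).const_mul _]
  exact Finset.sum_congr rfl fun j _ => fcoef_const_mul β _ _ q

lemma vcoef_sum {ι : Type*} (S : Finset ι) {v : ι → Space d → Vec n}
    (hv : ∀ i ∈ S, MemLp (v i) 2 (cellMeasure β)) (q : Fin d → ℤ) :
    vcoef β (fun x => ∑ i ∈ S, v i x) q = ∑ i ∈ S, vcoef β (v i) q := by
  ext i
  simp only [vcoef_apply, WithLp.ofLp_sum, Finset.sum_apply]
  exact fcoef_sum β S (fun j hj => memLp_coord (hv j hj) i) q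

lemma vcoef_add {v w : Space d → Vec n} (hv : MemLp v 2 (cellMeasure β))
    (hw : MemLp w 2 (cellMeasure β)) (q : Fin d → ℤ) :
    vcoef β (fun x => v x + w x) q = vcoef β v q + vcoef β w q := by
  ext i
  exact fcoef_add β (memLp_coord hv i) (memLp_coord hw i) q

lemma vcoef_smul (c : ℂ) (v : Space d → Vec n) (q : Fin d → ℤ) :
    vcoef β (fun x => c • v x) q = c • vcoef β v q := by
  ext i
  exact fcoef_const_mul β _ c q

lemma vcoef_zero {v : Space d → Vec n} (hv : MemLp v 2 (cellMeasure β)) :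
    vcoef β v 0 = ∫ x, v x ∂(cellMeasure β) := by
  ext i
  rw [integral_coord (hv.integrable (by norm_num)), vcoef_apply, fcoef_zero]

lemma vcoef_const (c : Vec n) (q : Fin d → ℤ) :
    vcoef β (fun _ => c) q = if q = 0 then c else 0 := by
  ext i
  have : (fun _ : Space d => c i) = fun x => c i * wave β 0 x := by ext x; simp [wave_zero]
  rw [vcoef_apply, this, fcoef_const_mul, fcoef_wave]
  split_ifs <;> simp

lemma hasSum_inner_vcoef {v w : Space d → Vec n} (hv : MemLp v 2 (cellMeasure β))
    (hw : MemLp w 2 (cellMeasure β)) :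
    HasSum (fun q => ⟪vcoef β v q, vcoef β w q⟫_ℂ) (∫ x, ⟪v x, w x⟫_ℂ ∂(cellMeasure β)) := by
  have h1 : ∀ a c : Vec n, ⟪a, c⟫_ℂ = ∑ i, (starRingEnd ℂ) (a i) * c i := fun a c => by
    simp [PiLp.inner_apply, mul_comm]
  simp only [h1]
  rw [integral_finsetSum _ fun i _ => ?_]
  · exact hasSum_sum fun i _ => hasSum_fcoef_mul β (memLp_coord hv i) (memLp_coord hw i)
  · exact (memLp_coord hv i).star.integrable_mul (memLp_coord hw i)

lemma hasSum_norm_vcoef_sq {v : Space d → Vec n} (hv : MemLp v 2 (cellMeasure β)) :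
    HasSum (fun q => ‖vcoef β v q‖ ^ 2) (∫ x, ‖v x‖ ^ 2 ∂(cellMeasure β)) := by
  have h := hasSum_inner_vcoef β hv hv
  simp only [norm_sq_eq_inner_re] at h
  rw [integral_complex_ofReal] at h
  exact_mod_cast h

lemma ae_eq_of_vcoef_eq {v w : Space d → Vec n} (hv : MemLp v 2 (cellMeasure β))
    (hw : MemLp w 2 (cellMeasure β)) (h : ∀ q, vcoef β v q = vcoef β w q) :
    v =ᵐ[cellMeasure β] w := by
  have : ∀ i, (fun x => v x i) =ᵐ[cellMeasure β] fun x => w x i := fun i =>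
    ae_eq_of_fcoef_eq β (memLp_coord hv i) (memLp_coord hw i) fun q => by
      rw [← vcoef_apply, ← vcoef_apply, h q]
  filter_upwards [ae_all_iff.mpr this] with x hx
  ext i
  exact hx i

lemma exists_periodic_of_summable_vec {a : (Fin d → ℤ) → Vec n}
    (ha : Summable fun q => ‖a q‖ ^ 2) :
    ∃ v : Space d → Vec n, IsPeriodic β v ∧ MemLp v 2 (cellMeasure β) ∧ vcoef β v = a := by
  have h : ∀ i : Fin n, Summable fun q => ‖a q i‖ ^ 2 := fun i =>
    ha.of_nonneg_of_le (fun q => by positivity) fun q => by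
      have := PiLp.norm_apply_le (a q) i
      gcongr
  choose f hper hL hc using fun i => exists_periodic_of_summable β (h i)
  refine ⟨fun x => WithLp.toLp 2 fun i => f i x, fun γ hγ x => ?_, memLp_of_coord hL, ?_⟩
  · simp only [fun i => hper i γ hγ x]
  · ext q i
    exact hc i q

/-! ### Periodic Sobolev functions -/

/-- Only the two extreme weights are needed: for |α| ≤ p the monomial s^α is bounded by 1 if |s| ≤ 1
and by |s|^p otherwise. -/
lemma exists_memPeriodicSobolev (p : ℕ) {a : (Fin d → ℤ) → Vec n}
    (ha : Summable fun q => ‖a q‖ ^ 2)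
    (hap : Summable fun q => (‖dualVec β q‖ ^ p * ‖a q‖) ^ 2) :
    ∃ v : Space d → Vec n, MemPeriodicSobolev β p v ∧ vcoef β v = a := by
  obtain ⟨v, hper, hL, hv⟩ := exists_periodic_of_summable_vec β ha
  refine ⟨v, ⟨hper, (memLp_cellMeasure β).mp hL, fun α hα => ?_⟩, hv⟩
  have hs : Summable fun q =>
      ‖(Complex.I ^ (∑ j, α j) * monom α (dualVec β q)) • a q‖ ^ 2 := by
    refine (ha.add hap).of_nonneg_of_le (fun q => by positivity) fun q => ?_
    rw [norm_smul, norm_mul, norm_pow, Complex.norm_I, one_pow, one_mul, mul_pow, mul_pow]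
    have h1 : ‖monom α (dualVec β q)‖ ^ 2 ≤ 1 + (‖dualVec β q‖ ^ p) ^ 2 := by
      have h2 : ‖monom α (dualVec β q)‖ ^ 2 ≤ (‖dualVec β q‖ ^ (∑ j, α j)) ^ 2 := by
        gcongr; exact norm_monom_le _ _
      rcases le_total ‖dualVec β q‖ 1 with h | h
      · have : (‖dualVec β q‖ ^ (∑ j, α j)) ^ 2 ≤ 1 :=
          pow_le_one₀ (by positivity) (pow_le_one₀ (norm_nonneg _) h)
        nlinarith [sq_nonneg (‖dualVec β q‖ ^ p)]
      · have : (‖dualVec β q‖ ^ (∑ j, α j)) ^ 2 ≤ (‖dualVec β q‖ ^ p) ^ 2 := by gcongr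
        linarith
    calc _ ≤ (1 + (‖dualVec β q‖ ^ p) ^ 2) * ‖a q‖ ^ 2 := by gcongr
      _ = _ := by ring
  obtain ⟨w, hwper, hwL, hw⟩ := exists_periodic_of_summable_vec β hs
  exact ⟨w, isWeakDeriv_of_fcoef β hL hwL hwper fun q => by rw [hw, hv]⟩

variable {β} {p m : ℕ} (b : (Fin d → ℕ) → Matrix (Fin m) (Fin n) ℂ) {v : Space d → Vec n}

lemma MemPeriodicSobolev.isWeakDeriv (hv : MemPeriodicSobolev β p v) {α : Fin d → ℕ}
    (hα : ∑ j, α j ≤ p) : IsWeakDeriv β α v (weakDeriv β α v) := by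
  rw [weakDeriv, dif_pos (hv.2.2 α hα)]
  exact (hv.2.2 α hα).choose_spec

lemma MemPeriodicSobolev.memLp_cell (hv : MemPeriodicSobolev β p v) :
    MemLp v 2 (cellMeasure β) := (memLp_cellMeasure β).mpr hv.2.1

lemma MemPeriodicSobolev.memLp_term (hv : MemPeriodicSobolev β p v) {α : Fin d → ℕ}
    (hα : α ∈ multiIndices d p) :
    MemLp (fun x => app (b α) ((-Complex.I) ^ p • weakDeriv β α v x)) 2 (cellMeasure β) :=
  memLp_app_const _ (((memLp_cellMeasure β).mpr
    (hv.isWeakDeriv (sum_of_mem_multiIndices hα).le).2.1).const_smul ((-Complex.I) ^ p))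

lemma MemPeriodicSobolev.memLp_periodicBD (hv : MemPeriodicSobolev β p v) :
    MemLp (periodicBD β p b v) 2 (cellMeasure β) :=
  memLp_finsetSum _ fun _ hα => hv.memLp_term b hα

lemma MemPeriodicSobolev.isPeriodic_periodicBD (hv : MemPeriodicSobolev β p v) :
    IsPeriodic β (periodicBD β p b v) := fun γ hγ x =>
  Finset.sum_congr rfl fun α hα => by
    rw [(hv.isWeakDeriv (sum_of_mem_multiIndices hα).le).1 γ hγ x]

/-- The factor (-i)^p in D^α cancels the i^p that ∂^α produces, which leaves the symbol at the dual
vector. -/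
lemma MemPeriodicSobolev.vcoef_periodicBD (hv : MemPeriodicSobolev β p v) (q : Fin d → ℤ) :
    vcoef β (periodicBD β p b v) q = app (symbol p b (dualVec β q)) (vcoef β v q) := by
  have h1 : vcoef β (periodicBD β p b v) q = ∑ α ∈ multiIndices d p,
      vcoef β (fun x => app (b α) ((-Complex.I) ^ p • weakDeriv β α v x)) q :=
    vcoef_sum β _ (fun α hα => hv.memLp_term b hα) q
  rw [h1, symbol_eq, sum_app]
  refine Finset.sum_congr rfl fun α hα => ?_
  have hw := hv.isWeakDeriv (sum_of_mem_multiIndices hα).le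
  rw [vcoef_app β (v := fun x => (-Complex.I) ^ p • weakDeriv β α v x) _ (((memLp_cellMeasure β).mpr hw.2.1).const_smul ((-Complex.I) ^ p)),
    vcoef_smul, fcoef_of_isWeakDeriv β hv.memLp_cell hw, sum_of_mem_multiIndices hα, smul_app,
    ← app_smul, smul_smul, ← mul_assoc, ← mul_pow]
  simp

end VectorCoefficients

/-! ### Solvability of the cell problem -/

lemma symbol_zero {d m n p : ℕ} (hp : p ≠ 0) (b : (Fin d → ℕ) → Matrix (Fin m) (Fin n) ℂ) :
    symbol p b 0 = 0 := by
  have := symbol_smul p b 0 0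
  simpa [hp] using this

/-- Orthogonality to the kernel of the adjoint characterizes the range. -/
lemma exists_app_eq {k n : ℕ} (M : Matrix (Fin k) (Fin n) ℂ) {y : Vec k}
    (h : ∀ c, app Mᴴ c = 0 → ⟪c, y⟫_ℂ = 0) : ∃ v, app M v = y := by
  have : y ∈ ((LinearMap.range (appL M).toLinearMap)ᗮ)ᗮ := by
    rw [Submodule.mem_orthogonal]
    intro c hc
    refine h c ?_
    refine ext_inner_left ℂ fun v => ?_
    rw [← inner_app_left, inner_zero_right]
    exact Submodule.inner_right_of_mem_orthogonal (LinearMap.mem_range_self _ v) hc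
  rw [Submodule.orthogonal_orthogonal] at this
  exact this

lemma cellMeasure_absolutelyContinuous {d : ℕ} (β : Module.Basis (Fin d) ℝ (Space d)) :
    cellMeasure β ≪ volume := by
  rw [← Measure.ae_le_iff_absolutelyContinuous]
  exact fun s hs => ae_cell_of_ae β hs

lemma IsElliptic.isBddMatrix_cell {d m : ℕ} {g : Space d → Matrix (Fin m) (Fin m) ℂ} {G K : ℝ}
    (hg : IsElliptic g G K) (β : Module.Basis (Fin d) ℝ (Space d)) :
    IsBddMatrix (cellMeasure β) g G :=
  ⟨fun i j => (hg.measurable i j).mono_ac (cellMeasure_absolutelyContinuous β),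
    ae_cell_of_ae β hg.isBddMatrix.bound⟩

lemma setIntegral_cell_eq_zero {d : ℕ} (β : Module.Basis (Fin d) ℝ (Space d)) {E : Type*}
    [NormedAddCommGroup E] [NormedSpace ℝ E] {f : Space d → E} :
    ∫ x in cell β, f x = 0 ↔ ∫ x, f x ∂(cellMeasure β) = 0 := by
  rw [integral_cellMeasure, smul_eq_zero, inv_eq_zero]
  simp [(volume_real_cell_pos β).ne']

section CellProblem

variable {d m n p : ℕ} {b : (Fin d → ℕ) → Matrix (Fin m) (Fin n) ℂ} {α₀ α₁ : ℝ}
  {g : Space d → Matrix (Fin m) (Fin m) ℂ} {G K : ℝ} {β : Module.Basis (Fin d) ℝ (Space d)}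

lemma integral_inner_toLp {X : Type*} [MeasurableSpace X] {μ : Measure X} {u v : X → Vec m}
    (hu : MemLp u 2 μ) (hv : MemLp v 2 μ) : ∫ x, ⟪u x, v x⟫_ℂ ∂μ = ⟪hu.toLp u, hv.toLp v⟫_ℂ := by
  rw [L2.inner_def]
  refine integral_congr_ae ?_
  filter_upwards [hu.coeFn_toLp, hv.coeFn_toLp] with x h1 h2
  rw [h1, h2]

lemma integral_norm_sq_toLp {X : Type*} [MeasurableSpace X] {μ : Measure X} {u : X → Vec m}
    (hu : MemLp u 2 μ) : ∫ x, ‖u x‖ ^ 2 ∂μ = ‖hu.toLp u‖ ^ 2 := by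
  have h := integral_inner_toLp hu hu
  simp only [norm_sq_eq_inner_re] at h
  rw [integral_complex_ofReal] at h
  exact_mod_cast h

/-- The coercivity of multiplication by `g` in `L₂(Ω)`. -/
lemma IsElliptic.le_integral_inner_cell (hg : IsElliptic g G K) {u : Space d → Vec m}
    (hu : MemLp u 2 (cellMeasure β)) :
    ∫ x, ‖u x‖ ^ 2 ∂(cellMeasure β) ≤ K * (∫ x, ⟪u x, app (g x) (u x)⟫_ℂ ∂(cellMeasure β)).re := by
  have hgu := (hg.isBddMatrix_cell β).memLp hu
  have hint : Integrable (fun x => ⟪u x, app (g x) (u x)⟫_ℂ) (cellMeasure β) :=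
    (L2.integrable_inner (𝕜 := ℂ) (hu.toLp u) (hgu.toLp _)).congr (by
      filter_upwards [hu.coeFn_toLp, hgu.coeFn_toLp] with x h1 h2
      rw [h1, h2])
  have hre : (∫ x, ⟪u x, app (g x) (u x)⟫_ℂ ∂(cellMeasure β)).re
      = ∫ x, (⟪u x, app (g x) (u x)⟫_ℂ).re ∂(cellMeasure β) := (integral_re hint).symm
  rw [hre, ← integral_const_mul]
  refine integral_mono_ae ((memLp_two_iff_integrable_sq_norm hu.1).mp hu)
    (hint.re.const_mul K) ?_
  filter_upwards [ae_cell_of_ae β hg.lower] with x hx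
  exact hx (u x)

/-- Supplies test functions that isolate one Fourier coefficient. -/
lemma exists_sobolev_single (p : ℕ) (q : Fin d → ℤ) (c : Vec n) :
    ∃ w : Space d → Vec n, MemPeriodicSobolev β p w ∧ vcoef β w = Pi.single q c := by
  refine exists_memPeriodicSobolev β p (summable_of_hasFiniteSupport ?_)
    (summable_of_hasFiniteSupport ?_)
  all_goals
    refine (Set.finite_singleton q).subset fun r hr => ?_
    by_contra h
    refine hr ?_
    have h0 : (Pi.single q c : (Fin d → ℤ) → Vec n) r = 0 := by
      have hrq : r ≠ q := by simpa using h
      simp [hrq]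
    simp [h0]

/-- Orthogonality to all `b(D)w` says that the Fourier coefficients are in the kernels of the
adjoint symbols. -/
lemma orthogonal_periodicBD_iff {F : Space d → Vec m} (hF : MemLp F 2 (cellMeasure β)) :
    (∀ w : Space d → Vec n, MemPeriodicSobolev β p w →
      ∫ x in cell β, ⟪periodicBD β p b w x, F x⟫_ℂ = 0) ↔
    ∀ q, app (symbol p b (dualVec β q))ᴴ (vcoef β F q) = 0 := by
  constructor
  · intro h q
    refine ext_inner_left ℂ fun c => ?_
    obtain ⟨w, hw, hc⟩ := exists_sobolev_single (β := β) p q c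
    have h1 := hasSum_inner_vcoef β (hw.memLp_periodicBD b) hF
    rw [(setIntegral_cell_eq_zero β).mp (h w hw)] at h1
    have h2 := h1.unique (hasSum_single q fun r hr => by
      rw [hw.vcoef_periodicBD, hc, Pi.single_eq_of_ne hr, app_zero, inner_zero_left])
    rw [hw.vcoef_periodicBD, hc, Pi.single_eq_same, inner_app_left] at h2
    rw [← h2, inner_zero_right]
  · intro h w hw
    rw [setIntegral_cell_eq_zero]
    refine (hasSum_inner_vcoef β (hw.memLp_periodicBD b) hF).unique ?_
    convert hasSum_zero using 2 with q
    rw [hw.vcoef_periodicBD, inner_app_left, h q, inner_zero_right]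

/-- A function whose Fourier coefficients are in the ranges of the symbols is of the form
`b(D)v`. -/
lemma exists_periodicBD_eq (hd : 1 ≤ d) (hp : p ≠ 0) (hα₀ : 0 < α₀) (hα₁ : 0 ≤ α₁)
    (hb : SymbolBounds p b α₀ α₁) {F : Space d → Vec m} (hF : MemLp F 2 (cellMeasure β))
    (h : ∀ q, ∃ v, app (symbol p b (dualVec β q)) v = vcoef β F q) :
    ∃ v : Space d → Vec n, MemPeriodicSobolev β p v ∧ vcoef β v 0 = 0 ∧
      periodicBD β p b v =ᵐ[cellMeasure β] F := by
  choose a ha using h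
  obtain ⟨r, hr, hle⟩ := exists_le_norm_dualVec β
  -- The symbol vanishes at 0, so the preimage there is arbitrary; taking it to be 0 makes the mean
  -- of v vanish.
  set a' : (Fin d → ℤ) → Vec n := fun q => if q = 0 then 0 else a q with ha'
  have hbase := (hasSum_norm_vcoef_sq β hF).summable
  -- Ellipticity converts square summability of the coefficients of F into summability of those of v
  -- with the weight |s|^p.
  have hpt : ∀ q, α₀ * (‖dualVec β q‖ ^ p * ‖a' q‖) ^ 2 ≤ ‖vcoef β F q‖ ^ 2 := fun q => by
    by_cases hq : q = 0
    · simp only [ha', hq, if_true, norm_zero, mul_zero, ne_eq, OfNat.ofNat_ne_zero,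
        not_false_eq_true, zero_pow]
      positivity
    · simp only [ha', hq, if_false]
      rw [← ha q]
      have := (hb.norm_bounds hd hα₀.le hα₁ (dualVec β q) (a q)).1
      calc α₀ * (‖dualVec β q‖ ^ p * ‖a q‖) ^ 2
          = (√α₀ * (‖dualVec β q‖ ^ p * ‖a q‖)) ^ 2 := by
            rw [mul_pow (√α₀), Real.sq_sqrt hα₀.le]
        _ ≤ _ := by gcongr
  have hs2 : Summable fun q => (‖dualVec β q‖ ^ p * ‖a' q‖) ^ 2 :=
    (hbase.mul_left α₀⁻¹).of_nonneg_of_le (fun q => by positivity) fun q => by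
      rw [← div_eq_inv_mul, le_div_iff₀ hα₀, mul_comm]
      exact hpt q
  have hs1 : Summable fun q => ‖a' q‖ ^ 2 :=
    (hs2.mul_left (((2 * r) ^ p) ^ 2)⁻¹).of_nonneg_of_le (fun q => by positivity) fun q => by
      by_cases hq : q = 0
      · simp only [ha', hq, if_true, norm_zero, mul_zero, ne_eq, OfNat.ofNat_ne_zero,
          not_false_eq_true, zero_pow, le_refl]
      · rw [← div_eq_inv_mul, le_div_iff₀ (by positivity), mul_comm, ← mul_pow]
        have := hle q hq
        gcongr
  obtain ⟨v, hv, hvc⟩ := exists_memPeriodicSobolev β p hs1 hs2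
  refine ⟨v, hv, by simp [hvc, ha'], ae_eq_of_vcoef_eq β (hv.memLp_periodicBD b) hF fun q => ?_⟩
  rw [hv.vcoef_periodicBD, hvc]
  by_cases hq : q = 0
  · rw [← ha q]
    simp [hq, symbol_zero hp]
  · simp only [ha', hq, if_false, ha q]

/-- The function `e_q c`, as an element of `L₂(Ω)`. -/
def waveVec (β : Module.Basis (Fin d) ℝ (Space d)) (q : Fin d → ℤ) (c : Vec m) :
    Lp (Vec m) 2 (cellMeasure β) :=
  (memLp_of_coord (v := fun x => wave β q x • c) fun i =>
    ((memLp_wave β q).mul_const (c i) : MemLp (fun x => wave β q x * c i) 2 _)).toLp _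

lemma inner_waveVec (q : Fin d → ℤ) (c : Vec m) (F : Lp (Vec m) 2 (cellMeasure β)) :
    ⟪waveVec β q c, F⟫_ℂ = ⟪c, vcoef β F q⟫_ℂ := by
  have hL := memLp_of_coord (μ := cellMeasure β) (v := fun x => wave β q x • c) fun i =>
    ((memLp_wave β q).mul_const (c i) : MemLp (fun x => wave β q x * c i) 2 _)
  have h1 : ⟪waveVec β q c, F⟫_ℂ = ∫ x, ⟪wave β q x • c, F x⟫_ℂ ∂(cellMeasure β) := by
    rw [integral_inner_toLp hL (Lp.memLp F), Lp.toLp_coeFn]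
    rfl
  rw [h1]
  refine ((hasSum_inner_vcoef β hL (Lp.memLp F)).unique ?_)
  have hc : ∀ r, vcoef β (fun x => wave β q x • c) r = if r = q then c else 0 := fun r => by
    ext i
    have : (fun x => (wave β q x • c) i) = fun x => c i * wave β q x := by
      ext x; simp [mul_comm]
    rw [vcoef_apply, this, fcoef_const_mul, fcoef_wave]
    split_ifs <;> simp
  simp only [hc]
  convert hasSum_ite_eq q (⟪c, vcoef β F q⟫_ℂ) using 2 with r
  split_ifs with h
  · rw [h]
  · simp

/-- The solvability of the cell problem for one right-hand side. -/
lemma exists_cell_column (hd : 1 ≤ d) (hp : p ≠ 0) (hα₀ : 0 < α₀) (hα₁ : 0 ≤ α₁)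
    (hb : SymbolBounds p b α₀ α₁) (hg : IsElliptic g G K) (hK : 0 < K) (e : Vec m) :
    ∃ v : Space d → Vec n, MemPeriodicSobolev β p v ∧
      (∀ w : Space d → Vec n, MemPeriodicSobolev β p w →
        ∫ x in cell β, ⟪periodicBD β p b w x, app (g x) (periodicBD β p b v x + e)⟫_ℂ = 0) ∧
      ∫ x in cell β, v x = 0 := by
  -- The waves with amplitude in the kernel of b(s)^* span, up to closure, the complement of the
  -- fields b(D)v, so S is the closed space of these fields. At s = 0 the symbol is zero, so the
  -- fields in S have mean zero.
  set S : Submodule ℂ (Lp (Vec m) 2 (cellMeasure β)) := (Submodule.span ℂ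
    {F | ∃ q c, app (symbol p b (dualVec β q))ᴴ c = 0 ∧ F = waveVec β q c})ᗮ with hS
  have hmem : ∀ F : Lp (Vec m) 2 (cellMeasure β), F ∈ S ↔
      ∀ q c, app (symbol p b (dualVec β q))ᴴ c = 0 → ⟪c, vcoef β F q⟫_ℂ = 0 := by
    intro F
    constructor
    · intro hF q c hc
      rw [← inner_waveVec]
      refine Submodule.inner_right_of_mem_orthogonal (Submodule.subset_span ?_) hF
      exact ⟨q, c, hc, rfl⟩
    · intro h
      rw [hS, Submodule.mem_orthogonal]
      intro u hu
      induction hu using Submodule.span_induction with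
      | mem x hx =>
        obtain ⟨q, c, hc, rfl⟩ := hx
        rw [inner_waveVec]
        exact h q c hc
      | zero => simp
      | add x y _ _ hx hy => rw [inner_add_left, hx, hy, add_zero]
      | smul t x _ hx => rw [inner_smul_left, hx, mul_zero]
  have : CompleteSpace S := (Submodule.isClosed_orthogonal _).completeSpace_coe
  set M := (hg.isBddMatrix_cell β).mulL with hM
  have hint : ∀ u : Lp (Vec m) 2 (cellMeasure β), ‖u‖ ^ 2 ≤ K * (⟪u, M u⟫_ℂ).re := fun u => by
    have h1 := hg.le_integral_inner_cell (Lp.memLp u)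
    rw [integral_norm_sq_toLp (Lp.memLp u), Lp.toLp_coeFn,
      integral_inner_toLp (Lp.memLp u) ((hg.isBddMatrix_cell β).memLp (Lp.memLp u)),
      Lp.toLp_coeFn] at h1
    exact h1
  -- The compression of multiplication by g to S. The unknown is the field F = b(D)v rather than v,
  -- and the cell equation says that g(F + e) is orthogonal to S.
  let T : S →L[ℂ] S := S.orthogonalProjectionOnto ∘L M ∘L S.subtypeL
  have hT : ∀ x : S, ⟪x, T x⟫_ℂ = ⟪(x : Lp (Vec m) 2 (cellMeasure β)), M x⟫_ℂ := fun x => by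
    have := Submodule.inner_orthogonalProjectionOnto_eq_of_mem_left (K := S) x (M x)
    exact this
  obtain ⟨R, -, hR⟩ := exists_inverse_of_coercive T (inv_pos.mpr hK) fun x => by
    rw [hT, inv_mul_le_iff₀ hK]
    exact (hint x).trans (mul_le_mul_of_nonneg_left (Complex.re_le_norm _) hK.le)
  set E : Lp (Vec m) 2 (cellMeasure β) := (memLp_const e).toLp (fun _ => e) with hE
  set F : S := R (-S.orthogonalProjectionOnto (M E)) with hF
  have hF1 : M ((F : Lp (Vec m) 2 (cellMeasure β)) + E) ∈ Sᗮ := by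
    rw [← Submodule.orthogonalProjectionOnto_eq_zero_iff]
    have : T F = -S.orthogonalProjectionOnto (M E) := hR _
    rw [map_add, map_add]
    change T F + _ = 0
    rw [this]
    simp
  obtain ⟨v, hv, hv0, hvF⟩ := exists_periodicBD_eq (β := β) hd hp hα₀ hα₁ hb
    (Lp.memLp (F : Lp (Vec m) 2 (cellMeasure β))) fun q =>
      exists_app_eq _ fun c hc => (hmem F).mp F.2 q c hc
  refine ⟨v, hv, fun w hw => ?_, ?_⟩
  · rw [setIntegral_cell_eq_zero]
    have hw' := hw.memLp_periodicBD b
    have hmemw : hw'.toLp _ ∈ S := by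
      rw [hmem]
      intro q c hc
      rw [vcoef_congr β hw'.coeFn_toLp, hw.vcoef_periodicBD, inner_app_right, hc, inner_zero_left]
    have h0 := Submodule.inner_right_of_mem_orthogonal hmemw hF1
    rw [← h0, L2.inner_def]
    refine integral_congr_ae ?_
    filter_upwards [hw'.coeFn_toLp, (hg.isBddMatrix_cell β).coeFn_mulL
      ((F : Lp (Vec m) 2 (cellMeasure β)) + E), Lp.coeFn_add (F : Lp (Vec m) 2 (cellMeasure β)) E,
      hvF, (memLp_const (μ := cellMeasure β) (p := 2) e).coeFn_toLp] with x h1 h2 h3 h4 h5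
    rw [h1, hM, h2, h3, Pi.add_apply, h4, hE, h5]
  · rw [setIntegral_cell_eq_zero, ← vcoef_zero β hv.memLp_cell, hv0]

theorem exists_isCellSolution (hd : 1 ≤ d) (hp : p ≠ 0) (hα₀ : 0 < α₀) (hα₁ : 0 ≤ α₁)
    (hb : SymbolBounds p b α₀ α₁) (hg : IsElliptic g G K) (hK : 0 < K)
    (β : Module.Basis (Fin d) ℝ (Space d)) :
    ∃ Λ : Space d → Matrix (Fin n) (Fin m) ℂ, IsCellSolution β p b g Λ := by
  choose v hv using fun j : Fin m => exists_cell_column (β := β) hd hp hα₀ hα₁ hb hg hK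
    (EuclideanSpace.single j 1)
  exact ⟨fun x => Matrix.of fun i j => v j x i, fun j => hv j⟩

end CellProblem

/-! ### Matrix-valued Fourier coefficients and the solution of the cell problem -/

/-- The Fourier coefficients of a matrix-valued function. -/
def mcoef {d k l : ℕ} (β : Module.Basis (Fin d) ℝ (Space d))
    (F : Space d → Matrix (Fin k) (Fin l) ℂ) (q : Fin d → ℤ) : Matrix (Fin k) (Fin l) ℂ :=
  Matrix.of fun i j => fcoef β (fun x => F x i j) q

lemma memLp_app_of_entries {X : Type*} [MeasurableSpace X] {μ : Measure X} {k l : ℕ}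
    {F : X → Matrix (Fin k) (Fin l) ℂ} {r : ℝ≥0∞} (hF : ∀ i j, MemLp (fun x => F x i j) r μ)
    (c : Vec l) : MemLp (fun x => app (F x) c) r μ :=
  memLp_of_coord fun i => by
    simp only [app_apply]
    exact memLp_finsetSum _ fun j _ => (hF i j).mul_const (c j)

lemma app_mcoef {d k l : ℕ} (β : Module.Basis (Fin d) ℝ (Space d))
    {F : Space d → Matrix (Fin k) (Fin l) ℂ}
    (hF : ∀ i j, MemLp (fun x => F x i j) 2 (cellMeasure β)) (q : Fin d → ℤ) (c : Vec l) :
    app (mcoef β F q) c = vcoef β (fun x => app (F x) c) q := by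
  ext i
  rw [vcoef_apply]
  simp only [app_apply, mcoef, Matrix.of_apply]
  rw [fcoef_sum β _ fun j _ => (hF i j).mul_const (c j)]
  refine Finset.sum_congr rfl fun j _ => ?_
  rw [mul_comm, ← fcoef_const_mul]
  simp only [mul_comm]

lemma frobSq_eq_sum {k l : ℕ} (M : Matrix (Fin k) (Fin l) ℂ) :
    frobSq M = ∑ j, ‖app M (EuclideanSpace.single j 1)‖ ^ 2 := by
  rw [frobSq, Finset.sum_comm]
  refine Finset.sum_congr rfl fun j _ => ?_
  rw [EuclideanSpace.norm_sq_eq]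
  refine Finset.sum_congr rfl fun i _ => ?_
  simp [app_apply]

lemma norm_sq_le_frobSq {k l : ℕ} (M : Matrix (Fin k) (Fin l) ℂ) : ‖M‖ ^ 2 ≤ frobSq M := by
  have := norm_le_of_norm_app_le (Real.sqrt_nonneg (frobSq M)) (norm_app_le_sqrt M)
  calc ‖M‖ ^ 2 ≤ √(frobSq M) ^ 2 := by gcongr
    _ = frobSq M := Real.sq_sqrt (frobSq_nonneg M)

lemma matrix_eq_zero_of_app {k l : ℕ} {M : Matrix (Fin k) (Fin l) ℂ}
    (h : ∀ c, app M c = 0) : M = 0 := by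
  ext i j
  have := congrArg (fun v : Vec k => v i) (h (EuclideanSpace.single j 1))
  simpa [app_apply] using this

/-- The square-summability of the norms of the coefficients of a matrix-valued function. -/
lemma summable_norm_mcoef_sq {d k l : ℕ} (β : Module.Basis (Fin d) ℝ (Space d))
    {F : Space d → Matrix (Fin k) (Fin l) ℂ}
    (hF : ∀ i j, MemLp (fun x => F x i j) 2 (cellMeasure β)) {C : ℝ}
    (hC : ∀ c, ∫ x, ‖app (F x) c‖ ^ 2 ∂(cellMeasure β) ≤ C * ‖c‖ ^ 2) :
    Summable (fun q => ‖mcoef β F q‖ ^ 2) ∧ ∑' q, ‖mcoef β F q‖ ^ 2 ≤ l * C := by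
  -- The Frobenius norm dominates the operator norm and splits over the columns, to each of which
  -- Parseval applies; the l columns give the factor l.
  have h1 : HasSum (fun q => frobSq (mcoef β F q)) (∑ j,
      ∫ x, ‖app (F x) (EuclideanSpace.single j 1)‖ ^ 2 ∂(cellMeasure β)) := by
    simp only [frobSq_eq_sum, app_mcoef β hF]
    exact hasSum_sum fun j _ => hasSum_norm_vcoef_sq β (memLp_app_of_entries hF _)
  have h2 : Summable (fun q => ‖mcoef β F q‖ ^ 2) :=
    h1.summable.of_nonneg_of_le (fun q => by positivity) fun q => norm_sq_le_frobSq _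
  refine ⟨h2, (h2.tsum_le_tsum (fun q => norm_sq_le_frobSq _) h1.summable).trans ?_⟩
  rw [h1.tsum_eq]
  calc _ ≤ ∑ _j : Fin l, C := Finset.sum_le_sum fun j _ => by
        simpa using hC (EuclideanSpace.single j 1)
    _ = l * C := by simp

/-- The matrix-valued function `b(D)Λ`. -/
def cellBD {d m n : ℕ} (β : Module.Basis (Fin d) ℝ (Space d)) (p : ℕ)
    (b : (Fin d → ℕ) → Matrix (Fin m) (Fin n) ℂ) (Λ : Space d → Matrix (Fin n) (Fin m) ℂ)
    (x : Space d) : Matrix (Fin m) (Fin m) ℂ :=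
  Matrix.of fun i j => periodicBD β p b (column Λ j) x i

/-! ### Energy identities and coefficient bounds for the cell solution. -/

section CellSolution

variable {d m n p : ℕ} {b : (Fin d → ℕ) → Matrix (Fin m) (Fin n) ℂ} {α₀ α₁ : ℝ}
  {g : Space d → Matrix (Fin m) (Fin m) ℂ} {G K : ℝ} {β : Module.Basis (Fin d) ℝ (Space d)}
  {Λ : Space d → Matrix (Fin n) (Fin m) ℂ}

lemma app_gTilde (x : Space d) (c : Vec m) :
    app (gTilde β p b g Λ x) c = app (g x) (app (cellBD β p b Λ x) c + c) := by
  rw [gTilde, mul_app, add_app, one_app]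
  rfl

namespace IsCellSolution

lemma memLp_entry (hΛ : IsCellSolution β p b g Λ) (i : Fin n) (j : Fin m) :
    MemLp (fun x => Λ x i j) 2 (cellMeasure β) := memLp_coord (hΛ j).1.memLp_cell i

lemma isPeriodic (hΛ : IsCellSolution β p b g Λ) : IsPeriodic β Λ := fun γ hγ x => by
  ext i j
  exact congrArg (fun v : Vec n => v i) ((hΛ j).1.1 γ hγ x)

lemma memLp_cellBD (hΛ : IsCellSolution β p b g Λ) (i j : Fin m) :
    MemLp (fun x => cellBD β p b Λ x i j) 2 (cellMeasure β) :=
  memLp_coord ((hΛ j).1.memLp_periodicBD b) i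

lemma isPeriodic_cellBD (hΛ : IsCellSolution β p b g Λ) : IsPeriodic β (cellBD β p b Λ) :=
  fun γ hγ x => by
    ext i j
    exact congrArg (fun v : Vec m => v i) ((hΛ j).1.isPeriodic_periodicBD b γ hγ x)

lemma mcoef_zero (hΛ : IsCellSolution β p b g Λ) : mcoef β Λ 0 = 0 := by
  ext i j
  have h := (setIntegral_cell_eq_zero β).mp (hΛ j).2.2
  rw [← vcoef_zero β (hΛ j).1.memLp_cell] at h
  exact congrArg (fun v : Vec n => v i) h

lemma mcoef_cellBD (hΛ : IsCellSolution β p b g Λ) (q : Fin d → ℤ) :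
    mcoef β (cellBD β p b Λ) q = symbol p b (dualVec β q) * mcoef β Λ q := by
  ext i j
  exact congrArg (fun v : Vec m => v i) ((hΛ j).1.vcoef_periodicBD b q)

lemma memLp_sum (hΛ : IsCellSolution β p b g Λ) (c : Vec m) :
    MemLp (fun x => app (cellBD β p b Λ x) c + c) 2 (cellMeasure β) :=
  (memLp_app_of_entries hΛ.memLp_cellBD c).add (memLp_const c)

lemma memLp_gTilde (hΛ : IsCellSolution β p b g Λ) (hg : IsElliptic g G K) (i j : Fin m) :
    MemLp (fun x => gTilde β p b g Λ x i j) 2 (cellMeasure β) := by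
  have h := memLp_coord
    ((hg.isBddMatrix_cell β).memLp (hΛ.memLp_sum (EuclideanSpace.single j 1))) i
  simp only [← app_gTilde] at h
  simpa [app_apply] using h

lemma isPeriodic_gTilde (hΛ : IsCellSolution β p b g Λ) (hper : IsPeriodic β g) :
    IsPeriodic β (gTilde β p b g Λ) := fun γ hγ x => by
  change g _ * (cellBD β p b Λ _ + 1) = g _ * (cellBD β p b Λ _ + 1)
  rw [hper γ hγ x, hΛ.isPeriodic_cellBD γ hγ x]

/-- The weak cell equation, read one Fourier coefficient at a time. This is the cancellation that
makes the oscillating flux close to the effective one. -/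
lemma adjoint_mcoef_gTilde (hΛ : IsCellSolution β p b g Λ) (hg : IsElliptic g G K)
    (q : Fin d → ℤ) : (symbol p b (dualVec β q))ᴴ * mcoef β (gTilde β p b g Λ) q = 0 := by
  ext i j
  have hL := (hg.isBddMatrix_cell β).memLp (hΛ.memLp_sum (EuclideanSpace.single j 1))
  have hcol : ∀ x, app (cellBD β p b Λ x) (EuclideanSpace.single j 1)
      = periodicBD β p b (column Λ j) x := fun x => by
    ext i
    simp [app_apply, cellBD]
  have h := (orthogonal_periodicBD_iff (b := b) (p := p) hL).mp (by
    simp only [hcol]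
    exact (hΛ j).2.1) q
  simp only [← app_gTilde] at h
  rw [← app_mcoef β (hΛ.memLp_gTilde hg), ← mul_app] at h
  have := congrArg (fun v : Vec n => v i) h
  simpa [app_apply] using this

lemma mcoef_gTilde_zero : mcoef β (gTilde β p b g Λ) 0 = gEff β p b g Λ := by
  ext i j
  simp only [mcoef, gEff, Matrix.of_apply, fcoef_zero, integral_cellMeasure, Complex.real_smul]
  push_cast
  rfl

lemma vcoef_cellBD_zero (hΛ : IsCellSolution β p b g Λ) (c : Vec m) :
    vcoef β (fun x => app (cellBD β p b Λ x) c) 0 = 0 := by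
  rw [← app_mcoef β hΛ.memLp_cellBD, hΛ.mcoef_cellBD, hΛ.mcoef_zero, Matrix.mul_zero, zero_app]

lemma vcoef_sum_zero (hΛ : IsCellSolution β p b g Λ) (c : Vec m) :
    vcoef β (fun x => app (cellBD β p b Λ x) c + c) 0 = c := by
  rw [vcoef_add β (memLp_app_of_entries hΛ.memLp_cellBD c) (memLp_const c),
    hΛ.vcoef_cellBD_zero, vcoef_const, if_pos rfl, zero_add]

/-- The bilinear form of the effective matrix. -/
lemma integral_inner_gTilde (hΛ : IsCellSolution β p b g Λ) (hg : IsElliptic g G K)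
    (c c' : Vec m) :
    ∫ x, ⟪app (cellBD β p b Λ x) c' + c', app (g x) (app (cellBD β p b Λ x) c + c)⟫_ℂ
      ∂(cellMeasure β) = ⟪c', app (gEff β p b g Λ) c⟫_ℂ := by
  have hL := memLp_app_of_entries (hΛ.memLp_gTilde hg) c
  simp only [← app_gTilde]
  refine (hasSum_inner_vcoef β (hΛ.memLp_sum c') hL).unique ?_
  -- In Parseval's sum the part b(D)Λc' pairs to zero with g̃c at every q by the cell equation. The
  -- constant c' contributes only at q = 0, where the coefficient of g̃ is g⁰.
  have h : ∀ q, ⟪vcoef β (fun x => app (cellBD β p b Λ x) c' + c') q,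
      vcoef β (fun x => app (gTilde β p b g Λ x) c) q⟫_ℂ
      = if q = 0 then ⟪c', app (gEff β p b g Λ) c⟫_ℂ else 0 := fun q => by
    rw [vcoef_add β (memLp_app_of_entries hΛ.memLp_cellBD c') (memLp_const c'), inner_add_left,
      ← app_mcoef β hΛ.memLp_cellBD, ← app_mcoef β (hΛ.memLp_gTilde hg), hΛ.mcoef_cellBD,
      mul_app, inner_app_left, ← mul_app, hΛ.adjoint_mcoef_gTilde hg, zero_app, inner_zero_right,
      zero_add, vcoef_const]
    split_ifs with hq
    · rw [hq, mcoef_gTilde_zero]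
    · rw [inner_zero_left]
  simp only [h]
  exact hasSum_ite_eq 0 _

lemma integral_norm_sq_sum_le (hΛ : IsCellSolution β p b g Λ) (hg : IsElliptic g G K)
    (c : Vec m) : ∫ x, ‖app (cellBD β p b Λ x) c + c‖ ^ 2 ∂(cellMeasure β)
      ≤ K * (⟪c, app (gEff β p b g Λ) c⟫_ℂ).re := by
  rw [← hΛ.integral_inner_gTilde hg]
  exact hg.le_integral_inner_cell (hΛ.memLp_sum c)

/-- The mean of b(D)Λc + c is c, and its square is one term of Parseval's sum. The effective matrix
therefore keeps the lower constant of g. -/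
lemma norm_sq_le (hΛ : IsCellSolution β p b g Λ) (hg : IsElliptic g G K) (c : Vec m) :
    ‖c‖ ^ 2 ≤ K * (⟪c, app (gEff β p b g Λ) c⟫_ℂ).re := by
  refine le_trans ?_ (hΛ.integral_norm_sq_sum_le hg c)
  have h := le_hasSum (hasSum_norm_vcoef_sq β (hΛ.memLp_sum c)) 0 fun q _ => by positivity
  rwa [hΛ.vcoef_sum_zero] at h

lemma integral_norm_sq_gTilde_le (hΛ : IsCellSolution β p b g Λ) (hg : IsElliptic g G K)
    (c : Vec m) : ∫ x, ‖app (gTilde β p b g Λ x) c‖ ^ 2 ∂(cellMeasure β)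
      ≤ G ^ 2 * ∫ x, ‖app (cellBD β p b Λ x) c + c‖ ^ 2 ∂(cellMeasure β) := by
  have h1 := hΛ.memLp_sum c
  have h2 := memLp_app_of_entries (hΛ.memLp_gTilde hg) c
  rw [← integral_const_mul]
  refine integral_mono_ae ((memLp_two_iff_integrable_sq_norm h2.1).mp h2)
    (((memLp_two_iff_integrable_sq_norm h1.1).mp h1).const_mul _) ?_
  filter_upwards [(hg.isBddMatrix_cell β).bound] with x hx
  rw [app_gTilde, ← mul_pow]
  have := hx (app (cellBD β p b Λ x) c + c)
  gcongr

/-- The square of |g⁰c| is one term of Parseval's sum for g̃c, hence at most G²K Re⟨c, g⁰c⟩ ≤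
G²K|c||g⁰c|; divide by |g⁰c|. -/
lemma norm_gEff_app_le (hΛ : IsCellSolution β p b g Λ) (hg : IsElliptic g G K) (hK : 0 ≤ K)
    (c : Vec m) : ‖app (gEff β p b g Λ) c‖ ≤ G ^ 2 * K * ‖c‖ := by
  have h1 := le_hasSum (hasSum_norm_vcoef_sq β (memLp_app_of_entries (hΛ.memLp_gTilde hg) c)) 0
    fun q _ => by positivity
  rw [← app_mcoef β (hΛ.memLp_gTilde hg), mcoef_gTilde_zero] at h1
  have h2 := hΛ.integral_norm_sq_gTilde_le hg c
  have h3 := hΛ.integral_norm_sq_sum_le hg c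
  have h4 : (⟪c, app (gEff β p b g Λ) c⟫_ℂ).re ≤ ‖c‖ * ‖app (gEff β p b g Λ) c‖ :=
    (Complex.re_le_norm _).trans (norm_inner_le_norm _ _)
  have h5 : ‖app (gEff β p b g Λ) c‖ ^ 2
      ≤ G ^ 2 * K * ‖c‖ * ‖app (gEff β p b g Λ) c‖ := by
    calc _ ≤ G ^ 2 * (K * (‖c‖ * ‖app (gEff β p b g Λ) c‖)) := by
          refine h1.trans (h2.trans ?_)
          gcongr
          exact h3.trans (by gcongr)
      _ = _ := by ring
  rcases (norm_nonneg (app (gEff β p b g Λ) c)).eq_or_lt with h | h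
  · rw [← h]; positivity
  · rw [sq] at h5
    exact le_of_mul_le_mul_right h5 h

lemma integral_norm_sq_sum_le' (hΛ : IsCellSolution β p b g Λ) (hg : IsElliptic g G K)
    (hK : 0 ≤ K) (c : Vec m) : ∫ x, ‖app (cellBD β p b Λ x) c + c‖ ^ 2 ∂(cellMeasure β)
      ≤ (G * K) ^ 2 * ‖c‖ ^ 2 := by
  have h4 : (⟪c, app (gEff β p b g Λ) c⟫_ℂ).re ≤ ‖c‖ * ‖app (gEff β p b g Λ) c‖ :=
    (Complex.re_le_norm _).trans (norm_inner_le_norm _ _)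
  calc _ ≤ K * (‖c‖ * (G ^ 2 * K * ‖c‖)) := by
        refine (hΛ.integral_norm_sq_sum_le hg c).trans ?_
        gcongr
        refine h4.trans ?_
        gcongr
        exact hΛ.norm_gEff_app_le hg hK c
    _ = _ := by ring

/-- The effective matrix is elliptic. -/
lemma isElliptic_gEff (hΛ : IsCellSolution β p b g Λ) (hg : IsElliptic g G K) (hK : 0 ≤ K) :
    IsElliptic (fun _ : Space d => gEff β p b g Λ) (G ^ 2 * K) K where
  measurable _ _ := aemeasurable_const
  herm := ae_of_all _ fun _ => by
    have h : ∀ c c' : Vec m, ⟪c', app (gEff β p b g Λ) c⟫_ℂ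
        = ⟪c', app (gEff β p b g Λ)ᴴ c⟫_ℂ := fun c c' => by
      rw [inner_app_right (gEff β p b g Λ)ᴴ, Matrix.conjTranspose_conjTranspose,
        ← inner_conj_symm (app (gEff β p b g Λ) c') c,
        ← hΛ.integral_inner_gTilde hg, ← hΛ.integral_inner_gTilde hg, ← integral_conj]
      refine integral_congr_ae ?_
      filter_upwards [ae_cell_of_ae β hg.herm] with x hx
      rw [inner_conj_symm, inner_app_right, hx.eq]
    rw [Matrix.IsHermitian, ← sub_eq_zero]
    refine matrix_eq_zero_of_app fun c => ?_
    rw [sub_app, sub_eq_zero]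
    exact ext_inner_left ℂ fun c' => (h c c').symm
  bound := ae_of_all _ fun _ => norm_le_of_norm_app_le (by positivity) (hΛ.norm_gEff_app_le hg hK)
  lower := ae_of_all _ fun _ => hΛ.norm_sq_le hg

lemma summable_gTilde (hΛ : IsCellSolution β p b g Λ) (hg : IsElliptic g G K) (hK : 0 ≤ K) :
    Summable (fun q => ‖mcoef β (gTilde β p b g Λ) q‖ ^ 2) ∧
      ∑' q, ‖mcoef β (gTilde β p b g Λ) q‖ ^ 2 ≤ m * (G ^ 2 * K) ^ 2 :=
  summable_norm_mcoef_sq β (hΛ.memLp_gTilde hg) fun c =>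
    (hΛ.integral_norm_sq_gTilde_le hg c).trans <| by
      calc _ ≤ G ^ 2 * ((G * K) ^ 2 * ‖c‖ ^ 2) := by
            gcongr; exact hΛ.integral_norm_sq_sum_le' hg hK c
        _ = _ := by ring

/-- Adding the constant c changes only the coefficient at 0, and there b(D)Λ contributes nothing. -/
lemma norm_vcoef_cellBD_le (hΛ : IsCellSolution β p b g Λ) (c : Vec m) (q : Fin d → ℤ) :
    ‖vcoef β (fun x => app (cellBD β p b Λ x) c) q‖ ^ 2
      ≤ ‖vcoef β (fun x => app (cellBD β p b Λ x) c + c) q‖ ^ 2 := by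
  by_cases hq : q = 0
  · rw [hq, hΛ.vcoef_cellBD_zero, norm_zero, sq, zero_mul]
    positivity
  · rw [vcoef_add β (memLp_app_of_entries hΛ.memLp_cellBD c) (memLp_const c), vcoef_const,
      if_neg hq, add_zero]

lemma summable_cellBD (hΛ : IsCellSolution β p b g Λ) (hg : IsElliptic g G K) (hK : 0 ≤ K) :
    Summable (fun q => ‖mcoef β (cellBD β p b Λ) q‖ ^ 2) ∧
      ∑' q, ‖mcoef β (cellBD β p b Λ) q‖ ^ 2 ≤ m * (G * K) ^ 2 :=
  summable_norm_mcoef_sq β hΛ.memLp_cellBD fun c =>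
    le_trans (hasSum_le (fun q => hΛ.norm_vcoef_cellBD_le c q)
      (hasSum_norm_vcoef_sq β (memLp_app_of_entries hΛ.memLp_cellBD c))
      (hasSum_norm_vcoef_sq β (hΛ.memLp_sum c))) (hΛ.integral_norm_sq_sum_le' hg hK c)

/-- The coefficient of b(D)Λ is b(s) times that of Λ, and b(s) is bounded below by √α₀|s|^p. -/
lemma norm_mcoef_le (hd : 1 ≤ d) (hα₀ : 0 < α₀) (hα₁ : 0 ≤ α₁) (hb : SymbolBounds p b α₀ α₁)
    (hΛ : IsCellSolution β p b g Λ) (q : Fin d → ℤ) :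
    ‖dualVec β q‖ ^ p * ‖mcoef β Λ q‖ ≤ (√α₀)⁻¹ * ‖mcoef β (cellBD β p b Λ) q‖ := by
  by_cases hp : ‖dualVec β q‖ ^ p = 0
  · rw [hp, zero_mul]; positivity
  have hpos : 0 < ‖dualVec β q‖ ^ p := lt_of_le_of_ne (by positivity) (Ne.symm hp)
  have hs : 0 < √α₀ := Real.sqrt_pos.mpr hα₀
  rw [← le_div_iff₀' hpos]
  refine norm_le_of_norm_app_le (by positivity) fun c => ?_
  have h1 := (hb.norm_bounds hd hα₀.le hα₁ (dualVec β q) (app (mcoef β Λ q) c)).1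
  rw [← mul_app, ← hΛ.mcoef_cellBD] at h1
  have h2 := h1.trans (norm_app_le _ c)
  rw [← mul_assoc, mul_comm (√α₀)] at h2
  rw [div_mul_eq_mul_div, le_div_iff₀ hpos, mul_assoc, ← div_eq_inv_mul, le_div_iff₀ hs]
  linarith

end IsCellSolution

end CellSolution

/-! ### Multiplication of band-limited functions by oscillating periodic functions -/

section Shift

variable {d k l : ℕ}

lemma eLpNorm_sq {X : Type*} [MeasurableSpace X] {μ : Measure X} {E : Type*}
    [NormedAddCommGroup E] (f : X → E) : eLpNorm f 2 μ ^ 2 = ∫⁻ x, ‖f x‖ₑ ^ 2 ∂μ := by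
  rw [eLpNorm_eq_lintegral_rpow_enorm_toReal two_ne_zero ENNReal.ofNat_ne_top,
    ← ENNReal.rpow_natCast, ← ENNReal.rpow_mul]
  simp

/-- The `L₂`-bound for a function that is dominated, at each point, by one of the translates of a
fixed function, with square-summable weights. -/
lemma eLpNorm_le_of_shift {E E' : Type*} [NormedAddCommGroup E] [NormedAddCommGroup E']
    {ι : Type*} [Countable ι] (τ : ι → Space d) {V : Space d → E} {H : Space d → E'}
    (hH : AEStronglyMeasurable H volume) {A : ι → ℝ} (hA : Summable fun q => A q ^ 2) {C : ℝ}
    (hC0 : 0 ≤ C) (hC : ∑' q, A q ^ 2 ≤ C ^ 2)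
    (hV : ∀ᵐ η, V η = 0 ∨ ∃ q, ‖V η‖ ≤ A q * ‖H (η - τ q)‖) :
    eLpNorm V 2 volume ≤ ENNReal.ofReal C * eLpNorm H 2 volume := by
  have h1 : ∫⁻ η, ‖V η‖ₑ ^ 2 ≤ ∫⁻ η, ∑' q, ENNReal.ofReal (A q ^ 2) * ‖H (η - τ q)‖ₑ ^ 2 := by
    refine lintegral_mono_ae ?_
    filter_upwards [hV] with η hη
    rcases hη with h | ⟨q, hq⟩
    · simp [h]
    -- The index q depends on η, so the single term is replaced by the sum over all indices, which
    -- is then integrated by translation invariance.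
    · refine le_trans ?_ (ENNReal.le_tsum q)
      rw [← ofReal_norm, ← ofReal_norm, ← ENNReal.ofReal_pow (norm_nonneg _),
        ← ENNReal.ofReal_pow (norm_nonneg _), ← ENNReal.ofReal_mul (by positivity), ← mul_pow]
      exact ENNReal.ofReal_le_ofReal (pow_le_pow_left₀ (norm_nonneg _) hq 2)
  have h2 : ∫⁻ η, ∑' q, ENNReal.ofReal (A q ^ 2) * ‖H (η - τ q)‖ₑ ^ 2
      = (∑' q, ENNReal.ofReal (A q ^ 2)) * ∫⁻ η, ‖H η‖ₑ ^ 2 := by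
    rw [lintegral_tsum fun q => ?_, ← ENNReal.tsum_mul_right]
    · refine tsum_congr fun q => ?_
      rw [lintegral_const_mul' _ _ ENNReal.ofReal_ne_top]
      congr 1
      exact lintegral_sub_right_eq_self (fun η => ‖H η‖ₑ ^ 2) (τ q)
    · have := (hH.comp_quasiMeasurePreserving
        (measurePreserving_sub_right volume (τ q)).quasiMeasurePreserving).enorm
      exact (this.pow_const 2).const_mul _
  rw [← ENNReal.ofReal_tsum_of_nonneg (fun q => by positivity) hA, ← eLpNorm_sq] at h2
  rw [← eLpNorm_sq, h2] at h1
  have h3 : eLpNorm V 2 volume ^ 2 ≤ (ENNReal.ofReal C * eLpNorm H 2 volume) ^ 2 := by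
    rw [mul_pow, ← ENNReal.ofReal_pow hC0]
    exact h1.trans (mul_le_mul_left (ENNReal.ofReal_le_ofReal hC) _)
  exact (ENNReal.pow_right_strictMono two_ne_zero).le_iff_le.mp h3

/-- The shifts `s / (2πε)` of the frequency variable, `s` in the dual lattice. -/
def shift (β : Module.Basis (Fin d) ℝ (Space d)) (ε : ℝ) (q : Fin d → ℤ) : Space d :=
  (2 * Real.pi * ε)⁻¹ • dualVec β q

/-- The translates of `B` by the shifts are disjoint. -/
def DisjointShifts (β : Module.Basis (Fin d) ℝ (Space d)) (ε : ℝ) (B : Set (Space d)) : Prop :=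
  ∀ η q r, η - shift β ε q ∈ B → η - shift β ε r ∈ B → q = r

/-- The Fourier transform of `F^ε u`, for `u` with Fourier transform `h`. -/
def modulated (β : Module.Basis (Fin d) ℝ (Space d)) (ε : ℝ)
    (a : (Fin d → ℤ) → Matrix (Fin k) (Fin l) ℂ) (h : Space d → Vec l) (η : Space d) : Vec k :=
  ∑' q, app (a q) (h (η - shift β ε q))

variable {β : Module.Basis (Fin d) ℝ (Space d)} {ε : ℝ} {B : Set (Space d)}
  {a : (Fin d → ℤ) → Matrix (Fin k) (Fin l) ℂ} {h : Space d → Vec l}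

lemma hasSum_modulated_of_mem (hB : DisjointShifts β ε B) (hh : ∀ η ∉ B, h η = 0)
    {η : Space d} {q : Fin d → ℤ} (hq : η - shift β ε q ∈ B) :
    HasSum (fun r => app (a r) (h (η - shift β ε r))) (app (a q) (h (η - shift β ε q))) :=
  hasSum_single q fun r hr => by
    rw [hh _ fun hm => hr (hB η r q hm hq), app_zero]

lemma modulated_of_mem (hB : DisjointShifts β ε B) (hh : ∀ η ∉ B, h η = 0)
    {η : Space d} {q : Fin d → ℤ} (hq : η - shift β ε q ∈ B) :
    modulated β ε a h η = app (a q) (h (η - shift β ε q)) :=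
  (hasSum_modulated_of_mem hB hh hq).tsum_eq

lemma modulated_of_notMem (hh : ∀ η ∉ B, h η = 0)
    {η : Space d} (hq : ∀ q, η - shift β ε q ∉ B) : modulated β ε a h η = 0 := by
  rw [modulated]
  convert tsum_zero with q
  rw [hh _ (hq q), app_zero]

lemma hasSum_modulated (hB : DisjointShifts β ε B) (hh : ∀ η ∉ B, h η = 0) (η : Space d) :
    HasSum (fun r => app (a r) (h (η - shift β ε r))) (modulated β ε a h η) := by
  by_cases hq : ∃ q, η - shift β ε q ∈ B
  · obtain ⟨q, hq⟩ := hq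
    rw [modulated_of_mem hB hh hq]
    exact hasSum_modulated_of_mem hB hh hq
  · push Not at hq
    rw [modulated_of_notMem hh hq]
    convert hasSum_zero with q
    rw [hh _ (hq q), app_zero]

lemma aestronglyMeasurable_term (hm : AEStronglyMeasurable h volume) (q : Fin d → ℤ) :
    AEStronglyMeasurable (fun η => app (a q) (h (η - shift β ε q))) volume :=
  (appL (a q)).continuous.comp_aestronglyMeasurable (hm.comp_quasiMeasurePreserving
    (measurePreserving_sub_right volume (shift β ε q)).quasiMeasurePreserving)

lemma aestronglyMeasurable_modulated (hB : DisjointShifts β ε B) (hh : ∀ η ∉ B, h η = 0)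
    (hm : AEStronglyMeasurable h volume) :
    AEStronglyMeasurable (modulated β ε a h) volume := by
  refine aestronglyMeasurable_of_tendsto_ae (u := (Filter.atTop : Filter (Finset (Fin d → ℤ))))
    (f := fun N η => ∑ q ∈ N, app (a q) (h (η - shift β ε q))) (fun N => ?_)
    (ae_of_all _ fun η => hasSum_modulated hB hh η)
  exact Finset.aestronglyMeasurable_fun_sum N fun q _ => aestronglyMeasurable_term hm q

lemma memLp_modulated (hB : DisjointShifts β ε B) (hh : ∀ η ∉ B, h η = 0)
    (hL : MemLp h 2 volume) (ha : Summable fun q => ‖a q‖ ^ 2) :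
    MemLp (modulated β ε a h) 2 volume := by
  refine ⟨aestronglyMeasurable_modulated hB hh hL.1, lt_of_le_of_lt
    (eLpNorm_le_of_shift (shift β ε) hL.1 ha (Real.sqrt_nonneg (∑' q, ‖a q‖ ^ 2))
      (Real.sq_sqrt (tsum_nonneg fun q => by positivity)).ge (ae_of_all _ fun η => ?_))
    (ENNReal.mul_lt_top ENNReal.ofReal_lt_top hL.2)⟩
  by_cases hq : ∃ q, η - shift β ε q ∈ B
  · obtain ⟨q, hq⟩ := hq
    refine Or.inr ⟨q, ?_⟩
    rw [modulated_of_mem hB hh hq]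
    exact norm_app_le _ _
  · push Not at hq
    exact Or.inl (modulated_of_notMem hh hq)

/-- What is left after a partial sum is again dominated by one translate at each point, now with the
coefficients outside N; the ℓ² tail bounds it. -/
lemma tendsto_modulated (hB : DisjointShifts β ε B) (hh : ∀ η ∉ B, h η = 0)
    (hL : MemLp h 2 volume) (ha : Summable fun q => ‖a q‖ ^ 2) :
    Filter.Tendsto (fun N : Finset (Fin d → ℤ) => eLpNorm (fun η =>
      ∑ q ∈ N, app (a q) (h (η - shift β ε q)) - modulated β ε a h η) 2 volume)
      Filter.atTop (nhds 0) := by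
  classical
  have hlim : Filter.Tendsto (fun N : Finset (Fin d → ℤ) =>
      ENNReal.ofReal √(∑' q, ‖a q‖ ^ 2 - ∑ q ∈ N, ‖a q‖ ^ 2) * eLpNorm h 2 volume)
      Filter.atTop (nhds 0) := by
    have h1 : Filter.Tendsto (fun N : Finset (Fin d → ℤ) =>
        ∑' q, ‖a q‖ ^ 2 - ∑ q ∈ N, ‖a q‖ ^ 2) Filter.atTop (nhds 0) := by
      have h0 : Filter.Tendsto (fun N : Finset (Fin d → ℤ) => ∑ q ∈ N, ‖a q‖ ^ 2) Filter.atTop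
        (nhds (∑' q, ‖a q‖ ^ 2)) := ha.hasSum
      have h1 := h0.const_sub (∑' q, ‖a q‖ ^ 2)
      rwa [sub_self (G := ℝ)] at h1
    have h2 := ENNReal.tendsto_ofReal ((Real.continuous_sqrt.tendsto 0).comp h1)
    rw [Real.sqrt_zero, ENNReal.ofReal_zero] at h2
    simpa using ENNReal.Tendsto.mul_const h2 (Or.inr hL.2.ne)
  refine tendsto_of_tendsto_of_tendsto_of_le_of_le tendsto_const_nhds hlim
    (fun _ => bot_le) fun N => ?_
  have hs : HasSum (fun q => (if q ∈ N then 0 else ‖a q‖) ^ 2)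
      (∑' q, ‖a q‖ ^ 2 - ∑ q ∈ N, ‖a q‖ ^ 2) := by
    have h1 : HasSum (fun q => if q ∈ N then ‖a q‖ ^ 2 else 0)
        (∑ q ∈ N, if q ∈ N then ‖a q‖ ^ 2 else 0) :=
      hasSum_sum_of_ne_finset_zero fun q hq => by simp [hq]
    rw [Finset.sum_congr rfl fun q hq => if_pos hq] at h1
    have h2 : (fun q => (if q ∈ N then 0 else ‖a q‖) ^ 2)
        = fun q => ‖a q‖ ^ 2 - if q ∈ N then ‖a q‖ ^ 2 else 0 := by
      ext q; split_ifs <;> simp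
    rw [h2]
    exact ha.hasSum.sub h1
  have hnn : 0 ≤ ∑' q, ‖a q‖ ^ 2 - ∑ q ∈ N, ‖a q‖ ^ 2 :=
    hs.nonneg fun q => by positivity
  refine eLpNorm_le_of_shift (shift β ε) hL.1 hs.summable (Real.sqrt_nonneg _)
    (by rw [Real.sq_sqrt hnn, hs.tsum_eq]) (ae_of_all _ fun η => ?_)
  by_cases hq : ∃ q, η - shift β ε q ∈ B
  · obtain ⟨q, hq⟩ := hq
    rw [modulated_of_mem hB hh hq]
    have hz : ∀ r ≠ q, app (a r) (h (η - shift β ε r)) = 0 := fun r hr => by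
      rw [hh _ fun hm => hr (hB η r q hm hq), app_zero]
    by_cases hN : q ∈ N
    · left
      rw [Finset.sum_eq_single_of_mem q hN fun r _ hr => hz r hr, sub_self]
    · right
      refine ⟨q, ?_⟩
      rw [Finset.sum_eq_zero fun r hr => hz r fun hrq => hN (hrq ▸ hr), zero_sub, norm_neg,
        if_neg hN]
      exact norm_app_le _ _
  · push Not at hq
    left
    rw [modulated_of_notMem hh hq, sub_zero]
    exact Finset.sum_eq_zero fun q _ => by rw [hh _ (hq q), app_zero]

end Shift

/-! ### The Fourier transform of F^ε u for band-limited u. -/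

section Oscillating

variable {d k l : ℕ} {β : Module.Basis (Fin d) ℝ (Space d)} {ε : ℝ}

/-- The shift s/(2πε) is the frequency, in the normalization exp(2πi⟨τ, x⟩), of the rescaled wave.
-/
lemma app_phase_shift (hε : ε ≠ 0) (q : Fin d → ℤ) (x : Space d) (v : Vec l) :
    app (phase l (shift β ε q) x) v = wave β q (ε⁻¹ • x) • v := by
  rw [app_phase, wave, shift]
  congr 2
  rw [inner_smul_left, inner_smul_right, mul_comm Complex.I]
  congr 2
  have := Real.pi_pos.ne'
  simp only [mul_inv, conj_trivial]
  field_simp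

/-- The trigonometric polynomials of `F`, applied to `u`. -/
def partialSumL (β : Module.Basis (Fin d) ℝ (Space d)) (ε : ℝ)
    (a : (Fin d → ℤ) → Matrix (Fin k) (Fin l) ℂ) (u : L2 d l) (N : Finset (Fin d → ℤ)) : L2 d k :=
  ∑ q ∈ N, (appL (a q)).compLpL 2 volume ((isBddMatrix_phase l (shift β ε q)).mulL u)

lemma coeFn_sum_Lp {X : Type*} [MeasurableSpace X] {μ : Measure X} {ι : Type*} (N : Finset ι)
    (f : ι → Lp (Vec k) 2 μ) : (∑ q ∈ N, f q : Lp (Vec k) 2 μ) =ᵐ[μ] fun x => ∑ q ∈ N, f q x := by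
  classical
  induction N using Finset.induction_on with
  | empty =>
    simp only [Finset.sum_empty]
    exact Lp.coeFn_zero (Vec k) 2 μ
  | insert q N hq ih =>
    rw [Finset.sum_insert hq]
    filter_upwards [Lp.coeFn_add (f q) (∑ r ∈ N, f r), ih] with x h1 h2
    rw [h1, Pi.add_apply, h2, Finset.sum_insert hq]

lemma coeFn_partialSumL (hε : ε ≠ 0) (a : (Fin d → ℤ) → Matrix (Fin k) (Fin l) ℂ) (u : L2 d l)
    (N : Finset (Fin d → ℤ)) : partialSumL β ε a u N
      =ᵐ[volume] fun x => app (∑ q ∈ N, wave β q (ε⁻¹ • x) • a q) (u x) := by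
  have h : ∀ᵐ x : Space d, ∀ q ∈ N, (appL (a q)).compLpL 2 volume
      ((isBddMatrix_phase l (shift β ε q)).mulL u) x = app (wave β q (ε⁻¹ • x) • a q) (u x) := by
    rw [Filter.eventually_all_finset]
    intro q _
    filter_upwards [(appL (a q)).coeFn_compLpL ((isBddMatrix_phase l (shift β ε q)).mulL u),
      (isBddMatrix_phase l (shift β ε q)).coeFn_mulL u] with x h1 h2
    rw [h1, h2, app_phase_shift hε]
    change app (a q) _ = _
    rw [app_smul, smul_app]
  filter_upwards [h, coeFn_sum_Lp N fun q => (appL (a q)).compLpL 2 volume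
    ((isBddMatrix_phase l (shift β ε q)).mulL u)] with x h1 h2
  rw [partialSumL, h2, sum_app]
  exact Finset.sum_congr rfl fun q hq => h1 q hq

lemma fourier_toLp_sum {ι : Type*} (N : Finset ι) (f : ι → L2 d k) :
    𝓕 (∑ q ∈ N, f q : L2 d k) = ∑ q ∈ N, (𝓕 (f q) : L2 d k) :=
  map_sum (Lp.fourierTransformₗᵢ (Space d) (Vec k)) f N

lemma coeFn_fourier_partialSumL (a : (Fin d → ℤ) → Matrix (Fin k) (Fin l) ℂ) {u : L2 d l}
    {h : Space d → Vec l} (hu : (𝓕 u : L2 d l) =ᵐ[volume] h) (N : Finset (Fin d → ℤ)) :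
    (𝓕 (partialSumL β ε a u N) : L2 d k)
      =ᵐ[volume] fun η => ∑ q ∈ N, app (a q) (h (η - shift β ε q)) := by
  have hsum : (𝓕 (partialSumL β ε a u N) : L2 d k) = ∑ q ∈ N, (appL (a q)).compLpL 2 volume
      (𝓕 ((isBddMatrix_phase l (shift β ε q)).mulL u) : L2 d l) := by
    rw [partialSumL, fourier_toLp_sum]
    exact Finset.sum_congr rfl fun q _ => fourier_compLpL _ _
  have hq : ∀ᵐ η : Space d, ∀ q ∈ N, (appL (a q)).compLpL 2 volume
      (𝓕 ((isBddMatrix_phase l (shift β ε q)).mulL u) : L2 d l) η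
        = app (a q) (h (η - shift β ε q)) := by
    rw [Filter.eventually_all_finset]
    intro q _
    filter_upwards [(appL (a q)).coeFn_compLpL
      (𝓕 ((isBddMatrix_phase l (shift β ε q)).mulL u) : L2 d l),
      coeFn_fourier_phase (shift β ε q) u,
      (measurePreserving_sub_right volume (shift β ε q)).quasiMeasurePreserving.ae hu]
      with η h1 h2 h3
    rw [h1, h2, h3]
    rfl
  rw [hsum]
  filter_upwards [hq, coeFn_sum_Lp N fun q => (appL (a q)).compLpL 2 volume
    (𝓕 ((isBddMatrix_phase l (shift β ε q)).mulL u) : L2 d l)] with η h1 h2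
  rw [h2]
  exact Finset.sum_congr rfl fun q hq => h1 q hq

lemma eLpNorm_sub_eq_fourier (u v : L2 d k) : eLpNorm (⇑u - ⇑v) 2 volume
    = eLpNorm (fun η => (𝓕 u : L2 d k) η - (𝓕 v : L2 d k) η) 2 volume := by
  rw [← eLpNorm_congr_ae (Lp.coeFn_sub u v), ← eLpNorm_congr_ae (coeFn_fourier_sub u v),
    ← Lp.enorm_def, ← Lp.enorm_def]
  exact ((Lp.fourierTransformₗᵢ (Space d) (Vec k)).enorm_map (u - v)).symm

/-- The Fourier series of the entries converge almost everywhere along a sequence. -/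
lemma exists_seq_tendsto_entries {F : Space d → Matrix (Fin k) (Fin l) ℂ}
    (hF : ∀ i j, MemLp (fun x => F x i j) 2 (cellMeasure β)) (hper : IsPeriodic β F) :
    ∃ ns : ℕ → Finset (Fin d → ℤ), Filter.Tendsto ns Filter.atTop Filter.atTop ∧
      ∀ᵐ x : Space d, ∀ i j, Filter.Tendsto
        (fun N => (∑ q ∈ ns N, wave β q x • mcoef β F q) i j) Filter.atTop (nhds (F x i j)) := by
  -- The errors of all entries are summed, so that a single sequence of partial sums serves every
  -- entry.
  set ρ : Finset (Fin d → ℤ) → Space d → ℝ := fun N x =>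
    ∑ i, ∑ j, ‖∑ q ∈ N, mcoef β F q i j * wave β q x - F x i j‖ with hρ
  have hmeas : ∀ (N : Finset (Fin d → ℤ)) i j, AEStronglyMeasurable
      (fun x => ∑ q ∈ N, mcoef β F q i j * wave β q x - F x i j) (cellMeasure β) := fun N i j =>
    ((Finset.aestronglyMeasurable_fun_sum N fun q _ =>
      ((continuous_wave β q).aestronglyMeasurable.const_mul _))).sub (hF i j).1
  have hlim : Filter.Tendsto (fun N => eLpNorm (ρ N) 2 (cellMeasure β)) Filter.atTop
      (nhds 0) := by
    have h1 : Filter.Tendsto (fun N : Finset (Fin d → ℤ) => ∑ i, ∑ j, eLpNorm (fun x =>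
        ∑ q ∈ N, mcoef β F q i j * wave β q x - F x i j) 2 (cellMeasure β)) Filter.atTop
        (nhds (∑ _i : Fin k, ∑ _j : Fin l, 0)) :=
      tendsto_finsetSum _ fun i _ => tendsto_finsetSum _ fun j _ =>
        tendsto_fourier_series β (hF i j)
    simp only [Finset.sum_const_zero] at h1
    refine tendsto_of_tendsto_of_tendsto_of_le_of_le tendsto_const_nhds h1
      (fun _ => bot_le) fun N => ?_
    have h2 : ρ N = ∑ i, ∑ j, fun x => ‖∑ q ∈ N, mcoef β F q i j * wave β q x - F x i j‖ := by
      ext x; simp [hρ]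
    rw [h2]
    refine (eLpNorm_sum_le (fun i _ => ?_) (by norm_num)).trans (Finset.sum_le_sum fun i _ =>
      (eLpNorm_sum_le (fun j _ => (hmeas N i j).norm) (by norm_num)).trans
        (Finset.sum_le_sum fun j _ => (eLpNorm_norm _).le))
    exact Finset.aestronglyMeasurable_sum _ fun j _ => (hmeas N i j).norm
  have hρm : ∀ N, AEStronglyMeasurable (ρ N) (cellMeasure β) := fun N =>
    Finset.aestronglyMeasurable_fun_sum _ fun i _ =>
      Finset.aestronglyMeasurable_fun_sum _ fun j _ => (hmeas N i j).norm
  obtain ⟨ns, hns, hae⟩ := (tendstoInMeasure_of_tendsto_eLpNorm (two_ne_zero) hρm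
    (aestronglyMeasurable_const (b := (0 : ℝ))) (by
      simpa [Pi.sub_def] using hlim)).exists_seq_tendsto_ae'
  refine ⟨ns, hns, ?_⟩
  refine ae_of_ae_cell β (fun γ hγ x => ?_) ?_
  · simp only [hper γ hγ x, fun q => isPeriodic_wave β q γ hγ x]
  · filter_upwards [hae] with x hx i j
    rw [tendsto_iff_norm_sub_tendsto_zero]
    refine tendsto_of_tendsto_of_tendsto_of_le_of_le tendsto_const_nhds hx
      (fun _ => norm_nonneg _) fun N => ?_
    have h1 : (∑ q ∈ ns N, wave β q x • mcoef β F q) i j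
        = ∑ q ∈ ns N, mcoef β F q i j * wave β q x := by
      rw [Matrix.sum_apply]
      exact Finset.sum_congr rfl fun q _ => by rw [Matrix.smul_apply, smul_eq_mul, mul_comm]
    simp only [h1]
    refine le_trans ?_ (Finset.single_le_sum (f := fun i => ∑ j,
      ‖∑ q ∈ ns N, mcoef β F q i j * wave β q x - F x i j‖)
      (fun i _ => Finset.sum_nonneg fun j _ => norm_nonneg _) (Finset.mem_univ i))
    exact Finset.single_le_sum (f := fun j =>
      ‖∑ q ∈ ns N, mcoef β F q i j * wave β q x - F x i j‖)
      (fun j _ => norm_nonneg _) (Finset.mem_univ j)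

/-- The product of a band-limited function and an oscillating periodic function is in `L₂`, and
its Fourier transform is the sum of the shifted Fourier transforms. -/
theorem exists_fourier_mul_rescale {F : Space d → Matrix (Fin k) (Fin l) ℂ} {B : Set (Space d)}
    {h : Space d → Vec l} (hε : 0 < ε)
    (hF : ∀ i j, MemLp (fun x => F x i j) 2 (cellMeasure β)) (hper : IsPeriodic β F)
    (hs : Summable fun q => ‖mcoef β F q‖ ^ 2) (hB : DisjointShifts β ε B)
    (hh : ∀ η ∉ B, h η = 0) {u : L2 d l} (hu : (𝓕 u : L2 d l) =ᵐ[volume] h) :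
    ∃ hV : MemLp (fun x => app (rescale ε F x) (u x)) 2 volume,
      (𝓕 (hV.toLp _) : L2 d k) =ᵐ[volume] modulated β ε (mcoef β F) h := by
  have hL : MemLp h 2 volume := (Lp.memLp (𝓕 u : L2 d l)).ae_eq hu
  have hW := memLp_modulated (β := β) (ε := ε) hB hh hL hs
  set V : L2 d k := 𝓕⁻ (hW.toLp _) with hVdef
  have hVF : (𝓕 V : L2 d k) =ᵐ[volume] modulated β ε (mcoef β F) h := by
    rw [hVdef, fourier_fourierInv]
    exact hW.coeFn_toLp
  have hlim : Filter.Tendsto (fun N => eLpNorm (⇑(partialSumL β ε (mcoef β F) u N) - ⇑V) 2 volume)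
      Filter.atTop (nhds 0) := by
    refine (tendsto_modulated hB hh hL hs).congr fun N => ?_
    rw [eLpNorm_sub_eq_fourier]
    refine eLpNorm_congr_ae ?_
    filter_upwards [coeFn_fourier_partialSumL (β := β) (ε := ε) (mcoef β F) hu N, hVF]
      with η h1 h2
    rw [h1, h2]
  obtain ⟨ns, hns, hae⟩ := exists_seq_tendsto_entries hF hper
  obtain ⟨ms, hms, hae'⟩ := (tendstoInMeasure_of_tendsto_eLpNorm two_ne_zero
    (fun N => Lp.aestronglyMeasurable _) (Lp.aestronglyMeasurable V)
    (hlim.comp hns)).exists_seq_tendsto_ae'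
  have hae2 := (quasiMeasurePreserving_smul (d := d) (inv_ne_zero hε.ne')).ae hae
  have hps := ae_all_iff.mpr fun N => coeFn_partialSumL (β := β) (ε := ε) hε.ne' (mcoef β F) u N
  -- The partial sums applied to u tend to V almost everywhere along a subsequence, because they do
  -- so in L₂. They also tend to F(x/ε)u(x), because the Fourier series of F converges along `ns`.
  -- Comparing the limits identifies the product without any bound on F.
  have hVu : (fun x => app (rescale ε F x) (u x)) =ᵐ[volume] V := by
    filter_upwards [hae', hae2, hps] with x h1 h2 h3
    ext i
    have h4 : Filter.Tendsto (fun N => (partialSumL β ε (mcoef β F) u (ns (ms N)) x) i)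
        Filter.atTop (nhds (V x i)) :=
      ((EuclideanSpace.proj (𝕜 := ℂ) i).continuous.tendsto (V x)).comp h1
    refine tendsto_nhds_unique ?_ h4
    simp only [h3, app_apply]
    exact tendsto_finsetSum _ fun j _ => ((h2 i j).comp hms).mul_const _
  have hV : MemLp (fun x => app (rescale ε F x) (u x)) 2 volume := (Lp.memLp V).ae_eq hVu.symm
  refine ⟨hV, ?_⟩
  have : hV.toLp _ = V := Lp.ext (hV.coeFn_toLp.trans hVu)
  rw [this]
  exact hVF

end Oscillating

/-! ### The Brillouin zone -/

section Brillouin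

variable {d : ℕ} {β : Module.Basis (Fin d) ℝ (Space d)}

/-- A countable intersection, which gives measurability of the zone. -/
lemma brillouin_eq (β : Module.Basis (Fin d) ℝ (Space d)) :
    brillouin β = ⋂ q : Fin d → ℤ, {k | dualVec β q ≠ 0 → ‖k‖ < ‖k - dualVec β q‖} := by
  ext k
  simp only [Set.mem_iInter, Set.mem_ofPred_eq]
  refine ⟨fun h q hq => h _ (dualVec_mem β q) hq, fun h s hs hs0 => ?_⟩
  obtain ⟨q, rfl⟩ := exists_dualVec_eq β hs
  exact h q hs0

lemma measurableSet_brillouin (β : Module.Basis (Fin d) ℝ (Space d)) :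
    MeasurableSet (brillouin β) := by
  rw [brillouin_eq]
  refine MeasurableSet.iInter fun q => ?_
  by_cases hq : dualVec β q = 0
  · simp [hq]
  · simp only [hq, ne_eq, not_false_eq_true, forall_const]
    exact measurableSet_lt continuous_norm.measurable
      (continuous_id.sub continuous_const).norm.measurable

lemma norm_lt_norm_add_of_mem_brillouin {k : Space d} (hk : k ∈ brillouin β) {q : Fin d → ℤ}
    (hq : q ≠ 0) : ‖k‖ < ‖k + dualVec β q‖ := by
  have h := hk (dualVec β (-q)) (dualVec_mem β _) (dualVec_ne_zero β (neg_ne_zero.mpr hq))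
  rwa [dualVec_neg, sub_neg_eq_add] at h

/-- Of two distinct representatives of κ in the zone, each would be strictly shorter than the other.
-/
lemma eq_of_sub_mem_brillouin {κ : Space d} {q r : Fin d → ℤ}
    (hq : κ - dualVec β q ∈ brillouin β) (hr : κ - dualVec β r ∈ brillouin β) : q = r := by
  by_contra hne
  have h1 := norm_lt_norm_add_of_mem_brillouin hq (sub_ne_zero.mpr hne)
  have h2 := norm_lt_norm_add_of_mem_brillouin hr (sub_ne_zero.mpr (Ne.symm hne))
  rw [dualVec_sub] at h1 h2
  rw [show κ - dualVec β q + (dualVec β q - dualVec β r) = κ - dualVec β r by abel] at h1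
  rw [show κ - dualVec β r + (dualVec β r - dualVec β q) = κ - dualVec β q by abel] at h2
  exact lt_asymm h1 h2

/-- Comparing k with k ± s, for s dual to the j-th basis vector, gives 2|⟨s, k⟩| ≤ |s|², and this
bounds the j-th coordinate of k. -/
lemma exists_norm_le_of_mem_brillouin (β : Module.Basis (Fin d) ℝ (Space d)) :
    ∃ M : ℝ, 0 ≤ M ∧ ∀ k ∈ brillouin β, ‖k‖ ≤ M := by
  refine ⟨∑ j, ‖dualVec β (Pi.single j 1)‖ ^ 2 * ‖β j‖, by positivity, fun k hk => ?_⟩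
  have hcoord : ∀ j, ‖β.repr k j‖ ≤ ‖dualVec β (Pi.single j 1)‖ ^ 2 := fun j => by
    set s := dualVec β (Pi.single j 1) with hs
    have hinner : ⟪s, k⟫_ℝ = 2 * Real.pi * β.repr k j := by
      rw [hs, inner_dualVec]
      congr 1
      rw [Finset.sum_eq_single_of_mem j (Finset.mem_univ j)]
      · simp
      · intro i _ hij
        simp [Pi.single_eq_of_ne hij]
    have hne : (Pi.single j 1 : Fin d → ℤ) ≠ 0 := by simp
    have h1 := norm_lt_norm_add_of_mem_brillouin hk hne
    have h2 := hk s (dualVec_mem β _) (dualVec_ne_zero β hne)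
    have h3 : ‖k‖ ^ 2 < ‖k + s‖ ^ 2 := by gcongr
    have h4 : ‖k‖ ^ 2 < ‖k - s‖ ^ 2 := by gcongr
    rw [norm_add_sq_real, real_inner_comm, hinner] at h3
    rw [norm_sub_sq_real, real_inner_comm, hinner] at h4
    have hpi := Real.pi_gt_three
    rw [Real.norm_eq_abs, abs_le]
    have h5 : |2 * (2 * Real.pi * β.repr k j)| ≤ ‖s‖ ^ 2 := abs_le.mpr ⟨by linarith, by linarith⟩
    rw [abs_mul, abs_mul, abs_mul, abs_of_pos Real.pi_pos, abs_two] at h5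
    have h6 : |β.repr k j| ≤ ‖s‖ ^ 2 := by nlinarith [abs_nonneg (β.repr k j)]
    exact abs_le.mp h6
  calc ‖k‖ = ‖∑ j, β.repr k j • β j‖ := by rw [β.sum_repr]
    _ ≤ ∑ j, ‖β.repr k j • β j‖ := norm_sum_le _ _
    _ ≤ _ := Finset.sum_le_sum fun j _ => by
        rw [norm_smul]
        exact mul_le_mul_of_nonneg_right (hcoord j) (norm_nonneg _)

/-- Constants of the lattice: the nonzero dual vectors have length at least `2r`, and the
Brillouin zone is in the ball of radius `M`. -/
structure LatticeBounds (β : Module.Basis (Fin d) ℝ (Space d)) (r M : ℝ) : Prop where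
  pos : 0 < r
  dual : ∀ q : Fin d → ℤ, q ≠ 0 → 2 * r ≤ ‖dualVec β q‖
  nonneg : 0 ≤ M
  zone : ∀ k ∈ brillouin β, ‖k‖ ≤ M

lemma exists_latticeBounds (β : Module.Basis (Fin d) ℝ (Space d)) :
    ∃ r M, LatticeBounds β r M := by
  obtain ⟨r, hr, hr'⟩ := exists_le_norm_dualVec β
  obtain ⟨M, hM, hM'⟩ := exists_norm_le_of_mem_brillouin β
  exact ⟨r, M, hr, hr', hM, hM'⟩

/-- If |k| < r then |k - s| ≥ 2r - |k| > |k| for all dual s ≠ 0, so the zone contains the ball of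
radius r. The frequencies removed by the smoothing thus satisfy ε|ξ| ≥ r. -/
lemma LatticeBounds.le_norm_of_notMem {r M : ℝ} (h : LatticeBounds β r M) {k : Space d}
    (hk : k ∉ brillouin β) : r ≤ ‖k‖ := by
  by_contra! hlt
  refine hk fun s hs hs0 => ?_
  obtain ⟨q, rfl⟩ := exists_dualVec_eq β hs
  have hq : q ≠ 0 := fun hq => hs0 (by rw [hq, dualVec_zero])
  have h1 := h.dual q hq
  have h2 := norm_sub_norm_le (dualVec β q) k
  rw [norm_sub_rev] at h2
  linarith

/-- The set of frequencies of the smoothing operator. -/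
def zone (β : Module.Basis (Fin d) ℝ (Space d)) (ε : ℝ) : Set (Space d) :=
  {η | ε • freq η ∈ brillouin β}

lemma measurableSet_zone (β : Module.Basis (Fin d) ℝ (Space d)) (ε : ℝ) :
    MeasurableSet (zone β ε) :=
  measurableSet_brillouin β |>.preimage (by fun_prop : Measurable fun η : Space d => ε • freq η)

lemma smul_freq_sub_shift {ε : ℝ} (hε : ε ≠ 0) (η : Space d) (q : Fin d → ℤ) :
    ε • freq (η - shift β ε q) = ε • freq η - dualVec β q := by
  rw [freq, smul_sub, smul_sub, shift, smul_smul, smul_smul, smul_smul]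
  congr 1
  have := Real.pi_pos.ne'
  rw [show ε * (2 * Real.pi) * (2 * Real.pi * ε)⁻¹ = 1 by field_simp, one_smul]

lemma disjointShifts_zone {ε : ℝ} (hε : ε ≠ 0) : DisjointShifts β ε (zone β ε) :=
  fun η q r hq hr => by
    change ε • freq _ ∈ brillouin β at hq hr
    rw [smul_freq_sub_shift hε] at hq hr
    exact eq_of_sub_mem_brillouin hq hr

variable {m n p : ℕ} {b : (Fin d → ℕ) → Matrix (Fin m) (Fin n) ℂ} {α₀ α₁ r M : ℝ}

lemma LatticeBounds.norm_add_dualVec_le (h : LatticeBounds β r M) {k : Space d} (hk : k ∈ brillouin β)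
    {q : Fin d → ℤ} (hq : q ≠ 0) : ‖k + dualVec β q‖ ≤ (1 + M / (2 * r)) * ‖dualVec β q‖ := by
  have h1 := h.zone k hk
  have h2 := h.dual q hq
  have hr := h.pos
  have h3 : M ≤ M / (2 * r) * ‖dualVec β q‖ := by
    rw [div_mul_eq_mul_div, le_div_iff₀ (by positivity)]
    exact mul_le_mul_of_nonneg_left h2 h.nonneg
  have := norm_add_le k (dualVec β q)
  linarith

lemma SymbolBounds.norm_sub_le_of_le (hb : SymbolBounds p b α₀ α₁) (hr : 0 < r) {k s : Space d}
    {R : ℝ} (h0 : 2 * r ≤ R) (h1 : ‖k + s‖ ≤ R) (h2 : ‖s‖ ≤ R) :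
    ‖symbol p b (k + s) - symbol p b s‖ ≤ diffConst d p α₁ / (2 * r) * (‖k‖ * R ^ p) := by
  have h3 := hb.norm_sub_le h1 h2
  rw [div_mul_eq_mul_div, le_div_iff₀ (by positivity)]
  calc _ ≤ ‖symbol p b (k + s) - symbol p b s‖ * R := by gcongr
    _ ≤ _ := h3.trans_eq (by ring)

/-- The Lipschitz bound with R = (1 + M/(2r))|s|. The weight |s|^p is the one with which the
coefficients of Λ are square summable. -/
lemma SymbolBounds.norm_sub_le_dual (hb : SymbolBounds p b α₀ α₁) (h : LatticeBounds β r M)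
    {k : Space d} (hk : k ∈ brillouin β) {q : Fin d → ℤ} (hq : q ≠ 0) :
    ‖symbol p b (k + dualVec β q) - symbol p b (dualVec β q)‖
      ≤ diffConst d p α₁ / (2 * r) * (1 + M / (2 * r)) ^ p * (‖k‖ * ‖dualVec β q‖ ^ p) := by
  have hr := h.pos
  have hM := h.nonneg
  have h1 : ‖dualVec β q‖ ≤ (1 + M / (2 * r)) * ‖dualVec β q‖ :=
    le_mul_of_one_le_left (norm_nonneg _) (le_add_of_nonneg_right (by positivity))
  refine (hb.norm_sub_le_of_le hr ((h.dual q hq).trans h1) (h.norm_add_dualVec_le hk hq) h1).trans_eq ?_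
  rw [mul_pow]
  ring

/-- Here R = 2|k + s|, since |k| < |k + s| in the zone gives |s| ≤ 2|k + s|. The weight |k + s|^p is
absorbed by |D|^p on the test function, so g̃ is only needed in L₂. -/
lemma SymbolBounds.norm_sub_le_add (hb : SymbolBounds p b α₀ α₁) (h : LatticeBounds β r M)
    {k : Space d} (hk : k ∈ brillouin β) {q : Fin d → ℤ} (hq : q ≠ 0) :
    ‖symbol p b (k + dualVec β q) - symbol p b (dualVec β q)‖
      ≤ diffConst d p α₁ / (2 * r) * 2 ^ p * (‖k‖ * ‖k + dualVec β q‖ ^ p) := by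
  have h1 := norm_lt_norm_add_of_mem_brillouin hk hq
  have h2 : ‖dualVec β q‖ ≤ 2 * ‖k + dualVec β q‖ := by
    have := _root_.norm_sub_le (k + dualVec β q) k
    rw [add_sub_cancel_left] at this
    linarith
  refine (hb.norm_sub_le_of_le h.pos ((h.dual q hq).trans h2) ?_ h2).trans_eq ?_
  · linarith [norm_nonneg (k + dualVec β q)]
  · rw [mul_pow]; ring

end Brillouin

/-! ### The smoothing operator -/

section Smoothing

variable {d m n p : ℕ} {b : (Fin d → ℕ) → Matrix (Fin m) (Fin n) ℂ} {α₀ α₁ : ℝ}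
  {β : Module.Basis (Fin d) ℝ (Space d)} {ε : ℝ}

lemma app_indicator_one (S : Set (Space d)) (ξ : Space d) (v : Vec n) :
    app (S.indicator (fun _ => (1 : Matrix (Fin n) (Fin n) ℂ)) ξ) v
      = S.indicator (fun _ => v) ξ := by
  by_cases h : ξ ∈ S <;> simp [h]

lemma coeFn_fourier_smoothing (f : L2 d n) : (𝓕 (smoothing β ε f) : L2 d n)
    =ᵐ[volume] (zone β ε).indicator (𝓕 f : L2 d n) := by
  have hfun : (fun η : Space d => app ({ξ : Space d | ε • ξ ∈ brillouin β}.indicator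
      (fun _ => (1 : Matrix (Fin n) (Fin n) ℂ)) (freq η)) ((𝓕 f : L2 d n) η))
      = (zone β ε).indicator (𝓕 f : L2 d n) := by
    ext1 η
    rw [app_indicator_one]
    rfl
  have h := coeFn_fourier_multiplier (u := f)
    (M := {ξ : Space d | ε • ξ ∈ brillouin β}.indicator
      (fun _ => (1 : Matrix (Fin n) (Fin n) ℂ))) (by
      rw [hfun]
      exact (Lp.memLp _).indicator (measurableSet_zone β ε))
  rw [hfun] at h
  exact h

/-- The resolvent of an operator with constant coefficients commutes with the smoothing. -/
lemma coeFn_fourier_resolvent_smoothing {A : Matrix (Fin m) (Fin m) ℂ} {G K φ : ℝ} {ζ : ℂ}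
    (hd : 1 ≤ d) (hα₀ : 0 ≤ α₀) (hα₁ : 0 ≤ α₁)
    (hb : SymbolBounds p b α₀ α₁) (hA : IsElliptic (fun _ : Space d => A) G K) (hK : 0 < K)
    (hφ : φ ∈ Set.Ioo 0 (2 * Real.pi)) (hζ : ζ = ‖ζ‖ * Complex.exp (φ * Complex.I))
    (hζ0 : ζ ≠ 0) {R : L2 d n →L[ℂ] L2 d n} (hR : IsResolvent p b (fun _ => A) ζ R) (f : L2 d n) :
    (𝓕 (R (smoothing β ε f)) : L2 d n)
      =ᵐ[volume] (zone β ε).indicator (𝓕 (R f) : L2 d n) := by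
  have hpos : ∀ η : Space d, 0 < α₀ / K * ‖freq η‖ ^ (2 * p) + ‖ζ‖ := fun η =>
    add_pos_of_nonneg_of_pos (by positivity) (norm_pos_iff.mpr hζ0)
  filter_upwards [resolvent_pointwise hd hα₀ hα₁ hb hA hK hφ hζ hR (smoothing β ε f),
    resolvent_pointwise hd hα₀ hα₁ hb hA hK hφ hζ hR (smoothing β ε f - f),
    coeFn_fourier_smoothing (β := β) (ε := ε) f, coeFn_fourier_sub (smoothing β ε f) f,
    coeFn_fourier_sub (R (smoothing β ε f)) (R f)] with η h1 h2 h3 h4 h5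
  -- Inside the zone the data Π_ε f - f vanish at this frequency, outside it the data Π_ε f do; the
  -- pointwise resolvent bound passes this on to the solution.
  by_cases hη : η ∈ zone β ε
  · rw [Set.indicator_of_mem hη] at h3 ⊢
    rw [h4, h3, sub_self, norm_zero, mul_zero, map_sub, h5] at h2
    have := nonpos_of_mul_nonpos_right h2 (hpos η)
    exact sub_eq_zero.mp (norm_le_zero_iff.mp this)
  · rw [Set.indicator_of_notMem hη] at h3 ⊢
    rw [h3, norm_zero, mul_zero] at h1
    exact norm_le_zero_iff.mp (nonpos_of_mul_nonpos_right h1 (hpos η))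

end Smoothing

/-! ### The corrector and the oscillating flux of a band-limited function -/

lemma norm_eq_eLpNorm_fourier {d k : ℕ} (V : L2 d k) :
    ‖V‖ = (eLpNorm (𝓕 V : L2 d k) 2 volume).toReal := by
  rw [← Lp.norm_def]
  exact ((Lp.fourierTransformₗᵢ (Space d) (Vec k)).norm_map V).symm

lemma inner_fourier {d k : ℕ} (u v : L2 d k) : ⟪u, v⟫_ℂ = ⟪(𝓕 u : L2 d k), (𝓕 v : L2 d k)⟫_ℂ :=
  ((Lp.fourierTransformₗᵢ (Space d) (Vec k)).inner_map_map u v).symm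

lemma norm_le_of_shift {d k : ℕ} {E : Type*} [NormedAddCommGroup E] {ι : Type*} [Countable ι]
    (τ : ι → Space d) {V : L2 d k} {H : Space d → E} (hH : MemLp H 2 volume) {A : ι → ℝ}
    (hA : Summable fun q => A q ^ 2) {C : ℝ} (hC0 : 0 ≤ C) (hC : ∑' q, A q ^ 2 ≤ C ^ 2)
    (hV : ∀ᵐ η, (𝓕 V : L2 d k) η = 0 ∨ ∃ q, ‖(𝓕 V : L2 d k) η‖ ≤ A q * ‖H (η - τ q)‖) :
    ‖V‖ ≤ C * (eLpNorm H 2 volume).toReal := by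
  rw [norm_eq_eLpNorm_fourier, ← ENNReal.toReal_ofReal hC0, ← ENNReal.toReal_mul]
  exact ENNReal.toReal_mono (ENNReal.mul_ne_top ENNReal.ofReal_ne_top hH.2.ne)
    (eLpNorm_le_of_shift τ hH.1 hA hC0 hC hV)

lemma norm_integral_le_of_le_mul {X : Type*} [MeasurableSpace X] {μ : Measure X} {E₁ E₂ : Type*}
    [NormedAddCommGroup E₁] [NormedAddCommGroup E₂] {f₁ : X → E₁} {f₂ : X → E₂}
    (h₁ : MemLp f₁ 2 μ) (h₂ : MemLp f₂ 2 μ) {ψ : X → ℂ} (hψ : ∀ᵐ x ∂μ, ‖ψ x‖ ≤ ‖f₁ x‖ * ‖f₂ x‖) :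
    ‖∫ x, ψ x ∂μ‖ ≤ (eLpNorm f₁ 2 μ).toReal * (eLpNorm f₂ 2 μ).toReal := by
  refine (norm_integral_le_of_norm_le (h₁.norm.integrable_mul h₂.norm) hψ).trans ?_
  have h3 : ∫ x, ‖f₁ x‖ * ‖f₂ x‖ ∂μ = ⟪h₁.norm.toLp _, h₂.norm.toLp _⟫_ℝ := by
    rw [L2.inner_def]
    refine integral_congr_ae ?_
    filter_upwards [h₁.norm.coeFn_toLp, h₂.norm.coeFn_toLp] with x e1 e2
    rw [e1, e2]
    simp [mul_comm]
  change ∫ x, ‖f₁ x‖ * ‖f₂ x‖ ∂μ ≤ _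
  rw [h3]
  refine (real_inner_le_norm _ _).trans ?_
  rw [Lp.norm_toLp, Lp.norm_toLp, eLpNorm_norm, eLpNorm_norm]

lemma summable_const_mul_sq {ι : Type*} {A : ι → ℝ} (hA : Summable fun q => A q ^ 2) {C : ℝ}
    (hC : ∑' q, A q ^ 2 ≤ C ^ 2) (c : ℝ) :
    (Summable fun q => (c * A q) ^ 2) ∧ ∑' q, (c * A q) ^ 2 ≤ (c * C) ^ 2 := by
  simp only [mul_pow]
  refine ⟨hA.mul_left _, ?_⟩
  rw [tsum_mul_left]
  gcongr

section Corrector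

variable {d m n p : ℕ} {b : (Fin d → ℕ) → Matrix (Fin m) (Fin n) ℂ} {α₀ α₁ : ℝ}
  {g : Space d → Matrix (Fin m) (Fin m) ℂ} {G K : ℝ} {β : Module.Basis (Fin d) ℝ (Space d)}
  {Λ : Space d → Matrix (Fin n) (Fin m) ℂ} {ε r M : ℝ}

lemma symbol_add_dualVec (hε : ε ≠ 0) (η : Space d) (q : Fin d → ℤ) :
    symbol p b (ε • freq (η - shift β ε q) + dualVec β q) = (ε : ℂ) ^ p • symbol p b (freq η) := by
  rw [smul_freq_sub_shift hε, sub_add_cancel, symbol_smul]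

lemma norm_smul_freq (hε : 0 < ε) (η : Space d) : ‖ε • freq η‖ = ε * ‖freq η‖ := by
  rw [norm_smul ε (freq η), Real.norm_of_nonneg hε.le]

lemma norm_freq_pow_smul {k : ℕ} (η : Space d) (j : ℕ) (v : Vec k) :
    ‖‖freq η‖ ^ j • v‖ = ‖freq η‖ ^ j * ‖v‖ := by
  rw [norm_smul (‖freq η‖ ^ j) v, norm_pow ‖freq η‖, norm_norm (freq η)]

lemma norm_freq_smul {k : ℕ} (η : Space d) (v : Vec k) : ‖‖freq η‖ • v‖ = ‖freq η‖ * ‖v‖ := by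
  rw [norm_smul ‖freq η‖ v, norm_norm (freq η)]

lemma norm_pow_eq (hε : 0 < ε) (η : Space d) (q : Fin d → ℤ) :
    ‖ε • freq (η - shift β ε q) + dualVec β q‖ ^ p = ε ^ p * ‖freq η‖ ^ p := by
  rw [smul_freq_sub_shift hε.ne', sub_add_cancel, norm_smul, mul_pow, Real.norm_of_nonneg hε.le]

lemma IsCellSolution.summable_dual_mul (hd : 1 ≤ d) (hα₀ : 0 < α₀) (hα₁ : 0 ≤ α₁)
    (hb : SymbolBounds p b α₀ α₁) (hg : IsElliptic g G K) (hK : 0 ≤ K)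
    (hΛ : IsCellSolution β p b g Λ) :
    (Summable fun q => (‖dualVec β q‖ ^ p * ‖mcoef β Λ q‖) ^ 2) ∧
      ∑' q, (‖dualVec β q‖ ^ p * ‖mcoef β Λ q‖) ^ 2 ≤ ((√α₀)⁻¹ * (√m * (G * K))) ^ 2 := by
  obtain ⟨h1, h2⟩ := hΛ.summable_cellBD hg hK
  have hm : (m : ℝ) * (G * K) ^ 2 = (√m * (G * K)) ^ 2 := by
    rw [mul_pow √(m : ℝ), Real.sq_sqrt (Nat.cast_nonneg m)]
  rw [hm] at h2
  obtain ⟨h3, h4⟩ := summable_const_mul_sq h1 h2 (√α₀)⁻¹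
  have hle : ∀ q, (‖dualVec β q‖ ^ p * ‖mcoef β Λ q‖) ^ 2
      ≤ ((√α₀)⁻¹ * ‖mcoef β (cellBD β p b Λ) q‖) ^ 2 := fun q => by
    have := hΛ.norm_mcoef_le hd hα₀ hα₁ hb q
    gcongr
  have h5 := h3.of_nonneg_of_le (fun q => by positivity) hle
  exact ⟨h5, (h5.tsum_le_tsum hle h3).trans h4⟩

/-- A Poincaré inequality for coefficients: the mean of Λ vanishes, and |s| ≥ 2r for every other
dual vector. -/
lemma IsCellSolution.summable (hd : 1 ≤ d) (hα₀ : 0 < α₀) (hα₁ : 0 ≤ α₁)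
    (hb : SymbolBounds p b α₀ α₁) (hg : IsElliptic g G K) (hK : 0 ≤ K)
    (hΛ : IsCellSolution β p b g Λ) (hr : LatticeBounds β r M) :
    (Summable fun q => ‖mcoef β Λ q‖ ^ 2) ∧
      ∑' q, ‖mcoef β Λ q‖ ^ 2 ≤ (((2 * r) ^ p)⁻¹ * ((√α₀)⁻¹ * (√m * (G * K)))) ^ 2 := by
  obtain ⟨h1, h2⟩ := hΛ.summable_dual_mul hd hα₀ hα₁ hb hg hK
  obtain ⟨h3, h4⟩ := summable_const_mul_sq h1 h2 ((2 * r) ^ p)⁻¹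
  have hr0 := hr.pos
  have hle : ∀ q, ‖mcoef β Λ q‖ ^ 2
      ≤ (((2 * r) ^ p)⁻¹ * (‖dualVec β q‖ ^ p * ‖mcoef β Λ q‖)) ^ 2 := fun q => by
    by_cases hq : q = 0
    · rw [hq, hΛ.mcoef_zero, norm_zero, sq, zero_mul]
      positivity
    · have h5 : (2 * r) ^ p ≤ ‖dualVec β q‖ ^ p := by
        have := hr.dual q hq
        gcongr
      have : ‖mcoef β Λ q‖ ≤ ((2 * r) ^ p)⁻¹ * (‖dualVec β q‖ ^ p * ‖mcoef β Λ q‖) := by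
        rw [← div_eq_inv_mul, le_div_iff₀ (by positivity), mul_comm]
        gcongr
      gcongr
  have h5 := h3.of_nonneg_of_le (fun q => by positivity) hle
  exact ⟨h5, (h5.tsum_le_tsum hle h3).trans h4⟩

variable {y : L2 d m} {h : Space d → Vec m}

/-- The corrector of a band-limited function is in `L₂`, with an explicit Fourier transform. -/
lemma IsCellSolution.exists_corrector (hd : 1 ≤ d) (hα₀ : 0 < α₀) (hα₁ : 0 ≤ α₁)
    (hb : SymbolBounds p b α₀ α₁) (hg : IsElliptic g G K) (hK : 0 ≤ K)
    (hΛ : IsCellSolution β p b g Λ) (hr : LatticeBounds β r M) (hε : 0 < ε)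
    (hh : ∀ η ∉ zone β ε, h η = 0) (hy : (𝓕 y : L2 d m) =ᵐ[volume] h) :
    ∃ hV : MemLp (fun x => app (rescale ε Λ x) (y x)) 2 volume,
      (𝓕 (hV.toLp _) : L2 d n) =ᵐ[volume] modulated β ε (mcoef β Λ) h :=
  exists_fourier_mul_rescale hε hΛ.memLp_entry hΛ.isPeriodic
    (hΛ.summable hd hα₀ hα₁ hb hg hK hr).1 (disjointShifts_zone hε.ne') hh hy

variable {V : L2 d n}

lemma IsCellSolution.norm_corrector_le (hd : 1 ≤ d) (hα₀ : 0 < α₀) (hα₁ : 0 ≤ α₁)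
    (hb : SymbolBounds p b α₀ α₁) (hg : IsElliptic g G K) (hG : 0 ≤ G) (hK : 0 ≤ K)
    (hΛ : IsCellSolution β p b g Λ) (hr : LatticeBounds β r M) (hε : 0 < ε)
    (hL : MemLp h 2 volume) (hh : ∀ η ∉ zone β ε, h η = 0)
    (hV : (𝓕 V : L2 d n) =ᵐ[volume] modulated β ε (mcoef β Λ) h) :
    ‖V‖ ≤ ((2 * r) ^ p)⁻¹ * ((√α₀)⁻¹ * (√m * (G * K))) * (eLpNorm h 2 volume).toReal := by
  obtain ⟨h1, h2⟩ := hΛ.summable hd hα₀ hα₁ hb hg hK hr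
  have hr0 := hr.pos
  refine norm_le_of_shift (shift β ε) hL h1 (by positivity) h2 ?_
  filter_upwards [hV] with η hη
  rw [hη]
  by_cases hq : ∃ q, η - shift β ε q ∈ zone β ε
  · obtain ⟨q, hq⟩ := hq
    refine Or.inr ⟨q, ?_⟩
    rw [modulated_of_mem (disjointShifts_zone hε.ne') hh hq]
    exact norm_app_le _ _
  · push Not at hq
    exact Or.inl (modulated_of_notMem hh hq)

/-- On the translate by s one has ε|ξ| = |k + s|, at most a constant times |s|, so |ξ|^p costs
ε^{-p}|s|^p. The coefficients of Λ absorb |s|^p, and the power of ε is harmless because only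
membership in H^p is claimed. -/
lemma IsCellSolution.memSobolev_corrector (hd : 1 ≤ d) (hα₀ : 0 < α₀) (hα₁ : 0 ≤ α₁)
    (hb : SymbolBounds p b α₀ α₁) (hg : IsElliptic g G K) (hG : 0 ≤ G) (hK : 0 ≤ K)
    (hΛ : IsCellSolution β p b g Λ) (hr : LatticeBounds β r M) (hε : 0 < ε)
    (hL : MemLp h 2 volume) (hh : ∀ η ∉ zone β ε, h η = 0)
    (hV : (𝓕 V : L2 d n) =ᵐ[volume] modulated β ε (mcoef β Λ) h) : MemSobolev p V := by
  obtain ⟨h1, h2⟩ := hΛ.summable_dual_mul hd hα₀ hα₁ hb hg hK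
  obtain ⟨h3, h4⟩ := summable_const_mul_sq h1 h2 ((ε ^ p)⁻¹ * (1 + M / (2 * r)) ^ p)
  have hr0 := hr.pos
  have hM0 := hr.nonneg
  refine (memSobolev_of_memLp ⟨aestronglyMeasurable_smul_fourier (continuous_freq_pow p) V,
    lt_of_le_of_lt (eLpNorm_le_of_shift (shift β ε) hL.1 h3 (by positivity) h4 ?_)
      (ENNReal.mul_lt_top ENNReal.ofReal_lt_top hL.2)⟩).1
  filter_upwards [hV] with η hη
  rw [hη]
  by_cases hq : ∃ q, η - shift β ε q ∈ zone β ε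
  · obtain ⟨q, hq⟩ := hq
    rw [modulated_of_mem (disjointShifts_zone hε.ne') hh hq]
    by_cases hq0 : q = 0
    · left
      rw [hq0, hΛ.mcoef_zero, zero_app, smul_zero]
    · refine Or.inr ⟨q, ?_⟩
      have h5 : ε ^ p * ‖freq η‖ ^ p ≤ (1 + M / (2 * r)) ^ p * ‖dualVec β q‖ ^ p := by
        rw [← norm_pow_eq hε η q, ← mul_pow]
        have := hr.norm_add_dualVec_le hq hq0
        gcongr
      have h6 := norm_app_le (mcoef β Λ q) (h (η - shift β ε q))
      rw [norm_freq_pow_smul]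
      calc ‖freq η‖ ^ p * ‖app (mcoef β Λ q) (h (η - shift β ε q))‖
          = (ε ^ p)⁻¹ * (ε ^ p * ‖freq η‖ ^ p) * ‖app (mcoef β Λ q) (h (η - shift β ε q))‖ := by
            field_simp
        _ ≤ (ε ^ p)⁻¹ * ((1 + M / (2 * r)) ^ p * ‖dualVec β q‖ ^ p)
            * (‖mcoef β Λ q‖ * ‖h (η - shift β ε q)‖) := by gcongr
        _ = _ := by ring
  · push Not at hq
    left
    rw [modulated_of_notMem hh hq, smul_zero]

/-- The derivatives of the corrector are, up to a small remainder, those of the oscillating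
factor. -/
lemma IsCellSolution.norm_bD_corrector_sub_le (hd : 1 ≤ d) (hα₀ : 0 < α₀) (hα₁ : 0 ≤ α₁)
    (hb : SymbolBounds p b α₀ α₁) (hg : IsElliptic g G K) (hG : 0 ≤ G) (hK : 0 ≤ K)
    (hΛ : IsCellSolution β p b g Λ) (hr : LatticeBounds β r M) (hε : 0 < ε)
    (hL : MemLp (fun η => ‖freq η‖ • h η) 2 volume) (hh : ∀ η ∉ zone β ε, h η = 0)
    (hV : (𝓕 V : L2 d n) =ᵐ[volume] modulated β ε (mcoef β Λ) h) (hVs : MemSobolev p V)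
    {P : L2 d m} (hP : (𝓕 P : L2 d m) =ᵐ[volume] modulated β ε (mcoef β (cellBD β p b Λ)) h) :
    ‖(ε : ℂ) ^ p • bD p b V - P‖ ≤ diffConst d p α₁ / (2 * r) * (1 + M / (2 * r)) ^ p * ε
      * ((√α₀)⁻¹ * (√m * (G * K))) * (eLpNorm (fun η => ‖freq η‖ • h η) 2 volume).toReal := by
  have hr0 := hr.pos
  have hM0 := hr.nonneg
  have hdc := diffConst_nonneg d p α₁
  obtain ⟨h1, h2⟩ := hΛ.summable_dual_mul hd hα₀ hα₁ hb hg hK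
  obtain ⟨h3, h4⟩ := summable_const_mul_sq h1 h2
    (diffConst d p α₁ / (2 * r) * (1 + M / (2 * r)) ^ p * ε)
  refine norm_le_of_shift (shift β ε) hL h3 (by positivity) h4 ?_
  filter_upwards [hV, hP, coeFn_fourier_sub ((ε : ℂ) ^ p • bD p b V) P,
    coeFn_fourier_smul ((ε : ℂ) ^ p) (bD p b V), coeFn_fourier_bD hd hα₀.le hα₁ hb hVs]
    with η e1 e2 e3 e4 e5
  rw [e3, e4, e5, e1, e2]
  by_cases hq : ∃ q, η - shift β ε q ∈ zone β ε
  · obtain ⟨q, hq⟩ := hq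
    rw [modulated_of_mem (disjointShifts_zone hε.ne') hh hq,
      modulated_of_mem (disjointShifts_zone hε.ne') hh hq, hΛ.mcoef_cellBD, mul_app, ← smul_app,
      ← symbol_add_dualVec (β := β) hε.ne' η q, ← sub_app]
    by_cases hq0 : q = 0
    · left
      rw [hq0, hΛ.mcoef_zero, zero_app, app_zero]
    · refine Or.inr ⟨q, ?_⟩
      -- The transform of ε^p b(D)V carries b(k + s) and that of P carries b(s). The factor |k|
      -- yields both ε and the frequency weight on h.
      have h5 := hb.norm_sub_le_dual hr hq hq0
      have h6 := norm_app_le (mcoef β Λ q) (h (η - shift β ε q))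
      refine (norm_app_le _ _).trans ((mul_le_mul h5 h6 (norm_nonneg _) (by positivity)).trans_eq ?_)
      rw [norm_smul_freq hε, norm_freq_smul]
      ring
  · push Not at hq
    left
    rw [modulated_of_notMem hh hq, modulated_of_notMem hh hq, app_zero, smul_zero, sub_zero]

lemma shift_zero : shift β ε 0 = 0 := by
  rw [shift, dualVec_zero, smul_zero]

/-- The difference of the oscillating flux and the effective flux is small in the dual norm. -/
lemma IsCellSolution.norm_inner_flux_sub_le (hd : 1 ≤ d) (hα₀ : 0 < α₀) (hα₁ : 0 ≤ α₁)
    (hb : SymbolBounds p b α₀ α₁) (hg : IsElliptic g G K) (hK : 0 ≤ K)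
    (hΛ : IsCellSolution β p b g Λ) (hr : LatticeBounds β r M) (hε : 0 < ε)
    (hL : MemLp (fun η => ‖freq η‖ • h η) 2 volume) (hh : ∀ η ∉ zone β ε, h η = 0)
    {T T₀ : L2 d m} (hT : (𝓕 T : L2 d m) =ᵐ[volume] modulated β ε (mcoef β (gTilde β p b g Λ)) h)
    (hT₀ : (𝓕 T₀ : L2 d m) =ᵐ[volume] fun η => app (gEff β p b g Λ) (h η))
    {v : L2 d n} (hv : MemSobolev p v) :
    ‖⟪bD p b v, T - T₀⟫_ℂ‖ ≤ dNorm p v * (diffConst d p α₁ / (2 * r) * 2 ^ p * ε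
      * (√m * (G ^ 2 * K)) * (eLpNorm (fun η => ‖freq η‖ • h η) 2 volume).toReal) := by
  have hr0 := hr.pos
  have hdc := diffConst_nonneg d p α₁
  set c := diffConst d p α₁ / (2 * r) * 2 ^ p * ε with hc
  have hc0 : 0 ≤ c := by positivity
  -- Scalar coefficients of a majorant: `modulated β ε a H` has a known L₂ bound and is paired with
  -- |D|^p v by Cauchy–Schwarz.
  set a : (Fin d → ℤ) → Matrix (Fin m) (Fin m) ℂ := fun q =>
    ((c * ‖mcoef β (gTilde β p b g Λ) q‖ : ℝ) : ℂ) • 1 with ha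
  have happ : ∀ q (u : Vec m), ‖app (a q) u‖ = c * ‖mcoef β (gTilde β p b g Λ) q‖ * ‖u‖ :=
    fun q u => by
      rw [ha, smul_app, one_app, norm_smul, Complex.norm_real, Real.norm_of_nonneg (by positivity)]
  obtain ⟨h1, h2⟩ := hΛ.summable_gTilde hg hK
  have hm : (m : ℝ) * (G ^ 2 * K) ^ 2 = (√m * (G ^ 2 * K)) ^ 2 := by
    rw [mul_pow √(m : ℝ), Real.sq_sqrt (Nat.cast_nonneg m)]
  rw [hm] at h2
  obtain ⟨h3, h4⟩ := summable_const_mul_sq h1 h2 c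
  set H : Space d → Vec m := fun η => ‖freq η‖ • h η with hH
  have hH0 : ∀ η ∉ zone β ε, H η = 0 := fun η hη => by rw [hH]; simp only [hh η hη, smul_zero]
  have hdis := disjointShifts_zone (β := β) hε.ne'
  have hbound : eLpNorm (modulated β ε a H) 2 volume
      ≤ ENNReal.ofReal (c * (√m * (G ^ 2 * K))) * eLpNorm H 2 volume := by
    refine eLpNorm_le_of_shift (shift β ε) hL.1 h3 (by positivity) h4 (ae_of_all _ fun η => ?_)
    by_cases hq : ∃ q, η - shift β ε q ∈ zone β ε
    · obtain ⟨q, hq⟩ := hq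
      refine Or.inr ⟨q, ?_⟩
      rw [modulated_of_mem hdis hH0 hq, happ]
    · push Not at hq
      exact Or.inl (modulated_of_notMem hH0 hq)
  have hmod : MemLp (modulated β ε a H) 2 volume :=
    ⟨aestronglyMeasurable_modulated hdis hH0 hL.1,
      lt_of_le_of_lt hbound (ENNReal.mul_lt_top ENNReal.ofReal_lt_top hL.2)⟩
  have hptw : ∀ᵐ η : Space d, ‖⟪(𝓕 (bD p b v) : L2 d m) η, (𝓕 (T - T₀) : L2 d m) η⟫_ℂ‖
      ≤ ‖‖freq η‖ ^ p • (𝓕 v : L2 d n) η‖ * ‖modulated β ε a H η‖ := by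
    filter_upwards [hT, hT₀, coeFn_fourier_sub T T₀, coeFn_fourier_bD hd hα₀.le hα₁ hb hv]
      with η e1 e2 e3 e4
    rw [e3, e1, e2, e4]
    by_cases hq : ∃ q, η - shift β ε q ∈ zone β ε
    · obtain ⟨q, hq⟩ := hq
      rw [modulated_of_mem hdis hh hq, modulated_of_mem hdis hH0 hq, happ]
      by_cases hq0 : q = 0
      · subst hq0
        -- The unshifted term of T is g⁰h, which is exactly T₀.
        rw [shift_zero, sub_zero, mcoef_gTilde_zero, sub_self, inner_zero_right, norm_zero]
        positivity
      -- On a translated copy of the zone T₀ vanishes, because the copies are disjoint.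
      · have hη : η ∉ zone β ε := fun hη => hq0 (hdis η q 0 hq (by rwa [shift_zero, sub_zero]))
        rw [hh η hη, app_zero, sub_zero]
        set s := dualVec β q with hs
        set k := ε • freq (η - shift β ε q) with hk
        set z := app (mcoef β (gTilde β p b g Λ) q) (h (η - shift β ε q)) with hz
        set w := (𝓕 v : L2 d n) η with hw
        have hs0 : ⟪app (symbol p b s) w, z⟫_ℂ = 0 := by
          rw [inner_app_left, hz, ← mul_app, hΛ.adjoint_mcoef_gTilde hg, zero_app,
            inner_zero_right]
        -- Multiplication by ε^p turns b(ξ) into b(k + s), from which b(s) may be subtracted since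
        -- it pairs to zero with z.
        have h5 : ε ^ p * ‖⟪app (symbol p b (freq η)) w, z⟫_ℂ‖
            = ‖⟪app (symbol p b (k + s) - symbol p b s) w, z⟫_ℂ‖ := by
          rw [sub_app, inner_sub_left, hs0, sub_zero, hk, hs, symbol_add_dualVec hε.ne', smul_app,
            inner_smul_left, norm_mul]
          congr 1
          simp [abs_of_pos hε]
        have h6 : ‖⟪app (symbol p b (k + s) - symbol p b s) w, z⟫_ℂ‖
            ≤ (diffConst d p α₁ / (2 * r) * 2 ^ p * (‖k‖ * (ε ^ p * ‖freq η‖ ^ p)) * ‖w‖)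
              * (‖mcoef β (gTilde β p b g Λ) q‖ * ‖h (η - shift β ε q)‖) := by
          refine (norm_inner_le_norm _ _).trans (mul_le_mul ((norm_app_le _ _).trans ?_)
            (norm_app_le _ _) (norm_nonneg _) (by positivity))
          rw [← norm_pow_eq (β := β) hε η q]
          exact mul_le_mul_of_nonneg_right (hb.norm_sub_le_add hr hq hq0) (norm_nonneg _)
        have hεp : 0 < ε ^ p := by positivity
        rw [← h5] at h6
        refine le_of_mul_le_mul_left (h6.trans_eq ?_) hεp
        rw [hH, norm_freq_pow_smul, norm_freq_smul, hk, norm_smul_freq hε, hc]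
        ring
    · push Not at hq
      have hη : η ∉ zone β ε := by
        have := hq 0
        rwa [shift_zero, sub_zero] at this
      rw [modulated_of_notMem hh hq, hh η hη, app_zero, sub_zero, inner_zero_right, norm_zero]
      positivity
  rw [inner_fourier, L2.inner_def]
  refine (norm_integral_le_of_le_mul hv.memLp hmod hptw).trans ?_
  refine mul_le_mul_of_nonneg_left ?_ (dNorm_nonneg p v)
  have hcc : 0 ≤ c * (√m * (G ^ 2 * K)) := by positivity
  rw [← ENNReal.toReal_ofReal hcc, ← ENNReal.toReal_mul]
  exact ENNReal.toReal_mono (ENNReal.mul_ne_top ENNReal.ofReal_ne_top hL.2.ne) hbound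

end Corrector

/-! ### Estimates for the effective resolvent -/

lemma pow_mul_pow_le_add {x Z : ℝ} (hx : 0 ≤ x) (hZ : 0 ≤ Z) (i j : ℕ) :
    x ^ i * Z ^ j ≤ x ^ (i + j) + Z ^ (i + j) := by
  rcases le_total x Z with h | h
  · calc x ^ i * Z ^ j ≤ Z ^ i * Z ^ j := by gcongr
      _ = Z ^ (i + j) := (pow_add _ _ _).symm
      _ ≤ _ := le_add_of_nonneg_left (by positivity)
  · calc x ^ i * Z ^ j ≤ x ^ i * x ^ j := by gcongr
      _ = x ^ (i + j) := (pow_add _ _ _).symm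
      _ ≤ _ := le_add_of_nonneg_right (by positivity)

lemma toReal_eLpNorm_le {X : Type*} [MeasurableSpace X] {μ : Measure X} {E₁ E₂ : Type*}
    [NormedAddCommGroup E₁] [NormedAddCommGroup E₂] {f₁ : X → E₁} {f₂ : X → E₂} {C : ℝ}
    (h₁ : AEStronglyMeasurable f₁ μ) (h₂ : MemLp f₂ 2 μ) (hC : 0 ≤ C)
    (h : ∀ᵐ x ∂μ, ‖f₁ x‖ ≤ C * ‖f₂ x‖) :
    MemLp f₁ 2 μ ∧ (eLpNorm f₁ 2 μ).toReal ≤ C * (eLpNorm f₂ 2 μ).toReal := by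
  have h3 := eLpNorm_le_mul_eLpNorm_of_ae_le_mul h 2
  refine ⟨h₂.of_le_mul h₁ h, ?_⟩
  rw [← ENNReal.toReal_ofReal hC, ← ENNReal.toReal_mul]
  exact ENNReal.toReal_mono (ENNReal.mul_ne_top ENNReal.ofReal_ne_top h₂.2.ne) h3

lemma IsBddMatrix.norm_mulL_le {X : Type*} [MeasurableSpace X] {μ : Measure X} {k n : ℕ}
    {M : X → Matrix (Fin k) (Fin n) ℂ} {C : ℝ} (h : IsBddMatrix μ M C) (u : Lp (Vec n) 2 μ) :
    ‖h.mulL u‖ ≤ C * ‖u‖ := by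
  refine Lp.norm_le_mul_norm_of_ae_le_mul ?_
  filter_upwards [h.coeFn_mulL u, h.bound] with x h1 h2
  rw [h1]
  exact h2 _

section Effective

variable {d m n p : ℕ} {b : (Fin d → ℕ) → Matrix (Fin m) (Fin n) ℂ} {α₀ α₁ : ℝ}
  {β : Module.Basis (Fin d) ℝ (Space d)} {ε r M c κ Z : ℝ} {f u : L2 d n}

/-- The Fourier transform of `b(D) Π_ε u`. -/
def bandLimited (p : ℕ) (b : (Fin d → ℕ) → Matrix (Fin m) (Fin n) ℂ)
    (β : Module.Basis (Fin d) ℝ (Space d)) (ε : ℝ) (u : L2 d n) : Space d → Vec m :=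
  (zone β ε).indicator fun η => app (symbol p b (freq η)) ((𝓕 u : L2 d n) η)

lemma bandLimited_of_notMem {η : Space d} (hη : η ∉ zone β ε) :
    bandLimited p b β ε u η = 0 := Set.indicator_of_notMem hη _

lemma norm_bandLimited_le (hd : 1 ≤ d) (hα₀ : 0 ≤ α₀) (hα₁ : 0 ≤ α₁)
    (hb : SymbolBounds p b α₀ α₁) (η : Space d) :
    ‖bandLimited p b β ε u η‖ ≤ √α₁ * (‖freq η‖ ^ p * ‖(𝓕 u : L2 d n) η‖) :=
  (norm_indicator_le_norm_self _ _).trans (hb.norm_bounds hd hα₀ hα₁ _ _).2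

lemma aestronglyMeasurable_bandLimited :
    AEStronglyMeasurable (bandLimited p b β ε u) volume :=
  (aestronglyMeasurable_symbol (Lp.aestronglyMeasurable _)).indicator (measurableSet_zone β ε)

/-- The resolvent estimate in terms of powers of `|ξ|` and of `|ζ|^{1/2p}`. -/
lemma pow_mul_le_of_resolvent {κ₀ x Z U F c : ℝ} (hκ : 0 < κ) (hκ0 : κ ≤ κ₀) (hκ1 : κ ≤ 1)
    (hx : 0 ≤ x) (hZ : 0 < Z) (hU : 0 ≤ U)
    (h : (κ₀ * x ^ (2 * p) + Z ^ (2 * p)) * U ≤ 2 * c * F) {i j : ℕ} (hij : i + j = 2 * p) :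
    x ^ i * U ≤ 2 * c / κ * (Z ^ j)⁻¹ * F := by
  have h1 : κ * (x ^ i * Z ^ j) ≤ κ₀ * x ^ (2 * p) + Z ^ (2 * p) := by
    calc κ * (x ^ i * Z ^ j) ≤ κ * (x ^ (2 * p) + Z ^ (2 * p)) := by
          rw [← hij]
          exact mul_le_mul_of_nonneg_left (pow_mul_pow_le_add hx hZ.le i j) hκ.le
      _ = κ * x ^ (2 * p) + κ * Z ^ (2 * p) := mul_add _ _ _
      _ ≤ κ₀ * x ^ (2 * p) + 1 * Z ^ (2 * p) := by gcongr
      _ = _ := by rw [one_mul]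
  have hZj : 0 < Z ^ j := by positivity
  have h2 := (mul_le_mul_of_nonneg_right h1 hU).trans h
  have h3 : x ^ i * U * (κ * Z ^ j) ≤ 2 * c * F := by linarith
  rw [← le_div_iff₀ (by positivity)] at h3
  refine h3.trans_eq ?_
  field_simp

/-- The exponents are p + 1 and p - 1: p powers of |ξ| come from b(ξ) and one from the weight left
by |k|. -/
lemma norm_freq_mul_bandLimited_le (hd : 1 ≤ d) (hα₀ : 0 ≤ α₀) (hα₁ : 0 ≤ α₁)
    (hb : SymbolBounds p b α₀ α₁) (hp : 1 ≤ p) {κ₀ : ℝ} (hκ : 0 < κ) (hκ0 : κ ≤ κ₀) (hκ1 : κ ≤ 1)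
    (hZ : 0 < Z) (hc : 0 ≤ c) (hu : ∀ᵐ η : Space d,
      (κ₀ * ‖freq η‖ ^ (2 * p) + Z ^ (2 * p)) * ‖(𝓕 u : L2 d n) η‖
        ≤ 2 * c * ‖(𝓕 f : L2 d n) η‖) :
    MemLp (fun η => ‖freq η‖ • bandLimited p b β ε u η) 2 volume ∧
      (eLpNorm (fun η => ‖freq η‖ • bandLimited p b β ε u η) 2 volume).toReal
        ≤ √α₁ * (2 / κ) * (c * (Z ^ (p - 1))⁻¹ * ‖f‖) := by
  have hm : AEStronglyMeasurable (fun η => ‖freq η‖ • bandLimited p b β ε u η) volume := by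
    have h1 := (continuous_freq_pow (d := d) 1).aestronglyMeasurable (μ := volume)
    simp only [pow_one] at h1
    exact h1.smul aestronglyMeasurable_bandLimited
  obtain ⟨h1, h2⟩ := toReal_eLpNorm_le (C := √α₁ * (2 * c / κ * (Z ^ (p - 1))⁻¹)) hm
    (Lp.memLp (𝓕 f : L2 d n)) (by positivity) (by
      filter_upwards [hu] with η hη
      have h3 := pow_mul_le_of_resolvent hκ hκ0 hκ1 (norm_nonneg (freq η)) hZ (norm_nonneg _) hη
        (show (p + 1) + (p - 1) = 2 * p by omega)
      have h4 := norm_bandLimited_le (β := β) (ε := ε) (u := u) hd hα₀ hα₁ hb η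
      rw [norm_freq_smul]
      calc ‖freq η‖ * ‖bandLimited p b β ε u η‖
          ≤ ‖freq η‖ * (√α₁ * (‖freq η‖ ^ p * ‖(𝓕 u : L2 d n) η‖)) := by gcongr
        _ = √α₁ * (‖freq η‖ ^ (p + 1) * ‖(𝓕 u : L2 d n) η‖) := by ring
        _ ≤ √α₁ * (2 * c / κ * (Z ^ (p - 1))⁻¹ * ‖(𝓕 f : L2 d n) η‖) := by gcongr
        _ = _ := by ring)
  refine ⟨h1, h2.trans_eq ?_⟩
  rw [← norm_eq_eLpNorm_fourier]
  ring

/-- Of the p powers of |ξ| in b(ξ), p - 1 are traded for (M/ε)^{p-1} in the zone, and the resolvent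
estimate is used with exponents 1 and 2p - 1. One of the p factors ε in front of the corrector thus
survives. -/
lemma norm_bandLimited_toReal_le (hd : 1 ≤ d) (hα₀ : 0 ≤ α₀) (hα₁ : 0 ≤ α₁)
    (hb : SymbolBounds p b α₀ α₁) (hp : 1 ≤ p) {κ₀ : ℝ} (hκ : 0 < κ) (hκ0 : κ ≤ κ₀) (hκ1 : κ ≤ 1)
    (hZ : 0 < Z) (hc : 0 ≤ c) (hr : LatticeBounds β r M) (hε : 0 < ε) (hu : ∀ᵐ η : Space d,
      (κ₀ * ‖freq η‖ ^ (2 * p) + Z ^ (2 * p)) * ‖(𝓕 u : L2 d n) η‖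
        ≤ 2 * c * ‖(𝓕 f : L2 d n) η‖) :
    ε ^ (p - 1) * (eLpNorm (bandLimited p b β ε u) 2 volume).toReal
      ≤ √α₁ * (2 / κ) * M ^ (p - 1) * (c * (Z ^ (2 * p - 1))⁻¹ * ‖f‖) := by
  have hM := hr.nonneg
  have hεp : 0 < ε ^ (p - 1) := by positivity
  obtain ⟨-, h2⟩ := toReal_eLpNorm_le
    (C := √α₁ * ((ε ^ (p - 1))⁻¹ * M ^ (p - 1) * (2 * c / κ * (Z ^ (2 * p - 1))⁻¹)))
    (aestronglyMeasurable_bandLimited (p := p) (b := b) (β := β) (ε := ε) (u := u))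
    (Lp.memLp (𝓕 f : L2 d n)) (by positivity) (by
      filter_upwards [hu] with η hη
      by_cases hz : η ∈ zone β ε
      · have h3 := pow_mul_le_of_resolvent hκ hκ0 hκ1 (norm_nonneg (freq η)) hZ (norm_nonneg _) hη
          (show 1 + (2 * p - 1) = 2 * p by omega)
        rw [pow_one] at h3
        have h4 := norm_bandLimited_le (β := β) (ε := ε) (u := u) hd hα₀ hα₁ hb η
        have h5 : ‖freq η‖ ^ (p - 1) ≤ (ε ^ (p - 1))⁻¹ * M ^ (p - 1) := by
          rw [← div_eq_inv_mul, le_div_iff₀ hεp, mul_comm, ← mul_pow, ← norm_smul_freq hε]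
          have := hr.zone _ hz
          gcongr
        calc ‖bandLimited p b β ε u η‖
            ≤ √α₁ * (‖freq η‖ ^ p * ‖(𝓕 u : L2 d n) η‖) := h4
          _ = √α₁ * (‖freq η‖ ^ (p - 1) * (‖freq η‖ * ‖(𝓕 u : L2 d n) η‖)) := by
              rw [← mul_assoc (‖freq η‖ ^ (p - 1)), ← pow_succ, Nat.sub_add_cancel hp]
          _ ≤ √α₁ * ((ε ^ (p - 1))⁻¹ * M ^ (p - 1)
              * (2 * c / κ * (Z ^ (2 * p - 1))⁻¹ * ‖(𝓕 f : L2 d n) η‖)) := by gcongr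
          _ = _ := by ring
      · rw [bandLimited_of_notMem hz, norm_zero]
        positivity)
  rw [← norm_eq_eLpNorm_fourier] at h2
  refine (mul_le_mul_of_nonneg_left h2 hεp.le).trans_eq ?_
  field_simp

/-- The smoothing error. -/
lemma norm_bD_sub_bandLimited_le (hd : 1 ≤ d) (hα₀ : 0 ≤ α₀) (hα₁ : 0 ≤ α₁)
    (hb : SymbolBounds p b α₀ α₁) (hp : 1 ≤ p) {κ₀ : ℝ} (hκ : 0 < κ) (hκ0 : κ ≤ κ₀) (hκ1 : κ ≤ 1)
    (hZ : 0 < Z) (hc : 0 ≤ c) (hr : LatticeBounds β r M) (hε : 0 < ε) (hu : ∀ᵐ η : Space d,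
      (κ₀ * ‖freq η‖ ^ (2 * p) + Z ^ (2 * p)) * ‖(𝓕 u : L2 d n) η‖
        ≤ 2 * c * ‖(𝓕 f : L2 d n) η‖) (hus : MemSobolev p u) {y : L2 d m}
    (hy : (𝓕 y : L2 d m) =ᵐ[volume] bandLimited p b β ε u) :
    ‖bD p b u - y‖ ≤ √α₁ * (2 / κ) / r * ε * (c * (Z ^ (p - 1))⁻¹ * ‖f‖) := by
  have hr0 := hr.pos
  obtain ⟨-, h2⟩ := toReal_eLpNorm_le (C := √α₁ * (ε / r * (2 * c / κ * (Z ^ (p - 1))⁻¹)))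
    (Lp.aestronglyMeasurable (𝓕 (bD p b u - y) : L2 d m))
    (Lp.memLp (𝓕 f : L2 d n)) (by positivity) (by
      filter_upwards [hu, coeFn_fourier_sub (bD p b u) y, coeFn_fourier_bD hd hα₀ hα₁ hb hus, hy]
        with η hη e1 e2 e3
      rw [e1, e2, e3, bandLimited]
      by_cases hz : η ∈ zone β ε
      · rw [Set.indicator_of_mem hz, sub_self, norm_zero]
        positivity
      · rw [Set.indicator_of_notMem hz, sub_zero]
        have h3 := pow_mul_le_of_resolvent hκ hκ0 hκ1 (norm_nonneg (freq η)) hZ (norm_nonneg _) hη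
          (show (p + 1) + (p - 1) = 2 * p by omega)
        have h4 := hr.le_norm_of_notMem hz
        rw [norm_smul_freq hε] at h4
        -- Outside the zone this factor can be inserted; it supplies the power of ε and one more
        -- power of |ξ|.
        have h5 : 1 ≤ ε / r * ‖freq η‖ := by
          rw [div_mul_eq_mul_div, le_div_iff₀ hr0, one_mul]
          exact h4
        calc _ ≤ √α₁ * (‖freq η‖ ^ p * ‖(𝓕 u : L2 d n) η‖) := (hb.norm_bounds hd hα₀ hα₁ _ _).2
          _ ≤ √α₁ * (‖freq η‖ ^ p * ‖(𝓕 u : L2 d n) η‖) * (ε / r * ‖freq η‖) :=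
              le_mul_of_one_le_right (by positivity) h5
          _ = √α₁ * (ε / r * (‖freq η‖ ^ (p + 1) * ‖(𝓕 u : L2 d n) η‖)) := by ring
          _ ≤ √α₁ * (ε / r * (2 * c / κ * (Z ^ (p - 1))⁻¹ * ‖(𝓕 f : L2 d n) η‖)) := by gcongr
          _ = _ := by ring)
  rw [← norm_eq_eLpNorm_fourier, ← norm_eq_eLpNorm_fourier] at h2
  exact h2.trans_eq (by ring)

end Effective

/-! ### The error estimate -/

/-- (Y + t)² ≤ 2(Y² + t²), and one factor Y + t is cancelled. -/
lemma add_le_of_sq_add_sq_le {κ B Y t : ℝ} (hκ : 0 < κ) (hB : 0 ≤ B) (hY : 0 ≤ Y) (ht : 0 ≤ t)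
    (h : κ * (Y ^ 2 + t ^ 2) ≤ B * (Y + t)) : Y + t ≤ 2 * B / κ := by
  rcases (add_nonneg hY ht).eq_or_lt with h0 | h0
  · rw [← h0]; positivity
  · rw [le_div_iff₀ hκ]
    refine le_of_mul_le_mul_right ?_ h0
    nlinarith [mul_nonneg hκ.le (sq_nonneg (Y - t))]

/-- Each bound involves only Y or only t; adding the missing nonnegative products makes the total a
multiple of Y + t. -/
lemma sum_le_residual {a₀ aR aD N s G G₀ r E Y t A₁ A₂ A₃ A₄ A₅ : ℝ} (ha₀ : 0 ≤ a₀)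
    (haR : 0 ≤ aR) (haD : 0 ≤ aD) (hN : 0 ≤ N) (hs : 0 ≤ s) (hG : 0 ≤ G)
    (hG₀ : 0 ≤ G₀) (hr : 0 < r) (hE : 0 ≤ E) (hY : 0 ≤ Y) (ht : 0 ≤ t)
    (h₁ : A₁ ≤ N * (a₀ * E) * t) (h₂ : A₂ ≤ s * Y * (G * (a₀ / r * E)))
    (h₃ : A₃ ≤ s * Y * (G₀ * (a₀ / r * E))) (h₄ : A₄ ≤ Y * (aD * (a₀ * E)))
    (h₅ : A₅ ≤ s * Y * (G * (aR * (a₀ * E)))) :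
    A₁ + A₂ + A₃ + A₄ + A₅
      ≤ a₀ * (s * ((G + G₀) / r + G * aR) + aD + N) * E * (Y + t) := by
  have h₆ : 0 ≤ a₀ * (N) * E * Y := by positivity
  have h₇ : 0 ≤ a₀ * (s * ((G + G₀) / r + G * aR) + aD) * E * t := by positivity
  calc A₁ + A₂ + A₃ + A₄ + A₅ ≤ N * (a₀ * E) * t + s * Y * (G * (a₀ / r * E))
        + s * Y * (G₀ * (a₀ / r * E)) + Y * (aD * (a₀ * E)) + s * Y * (G * (aR * (a₀ * E))) := by
        linarith
    _ ≤ N * (a₀ * E) * t + s * Y * (G * (a₀ / r * E))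
        + s * Y * (G₀ * (a₀ / r * E)) + Y * (aD * (a₀ * E)) + s * Y * (G * (aR * (a₀ * E)))
        + (a₀ * (N) * E * Y + a₀ * (s * ((G + G₀) / r + G * aR) + aD) * E * t) := by
        linarith
    _ = _ := by ring

/-- Since Z^{2p}/Z^{2p-1} = Z^p/Z^{p-1}, the factor |ζ| = Z^{2p} splits into the Z^p that
accompanies ‖w‖ in the energy and the common factor Z^{-(p-1)}; also ε^p = ε·ε^{p-1}. -/
lemma corrector_term_le {p : ℕ} {Z ε aK a M F W W' v x : ℝ} (hp : 1 ≤ p) (hZ : 0 < Z) (hε : 0 < ε)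
    (haK : 0 ≤ aK) (hW : 0 ≤ W) (hv : v ≤ aK * x)
    (hx : ε ^ (p - 1) * x ≤ a * M ^ (p - 1) * (F * (Z ^ (2 * p - 1))⁻¹ * W')) :
    Z ^ (2 * p) * ε ^ p * (W * v)
      ≤ aK * M ^ (p - 1) * (a * (ε * (F * (Z ^ (p - 1))⁻¹ * W'))) * (Z ^ p * W) := by
  have hZpow : Z ^ (2 * p) * (Z ^ (2 * p - 1))⁻¹ = Z ^ p * (Z ^ (p - 1))⁻¹ := by
    have e1 : Z ^ (2 * p) = Z ^ (2 * p - 1) * Z := by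
      rw [← pow_succ]; congr 1; omega
    have e2 : Z ^ p = Z ^ (p - 1) * Z := by
      rw [← pow_succ]; congr 1; omega
    rw [e1, e2]
    field_simp
  have hεp : ε ^ p = ε * ε ^ (p - 1) := by rw [← pow_succ']; congr 1; omega
  have h2 : ε ^ p * v ≤ aK * (ε * (a * M ^ (p - 1) * (F * (Z ^ (2 * p - 1))⁻¹ * W'))) := by
    calc ε ^ p * v ≤ ε ^ p * (aK * x) := by gcongr
      _ = aK * (ε * (ε ^ (p - 1) * x)) := by rw [hεp]; ring
      _ ≤ _ := by gcongr
  calc Z ^ (2 * p) * ε ^ p * (W * v) = Z ^ (2 * p) * W * (ε ^ p * v) := by ring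
    _ ≤ Z ^ (2 * p) * W * (aK * (ε * (a * M ^ (p - 1) * (F * (Z ^ (2 * p - 1))⁻¹ * W')))) := by
        gcongr
    _ = aK * M ^ (p - 1) * a * (ε * (F * W')) * W
        * (Z ^ (2 * p) * (Z ^ (2 * p - 1))⁻¹) := by ring
    _ = _ := by rw [hZpow]; ring

/-- The constant in the estimate of the remainder in `b(D)` of the corrector. -/
def remConst (d m p : ℕ) (α₀ α₁ G K r M : ℝ) : ℝ :=
  diffConst d p α₁ / (2 * r) * (1 + M / (2 * r)) ^ p * ((√α₀)⁻¹ * (√m * (G * K)))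

/-- The constant in the estimate of the difference of the fluxes. -/
def cellFluxConst (d m p : ℕ) (α₁ G K r : ℝ) : ℝ :=
  diffConst d p α₁ / (2 * r) * 2 ^ p * (√m * (G ^ 2 * K))

/-- The constant in the estimate of the norm of the corrector. -/
def corConst (m p : ℕ) (α₀ G K r : ℝ) : ℝ :=
  ((2 * r) ^ p)⁻¹ * ((√α₀)⁻¹ * (√m * (G * K)))

/-- The constant in the estimates of the effective resolvent. -/
def effConst (α₀ α₁ K : ℝ) : ℝ := √α₁ * (2 / min (α₀ / K) 1)

/-- The constant in the estimate of the residual. -/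
def resConst (d m p : ℕ) (α₀ α₁ G K r M : ℝ) : ℝ :=
  effConst α₀ α₁ K * (√α₁ * ((G + G ^ 2 * K) / r + G * remConst d m p α₀ α₁ G K r M)
    + cellFluxConst d m p α₁ G K r + corConst m p α₀ G K r * M ^ (p - 1))

/-- The constant in the error estimate in the energy norm. -/
def energyConst (d m p : ℕ) (α₀ α₁ G K r M : ℝ) : ℝ :=
  4 * resConst d m p α₀ α₁ G K r M / min (α₀ / K) 1

/-- The constant in the error estimate for the flux. -/
def fluxConst (d m p : ℕ) (α₀ α₁ G K r M : ℝ) : ℝ :=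
  G * (√α₁ * energyConst d m p α₀ α₁ G K r M
    + effConst α₀ α₁ K / r + remConst d m p α₀ α₁ G K r M * effConst α₀ α₁ K)

section Main

variable {d m n p : ℕ} {b : (Fin d → ℕ) → Matrix (Fin m) (Fin n) ℂ} {α₀ α₁ : ℝ}
  {g : Space d → Matrix (Fin m) (Fin m) ℂ} {G K : ℝ} {β : Module.Basis (Fin d) ℝ (Space d)}
  {Λ : Space d → Matrix (Fin n) (Fin m) ℂ} {ε r M : ℝ} {φ Z : ℝ} {ζ : ℂ}
  {Rε R₀ : L2 d n →L[ℂ] L2 d n}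

/-- The equation for the error. -/
lemma form_sub_eq (hd : 1 ≤ d) (hα₀ : 0 ≤ α₀) (hα₁ : 0 ≤ α₁) (hb : SymbolBounds p b α₀ α₁)
    {gε : Space d → Matrix (Fin m) (Fin m) ℂ} {A : Matrix (Fin m) (Fin m) ℂ} {G₀ K₀ : ℝ}
    (hg : IsElliptic gε G K) (hA : IsElliptic (fun _ : Space d => A) G₀ K₀) {f uε u₀ V : L2 d n}
    (hε : OperatorGraph p b gε uε (f + ζ • uε)) (h₀ : OperatorGraph p b (fun _ => A) u₀ (f + ζ • u₀))
    (hV : MemSobolev p V) (c : ℂ) {y P T : L2 d m} (hT : T = hg.isBddMatrix.mulL (P + y))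
    {w : L2 d n} (hw : w = uε - u₀ - c • V) :
    form p b gε w w - ζ * ⟪w, w⟫_ℂ
      = ζ * c * ⟪w, V⟫_ℂ - ⟪bD p b w, hg.isBddMatrix.mulL (bD p b u₀ - y)⟫_ℂ
        + ⟪bD p b w, hA.isBddMatrix.mulL (bD p b u₀ - y)⟫_ℂ
        - ⟪bD p b w, T - hA.isBddMatrix.mulL y⟫_ℂ
        - ⟪bD p b w, hg.isBddMatrix.mulL (c • bD p b V - P)⟫_ℂ := by
  have hws : MemSobolev p w := by rw [hw]; exact (hε.1.sub h₀.1).sub (hV.smul c)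
  have e1 := hε.2 w hws
  have e2 := h₀.2 w hws
  rw [form_eq_inner hg, inner_add_right, inner_smul_right] at e1
  rw [form_eq_inner hA, inner_add_right, inner_smul_right] at e2
  have e3 : bD p b w = bD p b uε - bD p b u₀ - c • bD p b V := by
    rw [hw, bD_sub hd hα₀ hα₁ hb (hε.1.sub h₀.1) (hV.smul c), bD_sub hd hα₀ hα₁ hb hε.1 h₀.1,
      bD_smul hd hα₀ hα₁ hb hV]
  have e4 : ⟪w, w⟫_ℂ = ⟪w, uε⟫_ℂ - ⟪w, u₀⟫_ℂ - c * ⟪w, V⟫_ℂ := by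
    conv_lhs => rw [show ⟪w, w⟫_ℂ = ⟪w, uε - u₀ - c • V⟫_ℂ by rw [← hw]]
    rw [inner_sub_right, inner_sub_right, inner_smul_right]
  have e5 : form p b gε w w = ⟪bD p b w, hg.isBddMatrix.mulL (bD p b uε)⟫_ℂ
      - ⟪bD p b w, hg.isBddMatrix.mulL (bD p b u₀)⟫_ℂ
      - ⟪bD p b w, hg.isBddMatrix.mulL (c • bD p b V)⟫_ℂ := by
    rw [form_eq_inner hg, ← inner_sub_right, ← inner_sub_right, ← map_sub, ← map_sub, ← e3]
  rw [e5, e4, hT]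
  simp only [map_sub, map_add, inner_sub_right, inner_add_right]
  -- The two weak equations tested with w; the right-hand side f drops out of the difference.
  linear_combination e1 - e2

/-- The energy estimate for the error, in terms of the bounds of the residual. -/
lemma energy_le (hd : 1 ≤ d) (hα₀ : 0 < α₀) (hα₁ : 0 ≤ α₁) (hb : SymbolBounds p b α₀ α₁)
    {gε : Space d → Matrix (Fin m) (Fin m) ℂ} {A : Matrix (Fin m) (Fin m) ℂ} {G₀ K₀ : ℝ}
    (hg : IsElliptic gε G K) (hA : IsElliptic (fun _ : Space d => A) G₀ K₀) (hG : 0 ≤ G)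
    (hG₀ : 0 ≤ G₀) (hK : 0 < K) (hφ : φ ∈ Set.Ioo 0 (2 * Real.pi))
    (hζ : ζ = ‖ζ‖ * Complex.exp (φ * Complex.I)) (hZ : 0 < Z) (hZζ : Z ^ (2 * p) = ‖ζ‖)
    {f uε u₀ V : L2 d n}
    (hε : OperatorGraph p b gε uε (f + ζ • uε)) (h₀ : OperatorGraph p b (fun _ => A) u₀ (f + ζ • u₀))
    (hV : MemSobolev p V) (c : ℂ) {y P T : L2 d m} (hT : T = hg.isBddMatrix.mulL (P + y))
    {w : L2 d n} (hw : w = uε - u₀ - c • V) {a₀ aR aD N E : ℝ} (ha₀ : 0 ≤ a₀) (haR : 0 ≤ aR)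
    (haD : 0 ≤ aD) (hN : 0 ≤ N) (hr : 0 < r) (hE : 0 ≤ E)
    (hS : ‖bD p b u₀ - y‖ ≤ a₀ / r * E) (hRem : ‖c • bD p b V - P‖ ≤ aR * (a₀ * E))
    (hFlux : ‖⟪bD p b w, T - hA.isBddMatrix.mulL y⟫_ℂ‖ ≤ dNorm p w * (aD * (a₀ * E)))
    (hcor : ‖ζ * c * ⟪w, V⟫_ℂ‖ ≤ N * (a₀ * E) * (Z ^ p * ‖w‖)) :
    dNorm p w + Z ^ p * ‖w‖ ≤ 2 * (2 * cAngle φ *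
      (a₀ * (√α₁ * ((G + G₀) / r + G * aR) + aD + N) * E)) / min (α₀ / K) 1 := by
  have hws : MemSobolev p w := by rw [hw]; exact (hε.1.sub h₀.1).sub (hV.smul c)
  have hid := form_sub_eq hd hα₀.le hα₁ hb hg hA hε h₀ hV c hT hw
  have hbw := (norm_bD_le hd hα₀.le hα₁ hb hws).2
  have hκ : 0 < min (α₀ / K) 1 := lt_min (by positivity) one_pos
  have hc1 : 1 ≤ cAngle φ := one_le_cAngle
  have hinner : ∀ {C : ℝ} (z : L2 d m), ‖z‖ ≤ C → ‖⟪bD p b w, z⟫_ℂ‖ ≤ √α₁ * dNorm p w * C :=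
    fun z hz => (norm_inner_le_norm _ _).trans
      (mul_le_mul hbw hz (norm_nonneg _) (mul_nonneg (Real.sqrt_nonneg _) (dNorm_nonneg p w)))
  have i1 := hinner (hg.isBddMatrix.mulL (bD p b u₀ - y))
    ((hg.isBddMatrix.norm_mulL_le _).trans (mul_le_mul_of_nonneg_left hS hG))
  have i2 := hinner (hA.isBddMatrix.mulL (bD p b u₀ - y))
    ((hA.isBddMatrix.norm_mulL_le _).trans (mul_le_mul_of_nonneg_left hS hG₀))
  have i3 := hinner (hg.isBddMatrix.mulL (c • bD p b V - P))
    ((hg.isBddMatrix.norm_mulL_le _).trans (mul_le_mul_of_nonneg_left hRem hG))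
  have hco := form_coercive hd hα₀.le hα₁ hb hg hK hφ hζ hws
  have hsplit : ∀ A₁ A₂ A₃ A₄ A₅ : ℂ, ‖A₁ - A₂ + A₃ - A₄ - A₅‖
      ≤ ‖A₁‖ + ‖A₂‖ + ‖A₃‖ + ‖A₄‖ + ‖A₅‖ := fun A₁ A₂ A₃ A₄ A₅ => by
    refine (norm_sub_le _ _).trans (add_le_add_left ?_ _)
    refine (norm_sub_le _ _).trans (add_le_add_left ?_ _)
    refine (norm_add_le _ _).trans (add_le_add_left ?_ _)
    exact norm_sub_le _ _
  have hY := dNorm_nonneg p w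
  have ht : 0 ≤ Z ^ p * ‖w‖ := by positivity
  have hres : ‖form p b gε w w - ζ * ⟪w, w⟫_ℂ‖
      ≤ a₀ * (√α₁ * ((G + G₀) / r + G * aR) + aD + N) * E * (dNorm p w + Z ^ p * ‖w‖) := by
    rw [hid]
    exact (hsplit _ _ _ _ _).trans (sum_le_residual ha₀ haR haD hN
      (Real.sqrt_nonneg α₁) hG hG₀ hr hE hY ht hcor i1 i2 hFlux i3)
  -- In the variable t = Z^p‖w‖ the L₂ part of the coercive bound is t², on the same footing as the
  -- square of the seminorm.
  have hsq : ‖ζ‖ * ‖w‖ ^ 2 = (Z ^ p * ‖w‖) ^ 2 := by rw [← hZζ]; ring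
  rw [hsq] at hco
  have hB : 0 ≤ a₀ * (√α₁ * ((G + G₀) / r + G * aR) + aD + N) * E := by positivity
  generalize a₀ * (√α₁ * ((G + G₀) / r + G * aR) + aD + N) * E = B at hB hres ⊢
  generalize Z ^ p * ‖w‖ = t at ht hres hco ⊢
  generalize dNorm p w = Y at hY hres hco ⊢
  refine add_le_of_sq_add_sq_le hκ (by positivity) hY ht ?_
  calc _ = min (α₀ / K) 1 * Y ^ 2 + min (α₀ / K) 1 * t ^ 2 := mul_add _ _ _
    _ ≤ α₀ / K * Y ^ 2 + 1 * t ^ 2 := by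
        gcongr
        · exact min_le_left _ _
        · exact min_le_right _ _
    _ = α₀ / K * Y ^ 2 + t ^ 2 := by rw [one_mul]
    _ ≤ 2 * cAngle φ * (B * (Y + t)) := hco.trans (by gcongr)
    _ = _ := by ring

set_option maxHeartbeats 1000000 in
/-- The error estimates in the energy norm and for the flux. -/
theorem error_estimate (hd : 1 ≤ d) (hp : 1 ≤ p) (hα₀ : 0 < α₀) (hα₁ : 0 ≤ α₁)
    (hb : SymbolBounds p b α₀ α₁) (hg : IsElliptic g G K) (hper : IsPeriodic β g) (hG : 0 ≤ G)
    (hK : 0 < K) (hΛ : IsCellSolution β p b g Λ) (hr : LatticeBounds β r M) (hε : 0 < ε)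
    (hφ : φ ∈ Set.Ioo 0 (2 * Real.pi)) (hζ : ζ = ‖ζ‖ * Complex.exp (φ * Complex.I)) (hζ0 : ζ ≠ 0)
    (hRε : IsResolvent p b (rescale ε g) ζ Rε)
    (hR₀ : IsResolvent p b (fun _ => gEff β p b g Λ) ζ R₀) (hZ : 0 < Z)
    (hZζ : Z ^ (2 * p) = ‖ζ‖) (f : L2 d n) :
    (∃ hV : MemLp (corrector β p b Λ ε R₀ f) 2 volume, MemSobolev p (hV.toLp _) ∧
      MemSobolev p (Rε f - R₀ f - ((ε : ℂ) ^ p) • hV.toLp _) ∧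
      dNorm p (Rε f - R₀ f - ((ε : ℂ) ^ p) • hV.toLp _)
        + Z ^ p * ‖Rε f - R₀ f - ((ε : ℂ) ^ p) • hV.toLp _‖
          ≤ energyConst d m p α₀ α₁ G K r M * (ε * cAngle φ ^ 2 * (Z ^ (p - 1))⁻¹ * ‖f‖)) ∧
    MemLp (fluxError β p b g Λ ε Rε R₀ f) 2 volume ∧
      eLpNorm (fluxError β p b g Λ ε Rε R₀ f) 2 volume ≤ ENNReal.ofReal
        (fluxConst d m p α₀ α₁ G K r M * (ε * cAngle φ ^ 2 * (Z ^ (p - 1))⁻¹ * ‖f‖)) := by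
  have hr0 := hr.pos
  have hM0 := hr.nonneg
  have hdc := diffConst_nonneg d p α₁
  have hc1 : 1 ≤ cAngle φ := one_le_cAngle
  set c := cAngle φ with hcdef
  have hc0 : 0 ≤ c := zero_le_one.trans hc1
  have hA := hΛ.isElliptic_gEff hg hK.le
  have hgε := hg.rescale hε
  set κ := min (α₀ / K) 1 with hκdef
  have hκ : 0 < κ := lt_min (by positivity) one_pos
  have hu₀ : OperatorGraph p b (fun _ => gEff β p b g Λ) (R₀ f) (f + ζ • R₀ f) := (hR₀ f _).mp rfl
  have huε : OperatorGraph p b (rescale ε g) (Rε f) (f + ζ • Rε f) := (hRε f _).mp rfl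
  have hus : MemSobolev p (R₀ (smoothing β ε f)) := ((hR₀ _ _).mp rfl).1
  have hpt := resolvent_pointwise hd hα₀.le hα₁ hb hA hK hφ hζ hR₀ f
  rw [← hZζ] at hpt
  set y := bD p b (R₀ (smoothing β ε f)) with hydef
  set h := bandLimited p b β ε (R₀ f) with hhdef
  have hh : ∀ η ∉ zone β ε, h η = 0 := fun η hη => bandLimited_of_notMem hη
  have hy : (𝓕 y : L2 d m) =ᵐ[volume] h := by
    filter_upwards [coeFn_fourier_bD hd hα₀.le hα₁ hb hus,
      coeFn_fourier_resolvent_smoothing (β := β) (ε := ε) hd hα₀.le hα₁ hb hA hK hφ hζ hζ0 hR₀ f]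
      with η e1 e2
    rw [e1, e2, hhdef, bandLimited]
    by_cases hz : η ∈ zone β ε
    · rw [Set.indicator_of_mem hz, Set.indicator_of_mem hz]
    · rw [Set.indicator_of_notMem hz, Set.indicator_of_notMem hz, app_zero]
  have hL : MemLp h 2 volume := (Lp.memLp (𝓕 y : L2 d m)).ae_eq hy
  obtain ⟨hHL, hX⟩ := norm_freq_mul_bandLimited_le (β := β) (ε := ε) hd hα₀.le hα₁ hb hp hκ
    (min_le_left _ _) (min_le_right _ _) hZ hc0 hpt
  have hXh := norm_bandLimited_toReal_le hd hα₀.le hα₁ hb hp hκ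
    (min_le_left _ _) (min_le_right _ _) hZ hc0 hr hε hpt
  have hS := norm_bD_sub_bandLimited_le hd hα₀.le hα₁ hb hp hκ
    (min_le_left _ _) (min_le_right _ _) hZ hc0 hr hε hpt hu₀.1 hy
  obtain ⟨hVL, hVF⟩ := hΛ.exists_corrector hd hα₀ hα₁ hb hg hK.le hr hε hh hy
  obtain ⟨hPL, hPF⟩ := exists_fourier_mul_rescale hε hΛ.memLp_cellBD hΛ.isPeriodic_cellBD
    (hΛ.summable_cellBD hg hK.le).1 (disjointShifts_zone hε.ne') hh hy
  obtain ⟨hTL, hTF⟩ := exists_fourier_mul_rescale hε (hΛ.memLp_gTilde hg)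
    (hΛ.isPeriodic_gTilde hper) (hΛ.summable_gTilde hg hK.le).1 (disjointShifts_zone hε.ne') hh hy
  set V : L2 d n := hVL.toLp _ with hVdef
  set P : L2 d m := hPL.toLp _ with hPdef
  set T : L2 d m := hTL.toLp _ with hTdef
  have hVs : MemSobolev p V := hΛ.memSobolev_corrector hd hα₀ hα₁ hb hg hG hK.le hr hε hL hh hVF
  have hVn := hΛ.norm_corrector_le hd hα₀ hα₁ hb hg hG hK.le hr hε hL hh hVF
  have hRem := hΛ.norm_bD_corrector_sub_le hd hα₀ hα₁ hb hg hG hK.le hr hε hHL hh hVF hVs hPF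
  have hT₀ : (𝓕 (hA.isBddMatrix.mulL y) : L2 d m)
      =ᵐ[volume] fun η => app (gEff β p b g Λ) (h η) := by
    filter_upwards [coeFn_fourier_mulL_const hA.isBddMatrix y, hy] with η e1 e2
    rw [e1, e2]
  -- This is g̃ = g(b(D)Λ + 1) at x/ε, applied to y(x).
  have hTP : T = hgε.isBddMatrix.mulL (P + y) := by
    refine Lp.ext ?_
    filter_upwards [hTL.coeFn_toLp, hgε.isBddMatrix.coeFn_mulL (P + y), Lp.coeFn_add P y,
      hPL.coeFn_toLp] with x e1 e2 e3 e4
    rw [hTdef, e1, e2, e3, Pi.add_apply, hPdef, e4]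
    exact app_gTilde (ε⁻¹ • x) (y x)
  set w := Rε f - R₀ f - ((ε : ℂ) ^ p) • V with hwdef
  have hws : MemSobolev p w := (huε.1.sub hu₀.1).sub (hVs.smul _)
  have hFlux := hΛ.norm_inner_flux_sub_le hd hα₀ hα₁ hb hg hK.le hr hε hHL hh hTF hT₀ hws
  have hbw := (norm_bD_le hd hα₀.le hα₁ hb hws).2
  -- The common small quantity. Its factor c(φ) comes from the effective resolvent; the second one
  -- enters with the coercivity for w.
  have hE : ∃ E, E = ε * (c * (Z ^ (p - 1))⁻¹ * ‖f‖) := ⟨_, rfl⟩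
  obtain ⟨E, hE⟩ := hE
  have hE0 : 0 ≤ E := by rw [hE]; positivity
  have ha₀0 : 0 ≤ effConst α₀ α₁ K := by rw [effConst]; positivity
  have haR0 : 0 ≤ remConst d m p α₀ α₁ G K r M := by rw [remConst]; positivity
  have haD0 : 0 ≤ cellFluxConst d m p α₁ G K r := by rw [cellFluxConst]; positivity
  have haK0 : 0 ≤ corConst m p α₀ G K r := by rw [corConst]; positivity
  have hG₀ : 0 ≤ G ^ 2 * K := by positivity
  have hεX : ε * (eLpNorm (fun η => ‖freq η‖ • h η) 2 volume).toReal
      ≤ effConst α₀ α₁ K * E := by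
    refine (mul_le_mul_of_nonneg_left hX hε.le).trans_eq ?_
    rw [effConst, hE]; ring
  have hS' : ‖bD p b (R₀ f) - y‖ ≤ effConst α₀ α₁ K / r * E := by
    refine hS.trans_eq ?_
    rw [effConst, hE]; ring
  have hRem' : ‖(ε : ℂ) ^ p • bD p b V - P‖
      ≤ remConst d m p α₀ α₁ G K r M * (effConst α₀ α₁ K * E) :=
    (hRem.trans_eq (by rw [remConst]; ring)).trans (mul_le_mul_of_nonneg_left hεX haR0)
  have hFlux' : ‖⟪bD p b w, T - hA.isBddMatrix.mulL y⟫_ℂ‖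
      ≤ dNorm p w * (cellFluxConst d m p α₁ G K r * (effConst α₀ α₁ K * E)) :=
    (hFlux.trans_eq (by rw [cellFluxConst]; ring)).trans (mul_le_mul_of_nonneg_left
      (mul_le_mul_of_nonneg_left hεX haD0) (dNorm_nonneg p w))
  have hV' : ‖ζ * (ε : ℂ) ^ p * ⟪w, V⟫_ℂ‖ ≤ corConst m p α₀ G K r * M ^ (p - 1)
      * (effConst α₀ α₁ K * E) * (Z ^ p * ‖w‖) := by
    have e1 : ‖ζ * (ε : ℂ) ^ p * ⟪w, V⟫_ℂ‖ ≤ Z ^ (2 * p) * ε ^ p * (‖w‖ * ‖V‖) := by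
      rw [norm_mul, norm_mul, norm_pow, Complex.norm_real, Real.norm_of_nonneg hε.le, hZζ]
      exact mul_le_mul_of_nonneg_left (norm_inner_le_norm _ _) (by positivity)
    refine e1.trans ?_
    rw [hE]
    refine (corrector_term_le hp hZ hε haK0 (norm_nonneg w) hVn hXh).trans_eq ?_
    rw [effConst]
  have hYt := energy_le hd hα₀ hα₁ hb hgε hA hG hG₀ hK hφ hζ hZ hZζ huε hu₀ hVs ((ε : ℂ) ^ p) hTP
    hwdef ha₀0 haR0 haD0 (by positivity) hr0 hE0 hS' hRem' hFlux' hV'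
  have hcE : c * E = ε * c ^ 2 * (Z ^ (p - 1))⁻¹ * ‖f‖ := by rw [hE]; ring
  have hYt' : dNorm p w + Z ^ p * ‖w‖ ≤ energyConst d m p α₀ α₁ G K r M * (c * E) := by
    refine hYt.trans_eq ?_
    rw [energyConst, resConst]
    ring
  refine ⟨⟨hVL, hVs, hws, by rw [← hcE]; exact hYt'⟩, ?_⟩
  -- The flux error is g^ε applied to b(D)w plus the smoothing error plus the Leibniz remainder, all
  -- three already estimated.
  have hΦ' : hgε.isBddMatrix.mulL
      (bD p b w + (bD p b (R₀ f) - y) + ((ε : ℂ) ^ p • bD p b V - P))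
      = hgε.isBddMatrix.mulL (bD p b (Rε f)) - T := by
    rw [hTP, ← map_sub]
    congr 1
    rw [hwdef, bD_sub hd hα₀.le hα₁ hb (huε.1.sub hu₀.1) (hVs.smul _),
      bD_sub hd hα₀.le hα₁ hb huε.1 hu₀.1, bD_smul hd hα₀.le hα₁ hb hVs]
    abel
  have hfl : (fluxError β p b g Λ ε Rε R₀ f) =ᵐ[volume] (hgε.isBddMatrix.mulL
      (bD p b w + (bD p b (R₀ f) - y) + ((ε : ℂ) ^ p • bD p b V - P)) : L2 d m) := by
    rw [hΦ']
    filter_upwards [Lp.coeFn_sub (hgε.isBddMatrix.mulL (bD p b (Rε f))) T,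
      hgε.isBddMatrix.coeFn_mulL (bD p b (Rε f)), hTL.coeFn_toLp] with x e1 e2 e3
    rw [e1, Pi.sub_apply, e2, hTdef, e3]
    rfl
  refine ⟨(Lp.memLp _).ae_eq hfl.symm, ?_⟩
  rw [eLpNorm_congr_ae hfl, ← Lp.enorm_def, ← ofReal_norm, ← hcE]
  refine ENNReal.ofReal_le_ofReal ((hgε.isBddMatrix.norm_mulL_le _).trans ?_)
  -- The smoothing error and the Leibniz remainder carry only one factor c(φ); as c(φ) ≥ 1, a second
  -- may be added.
  have hEc : E ≤ c * E := le_mul_of_one_le_left hE0 hc1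
  rw [fluxConst, mul_assoc]
  refine mul_le_mul_of_nonneg_left (norm_add₃_le.trans ?_) hG
  have j1 : ‖bD p b w‖ ≤ √α₁ * (energyConst d m p α₀ α₁ G K r M * (c * E)) :=
    hbw.trans (mul_le_mul_of_nonneg_left ((le_add_of_nonneg_right (by positivity)).trans hYt')
      (Real.sqrt_nonneg _))
  have j2 := hS'.trans (mul_le_mul_of_nonneg_left hEc (div_nonneg ha₀0 hr0.le))
  have j3 := hRem'.trans (mul_le_mul_of_nonneg_left (mul_le_mul_of_nonneg_left hEc ha₀0) haR0)
  refine (add_le_add (add_le_add j1 j2) j3).trans_eq ?_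
  ring

end Main

end HighOrderHomog

end

/-! ### Assembly: choice of constants and powers of |ζ|. -/

theorem theorem8p2 (d m p : ℕ) (hd : 1 ≤ d) (hp : 2 ≤ p)
    (α₀ α₁ G G' : ℝ) (hα₀ : 0 < α₀) (hα₁ : α₀ ≤ α₁)
    (β : Module.Basis (Fin d) ℝ (Space d)) :
    ∃ C' C'' C₄ : ℝ, ∀ n : ℕ, n ≤ m →
      ∀ b : (Fin d → ℕ) → Matrix (Fin m) (Fin n) ℂ, SymbolBounds p b α₀ α₁ →
      ∀ g : Space d → Matrix (Fin m) (Fin m) ℂ, IsCoefficient β g G G' →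
        (∃ Λ : Space d → Matrix (Fin n) (Fin m) ℂ, IsCellSolution β p b g Λ) ∧
        ∀ Λ : Space d → Matrix (Fin n) (Fin m) ℂ, IsCellSolution β p b g Λ →
        ∀ ε : ℝ, 0 < ε → ∀ (ζ : ℂ) (φ : ℝ), ζ ≠ 0 → φ ∈ Set.Ioo 0 (2 * Real.pi) →
          ζ = ‖ζ‖ * Complex.exp (φ * Complex.I) →
          ∃ Rε R₀ : L2 d n →L[ℂ] L2 d n,
            IsResolvent p b (rescale ε g) ζ Rε ∧
            IsResolvent p b (fun _ => gEff β p b g Λ) ζ R₀ ∧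
            ∀ f : L2 d n,
              (∃ hK : MemLp (corrector β p b Λ ε R₀ f) 2 volume,
                MemSobolev p (hK.toLp _) ∧
                sobolevNorm p (Rε f - R₀ f - ((ε : ℂ) ^ p) • hK.toLp _) ≤
                  ENNReal.ofReal (ε * cAngle φ ^ 2 * ‖ζ‖ ^ (1 / (2 * (p : ℝ))) *
                    (C' * ‖ζ‖⁻¹ + C'' * ‖ζ‖ ^ (-(1 / 2) : ℝ)) * ‖f‖)) ∧
              (MemLp (fluxError β p b g Λ ε Rε R₀ f) 2 volume ∧
                eLpNorm (fluxError β p b g Λ ε Rε R₀ f) 2 volume ≤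
                  ENNReal.ofReal (ε * cAngle φ ^ 2 * C₄ *
                    ‖ζ‖ ^ (1 / (2 * (p : ℝ)) - 1 / 2) * ‖f‖)) := by
  have hα₁' : 0 ≤ α₁ := hα₀.le.trans hα₁
  have hp1 : 1 ≤ p := by omega
  obtain ⟨r, M, hr⟩ := exists_latticeBounds β
  -- The constants are fixed before g, when G and G' are arbitrary reals; the maximum with 1
  -- supplies the signs that the estimates need.
  have hG₁ : (0 : ℝ) ≤ max G 1 := zero_le_one.trans (le_max_right _ _)
  have hK : (0 : ℝ) < max G' 1 := zero_lt_one.trans_le (le_max_right _ _)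
  refine ⟨√(2 ^ p) * energyConst d m p α₀ α₁ (max G 1) (max G' 1) r M,
    √(2 ^ p) * energyConst d m p α₀ α₁ (max G 1) (max G' 1) r M,
    fluxConst d m p α₀ α₁ (max G 1) (max G' 1) r M, fun n _ b hb g hg => ?_⟩
  have hge := hg.isElliptic (le_max_left G 1) (le_max_left G' 1) hK
  refine ⟨exists_isCellSolution hd (by omega) hα₀ hα₁' hb hge hK β,
    fun Λ hΛ ε hε ζ φ hζ0 hφ hζ => ?_⟩
  obtain ⟨Rε, hRε⟩ := exists_isResolvent hd hα₀ hα₁' hb (hge.rescale hε) hK hφ hζ0 hζ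
  obtain ⟨R₀, hR₀⟩ := exists_isResolvent hd hα₀ hα₁' hb (hΛ.isElliptic_gEff hge hK.le) hK hφ hζ0 hζ
  refine ⟨Rε, R₀, hRε, hR₀, fun f => ?_⟩
  have hζpos : 0 < ‖ζ‖ := norm_pos_iff.mpr hζ0
  have hZ : 0 < ‖ζ‖ ^ (1 / (2 * (p : ℝ))) := Real.rpow_pos_of_pos hζpos _
  have hp0 : (p : ℝ) ≠ 0 := by positivity
  have hZp : (‖ζ‖ ^ (1 / (2 * (p : ℝ)))) ^ p = ‖ζ‖ ^ (1 / 2 : ℝ) := by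
    rw [← Real.rpow_natCast, ← Real.rpow_mul hζpos.le]
    congr 1
    field_simp
  have hZζ : (‖ζ‖ ^ (1 / (2 * (p : ℝ)))) ^ (2 * p) = ‖ζ‖ := by
    rw [← Real.rpow_natCast, ← Real.rpow_mul hζpos.le]
    push_cast
    rw [one_div_mul_cancel (by positivity), Real.rpow_one]
  -- Z^{-(p-1)} = Z·Z^{-p} with Z^p = |ζ|^{1/2}.
  have hZinv : ((‖ζ‖ ^ (1 / (2 * (p : ℝ)))) ^ (p - 1))⁻¹
      = ‖ζ‖ ^ (1 / (2 * (p : ℝ))) * ‖ζ‖ ^ (-(1 / 2) : ℝ) := by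
    rw [Real.rpow_neg hζpos.le, ← hZp, ← pow_sub_one_mul (by omega : p ≠ 0)]
    field_simp
  obtain ⟨⟨hV, hVs, hws, hest⟩, hfl, hflest⟩ := error_estimate hd hp1 hα₀ hα₁' hb hge hg.periodic
    hG₁ hK hΛ hr hε hφ hζ hζ0 hRε hR₀ hZ hZζ f
  refine ⟨⟨hV, hVs, (memSobolev_of_memLp hws.memLp).2.trans (ENNReal.ofReal_le_ofReal ?_)⟩,
    hfl, hflest.trans_eq ?_⟩
  · rw [hZp, hZinv] at hest
    have hY := dNorm_nonneg p (Rε f - R₀ f - ((ε : ℂ) ^ p) • hV.toLp _)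
    generalize energyConst d m p α₀ α₁ (max G 1) (max G' 1) r M = C at hest ⊢
    generalize dNorm p (Rε f - R₀ f - ((ε : ℂ) ^ p) • hV.toLp _) = Y at hest hY ⊢
    have hW := norm_nonneg (Rε f - R₀ f - ((ε : ℂ) ^ p) • hV.toLp _)
    generalize ‖Rε f - R₀ f - ((ε : ℂ) ^ p) • hV.toLp _‖ = W at hest hW ⊢
    have hs : 0 < ‖ζ‖ ^ (1 / 2 : ℝ) := Real.rpow_pos_of_pos hζpos _
    have hinv : ‖ζ‖⁻¹ = (‖ζ‖ ^ (1 / 2 : ℝ))⁻¹ * (‖ζ‖ ^ (1 / 2 : ℝ))⁻¹ := by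
      rw [← mul_inv, ← Real.rpow_add hζpos]
      norm_num
    rw [Real.rpow_neg hζpos.le] at hest ⊢
    rw [hinv]
    generalize ‖ζ‖ ^ (1 / 2 : ℝ) = s at hest hs ⊢
    generalize ‖ζ‖ ^ (1 / (2 * (p : ℝ))) = z at hest ⊢
    -- The seminorm gives the term with |ζ|^{-1/2}. The L₂ norm enters the energy bound with the
    -- factor |ζ|^{1/2}, and dividing by it gives the term with |ζ|^{-1}; hence the two constants
    -- coincide.
    have h1 : Y ≤ C * (ε * cAngle φ ^ 2 * (z * s⁻¹) * ‖f‖) :=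
      (le_add_of_nonneg_right (mul_nonneg hs.le hW)).trans hest
    have h2 : W ≤ s⁻¹ * (C * (ε * cAngle φ ^ 2 * (z * s⁻¹) * ‖f‖)) := by
      rw [← div_eq_inv_mul, le_div_iff₀ hs, mul_comm]
      exact (le_add_of_nonneg_left hY).trans hest
    calc √(2 ^ p) * (W + Y) ≤ √(2 ^ p) * (s⁻¹ * (C * (ε * cAngle φ ^ 2 * (z * s⁻¹) * ‖f‖))
          + C * (ε * cAngle φ ^ 2 * (z * s⁻¹) * ‖f‖)) :=
          mul_le_mul_of_nonneg_left (add_le_add h2 h1) (Real.sqrt_nonneg _)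
      _ = _ := by ring
  · rw [hZinv, sub_eq_add_neg, Real.rpow_add hζpos]
    congr 1
    ring
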